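/- Let $p$ be a prime and let $\Gamma$ be a countable residually finite discrete group. Write $c_0(\Gamma)$ for the ring of formal series $\sum_{\gamma} x_\gamma \gamma$ with $x_\gamma\in\mathbb{Q}_p$ and $|x_\gamma|\to 0$ as $\gamma\to\infty$ (with the convolution product and the norm $\max_\gamma|x_\gamma|$), $\widehat{\mathbb{Z}\Gamma}\subset c_0(\Gamma)$ for the subring of series with coefficients in $\mathbb{Z}_p$, and $K_T(c_0(\Gamma)) = K_1(c_0(\Gamma))/\langle\pm\Gamma\rangle$. Let $\log_p:\mathbb{Q}_p^\times\to\mathbb{Z}_p$ be the $p$-adic logarithm with $\log_p(p)=0$. We write $\Gamma_n\to e$ if $(\Gamma_n)$ is a sequence of normal subgroups of finite index in $\Gamma$ such that the intersection of any infinitely many of them (over any infinite set of indices) is $\{e\}$. For $f\in \mathrm{GL}_r(c_0(\Gamma))$ let $f^{(n)}$ be its image in $\mathrm{GL}_r(\mathbb{Q}_p[\Gamma/\Gamma_n])$, regarded as a $\mathbb{Q}_p$-linear automorphism of $\mathbb{Q}_p[\Gamma/\Gamma_n]^r$. Let $\log_p\det_\Gamma : K_T(c_0(\Gamma))\to\mathbb{Q}_p$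 be a homomorphism which is "reasonable" in the following sense: (i) for all $r$ and all $f\in 1+pM_r(\widehat{\mathbb{Z}\Gamma})$ one has $\log_p\det_\Gamma f = \mathrm{tr}_\Gamma\log f$, where $\log f=-\sum_{\nu\ge1}(1-f)^\nu/\nu$ and $\mathrm{tr}_\Gamma$ is the matrix trace followed by $\sum_\gamma x_\gamma\gamma\mapsto x_e$; (ii) for all $r$, all $f\in\mathrm{GL}_r(c_0(\Gamma))$ and all $\Gamma_n\to e$ one has $\log_p\det_\Gamma f=\lim_{n\to\infty}(\Gamma:\Gamma_n)^{-1}\log_p(\det_{\mathbb{Q}_p}f^{(n)})$ in $\mathbb{Q}_p$. Let $M$ be a left $\mathbb{Z}\Gamma$-module of type $FL$, i.e. one which has a resolution $0\to F_d\to\cdots\to F_0\to M\to 0$ by finitely generated free $\mathbb{Z}\Gamma$-modules. Assume that $M$ is $p$-adically expansive, i.e. $c_0(\Gamma)\otimes_{\mathbb{Z}\Gamma}M=0$, and that $\varprojlim_i M_{p^i}=0$, where $M_{p^i}=\ker(p^i:M\to M)$ and the transition maps are $p:M_{p^{i+1}}\to M_{p^i}$. Then: (a) The $p$-adic $R$-torsion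 $\tau_p^\Gamma(M)\in\mathbb{Q}_p$ is defined and independent of the chosen resolution. That is, for every such resolution $F_\bullet$ and all $\mathbb{Z}\Gamma$-bases $\mathfrak{b}_\nu$ of the $F_\nu$, the complex $c_0(\Gamma)\otimes_{\mathbb{Z}\Gamma}F_\bullet$ is acyclic, its torsion $\tau(F_\bullet,\mathfrak{b}_\bullet)\in K_T(c_0(\Gamma))$ (the class of the matrix of $(\partial+\delta)_{\mathrm{odd}} : c_0(\Gamma)\otimes F_{\mathrm{odd}}\to c_0(\Gamma)\otimes F_{\mathrm{even}}$ in the given bases, for a chain contraction $\delta$) exists, and $\tau_p^\Gamma(M):=\log_p\det_\Gamma(\tau(F_\bullet,\mathfrak{b}_\bullet))$ has the same value for all choices of resolution, bases, their orderings and $\delta$. (b) For every sequence $\Gamma_n\to e$, the groups $H_i(\Gamma_n,M)$ are finite for all $i$ and $n$ and, for each $n$, vanish for almost all $i$, so that $\chi(\Gamma_n,M)=\prod_i|H_i(\Gamma_n,M)|^{(-1)^i}\in\mathbb{Q}^\times$ is defined, and $$\tau_p^\Gamma(M)=\lim_{n\to\infty}(\Gamma:\Gamma_n)^{-1}\log_p\chi(\Gamma_n,M)\quad\text{in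 }\mathbb{Q}_p.$$ -/

import Mathlib

open Filter Topology
open scoped TensorProduct
open scoped MonoidAlgebra

noncomputable section

namespace PadicTorsion

/-! ### The algebra `c₀(Γ)` -/

section C0

variable (p : ℕ) [Fact p.Prime] (Γ : Type*)

/-- The `ℚ_p`-vector space of functions `x : Γ → ℚ_p` with `|x_γ| → 0` as `γ → ∞`, i.e. along the
filter of complements of finite sets. -/
def c0Submodule : Submodule ℚ_[p] (Γ → ℚ_[p]) where
  carrier := {x | Tendsto x cofinite (𝓝 0)}
  add_mem' {x y} hx hy := by
    have h := Tendsto.add hx hy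
    rw [add_zero] at h
    exact h
  zero_mem' := tendsto_const_nhds
  smul_mem' c x hx := by
    have h := Tendsto.const_smul hx c
    rw [smul_zero] at h
    exact h

/-- `c₀(Γ)`: formal series `∑ x_γ γ` with `x_γ ∈ ℚ_p` and `|x_γ| → 0`. -/
def C0 : Type _ := c0Submodule p Γ

instance : AddCommGroup (C0 p Γ) := inferInstanceAs (AddCommGroup (c0Submodule p Γ))

instance : Module ℚ_[p] (C0 p Γ) := inferInstanceAs (Module ℚ_[p] (c0Submodule p Γ))

variable {p Γ}

/-- The series with prescribed coefficients. -/
def C0.mk (x : Γ → ℚ_[p]) (hx : Tendsto x cofinite (𝓝 0)) : C0 p Γ := ⟨x, hx⟩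

/-- The coefficient function of a series. -/
def C0.coeff (x : C0 p Γ) : Γ → ℚ_[p] := x.1

theorem C0.coeff_injective : Function.Injective (C0.coeff : C0 p Γ → Γ → ℚ_[p]) :=
  Subtype.val_injective

theorem C0.ext {x y : C0 p Γ} (h : ∀ γ, x.coeff γ = y.coeff γ) : x = y :=
  C0.coeff_injective (funext h)

theorem C0.tendsto_coeff (x : C0 p Γ) : Tendsto x.coeff cofinite (𝓝 0) := x.2

@[simp] theorem C0.coeff_mk (x : Γ → ℚ_[p]) (hx) : (C0.mk x hx).coeff = x := rfl
@[simp] theorem C0.coeff_zero : (0 : C0 p Γ).coeff = 0 := rfl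
@[simp] theorem C0.coeff_add (x y : C0 p Γ) : (x + y).coeff = x.coeff + y.coeff := rfl
@[simp] theorem C0.coeff_neg (x : C0 p Γ) : (-x).coeff = -x.coeff := rfl
@[simp] theorem C0.coeff_smul (c : ℚ_[p]) (x : C0 p Γ) : (c • x).coeff = c • x.coeff := rfl

theorem C0.summable (x : C0 p Γ) : Summable x.coeff :=
  NonarchimedeanAddGroup.summable_of_tendsto_cofinite_zero x.tendsto_coeff

theorem C0.bddAbove (x : C0 p Γ) : BddAbove (Set.range fun γ => ‖x.coeff γ‖) := by
  have h : Tendsto (fun γ => ‖x.coeff γ‖) cofinite (𝓝 0) := by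
    simpa using x.tendsto_coeff.norm
  have h1 : {γ | ¬ ‖x.coeff γ‖ < 1}.Finite := h.eventually (gt_mem_nhds one_pos)
  obtain ⟨C, hC⟩ := (h1.image fun γ => ‖x.coeff γ‖).bddAbove
  refine ⟨max C 1, ?_⟩
  rintro _ ⟨γ, rfl⟩
  by_cases hγ : ‖x.coeff γ‖ < 1
  · exact hγ.le.trans (le_max_right _ _)
  · exact (hC ⟨γ, hγ, rfl⟩).trans (le_max_left _ _)

/-- The norm `‖∑ x_γ γ‖ = max_γ |x_γ|`. -/
instance : Norm (C0 p Γ) := ⟨fun x => ⨆ γ, ‖x.coeff γ‖⟩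

theorem C0.norm_def (x : C0 p Γ) : ‖x‖ = ⨆ γ, ‖x.coeff γ‖ := rfl

theorem C0.norm_coeff_le (x : C0 p Γ) (γ : Γ) : ‖x.coeff γ‖ ≤ ‖x‖ := le_ciSup x.bddAbove γ

instance : NormedAddCommGroup (C0 p Γ) :=
  AddGroupNorm.toNormedAddCommGroup
    { toFun := fun x => ‖x‖
      map_zero' := by simp [C0.norm_def]
      add_le' := fun x y => by
        refine Real.iSup_le (fun γ => (norm_add_le _ _).trans
          (add_le_add (x.norm_coeff_le γ) (y.norm_coeff_le γ))) ?_
        exact add_nonneg (Real.iSup_nonneg fun _ => norm_nonneg _)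
          (Real.iSup_nonneg fun _ => norm_nonneg _)
      neg' := fun x => by simp [C0.norm_def]
      eq_zero_of_map_eq_zero' := fun x hx => C0.ext fun γ => by
        have := x.norm_coeff_le γ
        rw [show ‖x‖ = 0 from hx] at this
        simpa using this }

open scoped Classical in
/-- The element `γ` of `c₀(Γ)`. -/
def C0.single (γ : Γ) : C0 p Γ :=
  C0.mk (Pi.single γ 1) <| by
    refine tendsto_const_nhds.congr' ?_
    have : ∀ᶠ δ in cofinite, δ ≠ γ := (Set.finite_singleton γ).eventually_cofinite_notMem
    filter_upwards [this] with δ hδ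
    simp [hδ]

open scoped Classical in
theorem C0.coeff_single (γ δ : Γ) : (C0.single γ : C0 p Γ).coeff δ = if δ = γ then 1 else 0 := by
  simp [C0.single, Pi.single_apply]

theorem C0.summable_mul (x y : C0 p Γ) :
    Summable fun q : Γ × Γ => x.coeff q.1 * y.coeff q.2 :=
  haveI : NonarchimedeanRing ℚ_[p] := { is_nonarchimedean := NonarchimedeanAddGroup.is_nonarchimedean }
  x.summable.mul_of_nonarchimedean y.summable

end C0

section Convolution

variable {p : ℕ} [Fact p.Prime] {Γ : Type*} [Group Γ]

theorem C0.summable_conv' (x y : C0 p Γ) :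
    Summable fun q : Γ × Γ => x.coeff q.2 * y.coeff (q.2⁻¹ * q.1) := by
  let e : Γ × Γ ≃ Γ × Γ :=
    { toFun := fun q => (q.2, q.2⁻¹ * q.1)
      invFun := fun q => (q.1 * q.2, q.1)
      left_inv := fun q => by simp
      right_inv := fun q => by simp }
  exact (e.summable_iff (f := fun q : Γ × Γ => x.coeff q.1 * y.coeff q.2)).2 (x.summable_mul y)

theorem C0.summable_conv (x y : C0 p Γ) (γ : Γ) :
    Summable fun α => x.coeff α * y.coeff (α⁻¹ * γ) :=
  (x.summable_conv' y).prod_factor γ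

/-- The convolution product: the coefficient of `x * y` at `γ` is the sum of `x_α y_β` over all
`α β = γ`. -/
instance : Mul (C0 p Γ) :=
  ⟨fun x y => C0.mk (fun γ => ∑' α, x.coeff α * y.coeff (α⁻¹ * γ))
    (x.summable_conv' y).prod.tendsto_cofinite_zero⟩

theorem C0.coeff_mul (x y : C0 p Γ) (γ : Γ) :
    (x * y).coeff γ = ∑' α, x.coeff α * y.coeff (α⁻¹ * γ) := rfl

instance : One (C0 p Γ) := ⟨C0.single 1⟩

theorem C0.coeff_single_mul (γ : Γ) (x : C0 p Γ) (δ : Γ) :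
    (C0.single γ * x).coeff δ = x.coeff (γ⁻¹ * δ) := by
  rw [C0.coeff_mul, tsum_eq_single γ]
  · simp [C0.coeff_single]
  · intro α hα
    simp [C0.coeff_single, hα]

theorem C0.coeff_mul_single (γ : Γ) (x : C0 p Γ) (δ : Γ) :
    (x * C0.single γ).coeff δ = x.coeff (δ * γ⁻¹) := by
  rw [C0.coeff_mul, tsum_eq_single (δ * γ⁻¹)]
  · simp [C0.coeff_single]
  · intro α hα
    have : ¬ α⁻¹ * δ = γ := by
      rintro rfl
      exact hα (by simp)
    simp [C0.coeff_single, this]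

theorem C0.mul_assoc' (x y z : C0 p Γ) : x * y * z = x * (y * z) := by
  refine C0.ext fun γ => ?_
  have key : Summable fun q : Γ × Γ =>
      x.coeff q.2 * y.coeff (q.2⁻¹ * q.1) * z.coeff (q.1⁻¹ * γ) := by
    refine NonarchimedeanAddGroup.summable_of_tendsto_cofinite_zero ?_
    have h0 := (x.summable_conv' y).tendsto_cofinite_zero
    rw [tendsto_zero_iff_norm_tendsto_zero] at h0 ⊢
    refine squeeze_zero (fun _ => norm_nonneg _) (fun q => ?_) 
      (by have h := h0.mul_const ‖z‖; rwa [zero_mul] at h)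
    have hz : ‖z.coeff (q.1⁻¹ * γ)‖ ≤ ‖z‖ := z.norm_coeff_le _
    exact (norm_mul _ _).trans_le (mul_le_mul_of_nonneg_left hz (norm_nonneg _))
  calc (x * y * z).coeff γ
      = ∑' β, ∑' α, x.coeff α * y.coeff (α⁻¹ * β) * z.coeff (β⁻¹ * γ) := by
        rw [C0.coeff_mul]
        refine tsum_congr fun β => ?_
        rw [C0.coeff_mul, tsum_mul_right]
    _ = ∑' α, ∑' β, x.coeff α * y.coeff (α⁻¹ * β) * z.coeff (β⁻¹ * γ) :=
        Summable.tsum_comm (f := fun α β =>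
          x.coeff α * y.coeff (α⁻¹ * β) * z.coeff (β⁻¹ * γ)) key.prod_symm
    _ = (x * (y * z)).coeff γ := by
        rw [C0.coeff_mul]
        refine tsum_congr fun α => ?_
        rw [C0.coeff_mul, ← tsum_mul_left, ← (Equiv.mulLeft α).tsum_eq]
        refine tsum_congr fun δ => ?_
        simp [mul_assoc]

instance : Ring (C0 p Γ) :=
  { (inferInstance : AddCommGroup (C0 p Γ)) with
    mul := (· * ·)
    one := 1
    mul_assoc := C0.mul_assoc'
    one_mul := fun x => C0.ext fun γ => by
      change (C0.single 1 * x).coeff γ = _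
      simp [C0.coeff_single_mul]
    mul_one := fun x => C0.ext fun γ => by
      change (x * C0.single 1).coeff γ = _
      simp [C0.coeff_mul_single]
    zero_mul := fun x => C0.ext fun γ => by simp [C0.coeff_mul]
    mul_zero := fun x => C0.ext fun γ => by simp [C0.coeff_mul]
    left_distrib := fun x y z => C0.ext fun γ => by
      simp only [C0.coeff_mul, C0.coeff_add, Pi.add_apply, mul_add]
      exact (x.summable_conv y γ).tsum_add (x.summable_conv z γ)
    right_distrib := fun x y z => C0.ext fun γ => by
      simp only [C0.coeff_mul, C0.coeff_add, Pi.add_apply, add_mul]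
      exact (x.summable_conv z γ).tsum_add (y.summable_conv z γ) }

instance : Algebra ℚ_[p] (C0 p Γ) :=
  Algebra.ofModule
    (fun c x y => C0.ext fun γ => by
      simp only [C0.coeff_mul, C0.coeff_smul, Pi.smul_apply, smul_eq_mul, ← tsum_mul_left,
        mul_assoc])
    (fun c x y => C0.ext fun γ => by
      simp only [C0.coeff_mul, C0.coeff_smul, Pi.smul_apply, smul_eq_mul, ← tsum_mul_left]
      exact tsum_congr fun α => by ring)

variable (p Γ) in
/-- The inclusion `Γ → c₀(Γ)`, as a homomorphism of monoids. -/
def C0.of : Γ →* C0 p Γ where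
  toFun := C0.single
  map_one' := rfl
  map_mul' γ δ := C0.ext fun ε => by
    simp only [C0.coeff_single_mul, C0.coeff_single]
    congr 1
    rw [inv_mul_eq_iff_eq_mul]

variable (p Γ) in
/-- The inclusion of rings `ℤΓ → c₀(Γ)`. -/
def groupRingToC0 : ℤ[Γ] →+* C0 p Γ :=
  (MonoidAlgebra.lift ℤ (C0 p Γ) Γ (C0.of p Γ)).toRingHom

/-- `tr_Γ (∑ x_γ γ) = x_e`, composed with the trace of matrices. -/
def traceΓ {r : ℕ} (A : Matrix (Fin r) (Fin r) (C0 p Γ)) : ℚ_[p] := A.trace.coeff 1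

/-- The logarithmic series `log u = -∑_{ν ≥ 1} (1 - u)^ν / ν`, for the topology on
`M_r(c₀(Γ))` given by the norm of `c₀(Γ)`. -/
def matrixLog {r : ℕ} (u : Matrix (Fin r) (Fin r) (C0 p Γ)) : Matrix (Fin r) (Fin r) (C0 p Γ) :=
  -∑' ν : ℕ, ((ν + 1 : ℕ) : ℚ_[p])⁻¹ • (1 - u) ^ (ν + 1)

/-- The set `1 + p M_r(A)`, where `A = {x ∈ c₀(Γ) | ‖x‖ ≤ 1}` is the `p`-adic completion of `ℤΓ`
(series with coefficients in `ℤ_p`). -/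
def IsOneUnit {r : ℕ} (u : Matrix (Fin r) (Fin r) (C0 p Γ)) : Prop :=
  ∃ a : Matrix (Fin r) (Fin r) (C0 p Γ), (∀ i j, ‖a i j‖ ≤ 1) ∧ u = 1 + (p : ℚ_[p]) • a

/-- The canonical map `c₀(Γ) → c₀(Γ/N) = ℚ_p[Γ/N]` for a normal subgroup `N` of finite index: the
coefficient of the image at a coset `δ` is the sum of the `x_γ` with `γ ∈ δ`. -/
def C0.toQuotient (N : FiniteIndexNormalSubgroup Γ) (x : C0 p Γ) :
    ℚ_[p][Γ ⧸ N.toSubgroup] :=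
  .ofCoeff (Finsupp.equivFunOnFinite.symm fun δ : Γ ⧸ N.toSubgroup =>
    ∑' γ : {γ : Γ // (γ : Γ ⧸ N.toSubgroup) = δ}, x.coeff γ)

/-- `det_{ℚ_p}(f^{(N)})`: the determinant of the `ℚ_p`-linear endomorphism of `ℚ_p[Γ/N]^r` given by
right multiplication (on row vectors) with the image of the matrix `f` over `ℚ_p[Γ/N]`. -/
def quotientDet (N : FiniteIndexNormalSubgroup Γ) {r : ℕ}
    (f : Matrix (Fin r) (Fin r) (C0 p Γ)) : ℚ_[p] :=
  LinearMap.det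
    ((Matrix.toLinearMapRight' (f.map (C0.toQuotient N))).restrictScalars ℚ_[p])

end Convolution

/-- The branch of the `p`-adic logarithm on `ℚ_p^×` with `log_p p = 0`. For `x = p^v u` with `|u| = 1`
one has `u^(p-1) ∈ 1 + p ℤ_p`, and `log_p x = (p - 1)⁻¹ log (u^(p-1))` with `log` the logarithmic
series. -/
def padicLog (p : ℕ) [Fact p.Prime] (x : ℚ_[p]) : ℚ_[p] :=
  ((p : ℚ_[p]) - 1)⁻¹ *
    -∑' ν : ℕ, ((ν + 1 : ℕ) : ℚ_[p])⁻¹ *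
      (1 - (x * (p : ℚ_[p]) ^ (-x.valuation)) ^ (p - 1)) ^ (ν + 1)

/-- `Γ_n → e`: for every infinite set `I` of indices, the intersection of the `Γ_n`, `n ∈ I`, is
trivial. -/
def TendsToUnit {Γ : Type*} [Group Γ] (N : ℕ → FiniteIndexNormalSubgroup Γ) : Prop :=
  ∀ I : Set ℕ, I.Infinite → ⨅ n ∈ I, (N n).toSubgroup = ⊥

/-! ### `K₁` and its quotient by trivial units -/

section K1

variable (R : Type*) [Ring R]

/-- `GL_r(R)`. -/
abbrev GLr (r : ℕ) : Type _ := (Matrix (Fin r) (Fin r) R)ˣ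

variable {R}

/-- The matrix with upper left block `A` and lower right block the identity. -/
def stabMatrix (r s : ℕ) (A : Matrix (Fin r) (Fin r) R) : Matrix (Fin s) (Fin s) R :=
  fun i j =>
    if h : (i : ℕ) < r ∧ (j : ℕ) < r then A ⟨i, h.1⟩ ⟨j, h.2⟩ else if i = j then 1 else 0

theorem stabMatrix_one (r s : ℕ) : stabMatrix r s (1 : Matrix (Fin r) (Fin r) R) = 1 := by
  ext i j
  by_cases h : (i : ℕ) < r ∧ (j : ℕ) < r
  · simp [stabMatrix, h, Matrix.one_apply, Fin.ext_iff]
  · simp [stabMatrix, h, Matrix.one_apply]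

theorem stabMatrix_mul {r s : ℕ} (hrs : r ≤ s) (A B : Matrix (Fin r) (Fin r) R) :
    stabMatrix r s (A * B) = stabMatrix r s A * stabMatrix r s B := by
  obtain ⟨t, rfl⟩ := Nat.exists_eq_add_of_le hrs
  ext i j
  rw [Matrix.mul_apply, Fin.sum_univ_add]
  refine Fin.addCases (fun i => ?_) (fun i => ?_) i <;>
    refine Fin.addCases (fun j => ?_) (fun j => ?_) j <;>
    simp only [stabMatrix, Matrix.mul_apply, Fin.ext_iff, Fin.val_castAdd, Fin.val_natAdd,
      Fin.is_lt, and_true, dite_true, Fin.eta, not_lt.2 (Nat.le_add_right r _),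
      and_false, dite_false, mul_ite, ite_mul, mul_one, mul_zero, one_mul, zero_mul]
  · rw [Finset.sum_eq_zero (s := (Finset.univ : Finset (Fin t))), add_zero]
    intro x _
    rw [if_neg (by omega)]
  · rw [if_neg (by omega), Finset.sum_eq_zero, Finset.sum_eq_zero, add_zero]
    · intro x _
      split_ifs <;> first | rfl | omega
    · intro x _
      rw [if_neg (by omega)]
  · rw [if_neg (by omega), Finset.sum_eq_zero, Finset.sum_eq_zero, add_zero]
    · intro x _
      rw [if_neg (by omega)]
    · intro x _
      rw [if_neg (by omega)]
  · rw [Finset.sum_eq_zero, zero_add, Finset.sum_eq_single j]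
    · simp
    · intro x _ hx
      rw [if_neg (fun h => hx (Fin.ext (by omega)))]
    · simp
    · intro x _
      rw [if_neg (by omega)]

variable (R) in
/-- The stabilisation homomorphism `GL_r(R) → GL_s(R)`, `A ↦ diag(A, 1)`, for `r ≤ s`. -/
def stab {r s : ℕ} (hrs : r ≤ s) : GLr R r →* GLr R s :=
  Units.map
    { toFun := stabMatrix r s
      map_one' := stabMatrix_one r s
      map_mul' := stabMatrix_mul hrs }

instance : DirectedSystem (GLr R) (fun _ _ h => stab R h) where
  map_self r u := by
    refine Units.ext (Matrix.ext fun i j => ?_)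
    simp [stab, stabMatrix]
  map_map k j i hij hjk u := by
    refine Units.ext (Matrix.ext fun a b => ?_)
    simp only [stab, stabMatrix, Units.coe_map, MonoidHom.coe_mk, OneHom.coe_mk]
    by_cases h : (a : ℕ) < i ∧ (b : ℕ) < i
    · have h' : (a : ℕ) < j ∧ (b : ℕ) < j := ⟨h.1.trans_le hij, h.2.trans_le hij⟩
      simp [h, h']
    · by_cases h' : (a : ℕ) < j ∧ (b : ℕ) < j
      · simp [h, h', Fin.ext_iff]
      · simp [h, h']

variable (R)

/-- `GL_∞(R)`, the union of the `GL_r(R)`. -/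
abbrev GLInf : Type _ := DirectLimit (GLr R) (fun _ _ h => stab R h)

/-- `K₁(R)`, the abelianization of `GL_∞(R)`. -/
abbrev K1 : Type _ := Abelianization (GLInf R)

/-- The canonical homomorphism `GL_r(R) → K₁(R)`. -/
def K1.of (r : ℕ) : GLr R r →* K1 R :=
  Abelianization.of.comp
    { toFun := fun u => (⟦⟨r, u⟩⟧ : GLInf R)
      map_one' := (DirectLimit.one_def (f := fun _ _ h => stab R h) r).symm
      map_mul' := fun u v =>
        (DirectLimit.mul_def (f := fun _ _ h => stab R h) r u v).symm }

/-- The natural map `⟨ ⟩ : Rˣ → K₁(R)`. -/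
def K1.ofUnit : Rˣ →* K1 R :=
  (K1.of R 1).comp (Units.map (Matrix.scalar (Fin 1) : R →+* Matrix (Fin 1) (Fin 1) R).toMonoidHom)

end K1

section KT

variable (p : ℕ) [Fact p.Prime] (Γ : Type*) [Group Γ]

/-- The subgroup `⟨±Γ⟩` of `K₁(c₀(Γ))`. -/
def trivialUnits : Subgroup (K1 (C0 p Γ)) :=
  Subgroup.closure
    {k | ∃ γ : Γ, k = K1.ofUnit _ ((C0.of p Γ).toHomUnits γ) ∨
      k = K1.ofUnit _ (-(C0.of p Γ).toHomUnits γ)}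

/-- `K_T(c₀(Γ)) = K₁(c₀(Γ)) / ⟨±Γ⟩`. -/
abbrev KT : Type _ := K1 (C0 p Γ) ⧸ trivialUnits p Γ

/-- The canonical homomorphism `π : GL_r(c₀(Γ)) → K_T(c₀(Γ))`. -/
def KT.of (r : ℕ) : GLr (C0 p Γ) r →* KT p Γ :=
  (QuotientGroup.mk' (trivialUnits p Γ)).comp (K1.of _ r)

variable {p Γ}

/-- A homomorphism `L : K_T(c₀(Γ)) → ℚ_p` is a reasonable definition of `log_p det_Γ` if
it agrees with `tr_Γ log` on every `1 + p M_r(A)`, with `A` the `p`-adic completion of `ℤΓ`, and if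
`L(f) = lim (Γ : Γ_n)⁻¹ log_p det_{ℚ_p}(f^{(n)})` for all `f ∈ GL_r(c₀(Γ))` and all
`Γ_n → e`. -/
structure IsReasonableLogDet (L : KT p Γ →* Multiplicative ℚ_[p]) : Prop where
  compat : ∀ (r : ℕ) (u : GLr (C0 p Γ) r), IsOneUnit u.val →
    (L (KT.of p Γ r u)).toAdd = traceΓ (matrixLog u.val)
  limit : ∀ (r : ℕ) (f : GLr (C0 p Γ) r) (N : ℕ → FiniteIndexNormalSubgroup Γ), TendsToUnit N →
    Tendsto (fun n => ((N n).toSubgroup.index : ℚ_[p])⁻¹ * padicLog p (quotientDet (N n) f.val))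
      atTop (𝓝 (L (KT.of p Γ r f)).toAdd)

end KT

/-! ### Tensor products `S ⊗_R M` over a noncommutative ring -/

section BaseChange

variable {R S : Type*} [Ring R] [Ring S] (φ : R →+* S)

/-- The `S`-submodule of `S ⊗_ℤ M` generated by the elements `s φ(r) ⊗ m - s ⊗ r m`. -/
def balancing (M : Type*) [AddCommGroup M] [Module R M] : Submodule S (TensorProduct ℤ S M) :=
  Submodule.span S {x | ∃ (s : S) (r : R) (m : M), x = (s * φ r) ⊗ₜ[ℤ] m - s ⊗ₜ[ℤ] (r • m)}

/-- The left `S`-module `S ⊗_R M`, for a left `R`-module `M` and a ring homomorphism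
`φ : R → S` by which `S` is a right `R`-module. -/
def BaseChange (M : Type*) [AddCommGroup M] [Module R M] : Type _ :=
  TensorProduct ℤ S M ⧸ balancing φ M

variable (M : Type*) [AddCommGroup M] [Module R M]
variable {M' : Type*} [AddCommGroup M'] [Module R M']

instance : AddCommGroup (BaseChange φ M) :=
  inferInstanceAs (AddCommGroup (TensorProduct ℤ S M ⧸ balancing φ M))

instance : Module S (BaseChange φ M) :=
  inferInstanceAs (Module S (TensorProduct ℤ S M ⧸ balancing φ M))

/-- The quotient map `S ⊗_ℤ M → S ⊗_R M`. -/
def BaseChange.mkQ : TensorProduct ℤ S M →ₗ[S] BaseChange φ M := (balancing φ M).mkQ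

variable {M}

theorem BaseChange.mkQ_surjective : Function.Surjective (BaseChange.mkQ φ M) :=
  (balancing φ M).mkQ_surjective

/-- The pure tensor `s ⊗ m` in `S ⊗_R M`. -/
def BaseChange.tmul (s : S) (m : M) : BaseChange φ M := BaseChange.mkQ φ M (s ⊗ₜ[ℤ] m)

theorem BaseChange.tmul_smul (s : S) (r : R) (m : M) :
    BaseChange.tmul φ s (r • m) = BaseChange.tmul φ (s * φ r) m :=
  ((Submodule.Quotient.eq (balancing φ M)).2 (Submodule.subset_span ⟨s, r, m, rfl⟩)).symm

theorem BaseChange.smul_tmul (t s : S) (m : M) :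
    t • BaseChange.tmul φ s m = BaseChange.tmul φ (t * s) m := rfl

theorem BaseChange.add_tmul (s t : S) (m : M) :
    BaseChange.tmul φ (s + t) m = BaseChange.tmul φ s m + BaseChange.tmul φ t m := by
  simp only [BaseChange.tmul, TensorProduct.add_tmul, map_add]

theorem BaseChange.tmul_add (s : S) (m n : M) :
    BaseChange.tmul φ s (m + n) = BaseChange.tmul φ s m + BaseChange.tmul φ s n := by
  simp only [BaseChange.tmul, TensorProduct.tmul_add, map_add]

theorem BaseChange.tmul_zero (s : S) : BaseChange.tmul φ s (0 : M) = 0 := by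
  simp only [BaseChange.tmul, TensorProduct.tmul_zero, map_zero]

theorem BaseChange.zero_tmul (m : M) : BaseChange.tmul φ 0 m = 0 := by
  simp only [BaseChange.tmul, TensorProduct.zero_tmul, map_zero]

theorem BaseChange.induction {P : BaseChange φ M → Prop} (x : BaseChange φ M)
    (zero : P 0) (tmul : ∀ s m, P (BaseChange.tmul φ s m)) (add : ∀ x y, P x → P y → P (x + y)) :
    P x := by
  obtain ⟨y, rfl⟩ := BaseChange.mkQ_surjective φ x
  induction y using TensorProduct.induction_on with
  | zero => rwa [map_zero]
  | tmul s m => exact tmul s m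
  | add x y hx hy =>
    rw [map_add]
    exact add _ _ hx hy

section lift

variable {P : Type*} [AddCommGroup P] [Module S P] (f : M →+ P)

/-- The `S`-linear map `S ⊗_ℤ M → P`, `s ⊗ m ↦ s f(m)`. -/
def BaseChange.liftAux : TensorProduct ℤ S M →ₗ[S] P :=
  TensorProduct.AlgebraTensorModule.lift
    (LinearMap.mk₂' S ℤ (fun (s : S) (m : M) => s • f m)
      (fun s t m => add_smul s t _)
      (fun n s m => smul_assoc n s _)
      (fun s m n => by rw [map_add, smul_add])
      (fun n s m => by rw [map_zsmul, smul_comm]))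

/-- The universal property of `S ⊗_R M`. -/
def BaseChange.lift (hf : ∀ (r : R) (m : M), f (r • m) = φ r • f m) : BaseChange φ M →ₗ[S] P :=
  (balancing φ M).liftQ (BaseChange.liftAux f) <| by
    refine Submodule.span_le.2 ?_
    rintro _ ⟨s, r, m, rfl⟩
    simp [BaseChange.liftAux, hf, mul_smul]

theorem BaseChange.lift_tmul (hf : ∀ (r : R) (m : M), f (r • m) = φ r • f m) (s : S) (m : M) :
    BaseChange.lift φ f hf (BaseChange.tmul φ s m) = s • f m := rfl

end lift

/-- The map `id ⊗ f : S ⊗_R M → S ⊗_R M'`. -/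
def BaseChange.map (f : M →ₗ[R] M') : BaseChange φ M →ₗ[S] BaseChange φ M' :=
  BaseChange.lift φ
    { toFun := fun m => BaseChange.tmul φ 1 (f m)
      map_zero' := by rw [map_zero, BaseChange.tmul_zero]
      map_add' := fun m n => by rw [map_add, BaseChange.tmul_add] }
    (fun r m => by
      change BaseChange.tmul φ 1 (f (r • m)) = φ r • BaseChange.tmul φ 1 (f m)
      rw [map_smul, BaseChange.tmul_smul, BaseChange.smul_tmul, one_mul, mul_one])

theorem BaseChange.map_tmul (f : M →ₗ[R] M') (s : S) (m : M) :
    BaseChange.map φ f (BaseChange.tmul φ s m) = BaseChange.tmul φ s (f m) := by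
  change s • BaseChange.tmul φ 1 (f m) = _
  rw [BaseChange.smul_tmul, mul_one]

/-- The coordinates on `S ⊗_R M` given by a basis of `M`. -/
def BaseChange.coords {ι : Type*} (b : Module.Basis ι R M) : BaseChange φ M →ₗ[S] (ι → S) :=
  BaseChange.lift φ (P := ι → S)
    { toFun := fun m i => φ (b.repr m i)
      map_zero' := by ext; simp
      map_add' := fun m n => by ext; simp }
    (fun r m => by ext; simp)

theorem BaseChange.coords_tmul {ι : Type*} (b : Module.Basis ι R M) (s : S) (m : M) (i : ι) :
    BaseChange.coords φ b (BaseChange.tmul φ s m) i = s * φ (b.repr m i) := rfl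

theorem BaseChange.tmul_sum {ι : Type*} (t : Finset ι) (s : S) (m : ι → M) :
    BaseChange.tmul φ s (∑ i ∈ t, m i) = ∑ i ∈ t, BaseChange.tmul φ s (m i) :=
  map_sum (AddMonoidHom.mk' (BaseChange.tmul φ s) (BaseChange.tmul_add φ s)) m t

/-- The basis `1 ⊗ b` of `S ⊗_R M` induced by a finite basis `b` of `M`. -/
def BaseChange.basis {ι : Type*} [Fintype ι] (b : Module.Basis ι R M) :
    Module.Basis ι S (BaseChange φ M) :=
  Module.Basis.ofEquivFun
    { BaseChange.coords φ b with
      invFun := fun c => ∑ i, BaseChange.tmul φ (c i) (b i)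
      left_inv := fun x => by
        change ∑ i, BaseChange.tmul φ (BaseChange.coords φ b x i) (b i) = x
        induction x using BaseChange.induction with
        | zero => simp only [map_zero, Pi.zero_apply, BaseChange.zero_tmul, Finset.sum_const_zero]
        | tmul s m =>
          conv_rhs => rw [← b.sum_repr m]
          simp only [BaseChange.coords_tmul, BaseChange.tmul_sum, BaseChange.tmul_smul]
        | add x y hx hy =>
          simp only [map_add, Pi.add_apply, BaseChange.add_tmul, Finset.sum_add_distrib, hx, hy]
      right_inv := fun c => by
        classical
        change BaseChange.coords φ b (∑ i, BaseChange.tmul φ (c i) (b i)) = c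
        ext j
        simp [BaseChange.coords_tmul, Finsupp.single_apply, apply_ite φ] }

theorem BaseChange.basis_apply {ι : Type*} [Fintype ι] (b : Module.Basis ι R M) (i : ι) :
    BaseChange.basis φ b i = BaseChange.tmul φ 1 (b i) := by
  classical
  rw [BaseChange.basis, Module.Basis.coe_ofEquivFun]
  change ∑ j, BaseChange.tmul φ ((Pi.single i 1 : ι → S) j) (b j) = _
  rw [Finset.sum_eq_single i]
  · simp
  · intro j _ hj
    rw [Pi.single_eq_of_ne hj, BaseChange.zero_tmul]
  · simp

end BaseChange

/-! ### Resolutions and torsion -/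

section Resolution

variable (Γ : Type) [Group Γ] (M : Type) [AddCommGroup M] [Module ℤ[Γ] M]

/-- An exact sequence `0 → F_d → ⋯ → F_0 → M → 0` with finitely generated free left `ℤΓ`-modules
`F_ν`. It is continued by `F_ν = 0` for `ν > d`. -/
structure FLResolution where
  /-- the modules of the resolution -/
  F : ℕ → Type
  [addCommGroup : ∀ ν, AddCommGroup (F ν)]
  [module : ∀ ν, Module ℤ[Γ] (F ν)]
  [free : ∀ ν, Module.Free ℤ[Γ] (F ν)]
  [finite : ∀ ν, Module.Finite ℤ[Γ] (F ν)]
  /-- the length of the resolution -/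
  d : ℕ
  subsingleton : ∀ ν, d < ν → Subsingleton (F ν)
  /-- the differential `F_{ν+1} → F_ν` -/
  bd : ∀ ν, F (ν + 1) →ₗ[ℤ[Γ]] F ν
  /-- the augmentation `F_0 → M` -/
  π : F 0 →ₗ[ℤ[Γ]] M
  surjective : Function.Surjective π
  exact_zero : Function.Exact (bd 0) π
  exact_succ : ∀ ν, Function.Exact (bd (ν + 1)) (bd ν)

attribute [instance] FLResolution.addCommGroup FLResolution.module FLResolution.free
  FLResolution.finite

/-- The `ℤΓ`-module `M` is of type `FL`. -/
def IsTypeFL : Prop := Nonempty (FLResolution Γ M)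

variable {Γ M}

namespace FLResolution

variable (p : ℕ) [Fact p.Prime] (F : FLResolution Γ M)

/-- The module `c₀(Γ) ⊗_{ℤΓ} F_ν`. -/
abbrev C (ν : ℕ) : Type := BaseChange (groupRingToC0 p Γ) (F.F ν)

/-- The differential `id ⊗ ∂` of `c₀(Γ) ⊗_{ℤΓ} F_•`. -/
def bdC (ν : ℕ) : F.C p (ν + 1) →ₗ[C0 p Γ] F.C p ν := BaseChange.map _ (F.bd ν)

/-- The complex `0 → c₀(Γ) ⊗_{ℤΓ} F_d → ⋯ → c₀(Γ) ⊗_{ℤΓ} F_0 → 0` is acyclic. -/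
def IsAcyclic : Prop :=
  Function.Surjective (F.bdC p 0) ∧ ∀ ν, Function.Exact (F.bdC p (ν + 1)) (F.bdC p ν)

variable {p F} in
/-- A chain contraction of `c₀(Γ) ⊗_{ℤΓ} F_•`: a `c₀(Γ)`-linear map `δ` of degree one with
`δ ∂ + ∂ δ = id`. -/
def IsContraction (δ : ∀ ν, F.C p ν →ₗ[C0 p Γ] F.C p (ν + 1)) : Prop :=
  F.bdC p 0 ∘ₗ δ 0 = LinearMap.id ∧
    ∀ ν, δ ν ∘ₗ F.bdC p ν + F.bdC p (ν + 1) ∘ₗ δ (ν + 1) = LinearMap.id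

/-- `c₀(Γ) ⊗_{ℤΓ} F_odd`, where `F_odd = F_1 ⊕ F_3 ⊕ ⋯`. -/
abbrev COdd : Type := Π₀ k : ℕ, F.C p (2 * k + 1)

/-- `c₀(Γ) ⊗_{ℤΓ} F_even`, where `F_even = F_0 ⊕ F_2 ⊕ ⋯`. -/
abbrev CEven : Type := Π₀ k : ℕ, F.C p (2 * k)

variable {p F} in
/-- The map `(∂ + δ)_odd : c₀(Γ) ⊗ F_odd → c₀(Γ) ⊗ F_even`. -/
def oddMap (δ : ∀ ν, F.C p ν →ₗ[C0 p Γ] F.C p (ν + 1)) : F.COdd p →ₗ[C0 p Γ] F.CEven p :=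
  DFinsupp.lsum ℕ fun k =>
    DFinsupp.lsingle (M := fun k => F.C p (2 * k)) k ∘ₗ F.bdC p (2 * k) +
      DFinsupp.lsingle (M := fun k => F.C p (2 * k)) (k + 1) ∘ₗ δ (2 * k + 1)

variable {F} {n : ℕ → ℕ} (b : ∀ ν, Module.Basis (Fin (n ν)) ℤ[Γ] (F.F ν))

/-- The basis `1 ⊗ 𝔟_odd` of `c₀(Γ) ⊗ F_odd`, where `𝔟_odd = 𝔟_1 ∪ 𝔟_3 ∪ ⋯`. -/
def basisOdd : Module.Basis (Σ k : ℕ, Fin (n (2 * k + 1))) (C0 p Γ) (F.COdd p) :=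
  DFinsupp.basis fun k => BaseChange.basis _ (b (2 * k + 1))

/-- The basis `1 ⊗ 𝔟_even` of `c₀(Γ) ⊗ F_even`, where `𝔟_even = 𝔟_0 ∪ 𝔟_2 ∪ ⋯`. -/
def basisEven : Module.Basis (Σ k : ℕ, Fin (n (2 * k))) (C0 p Γ) (F.CEven p) :=
  DFinsupp.basis fun k => BaseChange.basis _ (b (2 * k))

/-- `t ∈ K_T(c₀(Γ))` is the torsion `τ(F_•, 𝔟_•)` of the based complex `c₀(Γ) ⊗_{ℤΓ} F_•`: for some
chain contraction `δ` and some orderings of `𝔟_odd` and `𝔟_even`, it is the class of the matrix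
`(a_ij) ∈ GL_r(c₀(Γ))` of `(∂ + δ)_odd`, defined by `e_i ↦ ∑_j a_ij e_j`. -/
def IsTorsion (t : KT p Γ) : Prop :=
  ∃ (δ : ∀ ν, F.C p ν →ₗ[C0 p Γ] F.C p (ν + 1)) (r : ℕ)
    (eOdd : (Σ k : ℕ, Fin (n (2 * k + 1))) ≃ Fin r) (eEven : (Σ k : ℕ, Fin (n (2 * k))) ≃ Fin r)
    (a : GLr (C0 p Γ) r), IsContraction δ ∧
    (∀ i j, a.val i j = (basisEven p b).repr (oddMap δ (basisOdd p b (eOdd.symm i)))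
      (eEven.symm j)) ∧
    t = KT.of p Γ r a

end FLResolution

/-- Relative to the homomorphism `L = log_p det_Γ` on `K_T(c₀(Γ))`, the `p`-adic `R`-torsion of `M`
is defined and equal to `τ`: for every `FL`-resolution `F_•` of `M`, the complex
`c₀(Γ) ⊗_{ℤΓ} F_•` is acyclic, and for all bases `𝔟_•` its torsion exists and is mapped
to `τ` by `L`. -/
def HasPadicTorsion {p : ℕ} [Fact p.Prime] (L : KT p Γ →* Multiplicative ℚ_[p]) (M : Type)
    [AddCommGroup M] [Module ℤ[Γ] M] (τ : ℚ_[p]) : Prop :=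
  ∀ F : FLResolution Γ M, F.IsAcyclic p ∧
    ∀ (n : ℕ → ℕ) (b : ∀ ν, Module.Basis (Fin (n ν)) ℤ[Γ] (F.F ν)),
      (∃ t, FLResolution.IsTorsion p b t) ∧
        ∀ t, FLResolution.IsTorsion p b t → (L t).toAdd = τ

variable (Γ M)

/-- The `ℤΓ`-module `M` (of type `FL`) is `p`-adically expansive: `c₀(Γ) ⊗_{ℤΓ} M = 0`. -/
def IsPadicallyExpansive (p : ℕ) [Fact p.Prime] : Prop :=
  Subsingleton (BaseChange (groupRingToC0 p Γ) M)

/-- The projective limit of the groups `M_{p^i} = ker (p^i : M → M)` along the maps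
`p : M_{p^{i+1}} → M_{p^i}`. -/
def limTorsion (p : ℕ) (M : Type*) [AddCommGroup M] : AddSubgroup (ℕ → M) where
  carrier := {m | ∀ i, p ^ i • m i = 0 ∧ p • m (i + 1) = m i}
  add_mem' {x y} hx hy i := by
    simp only [Pi.add_apply, smul_add, (hx i).1, (hx i).2, (hy i).1, (hy i).2, add_zero, and_self]
  zero_mem' i := by simp
  neg_mem' {x} hx i := by
    simp only [Pi.neg_apply, smul_neg, (hx i).1, (hx i).2, neg_zero, and_self]

/-! ### Multiplicative Euler characteristics -/

variable {Γ}

/-- The homology group `H_i(N, M)` of the subgroup `N` of `Γ`. -/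
abbrev H (N : Subgroup Γ) (i : ℕ) : Type :=
  groupHomology (Rep.of ((Representation.ofModule' (k := ℤ) (G := Γ) M).comp N.subtype)) i

/-- The multiplicative Euler characteristic `χ(N, M)` is defined: the groups `H_i(N, M)` are
finite, and almost all of them vanish. -/
def IsEulerDefined (N : Subgroup Γ) : Prop :=
  (∀ i, Finite (H M N i)) ∧ ∀ᶠ i in atTop, Subsingleton (H M N i)

/-- The multiplicative Euler characteristic `χ(N, M) = ∏_i |H_i(N, M)|^((-1)^i)`. -/
def eulerChar (N : Subgroup Γ) : ℚ := ∏ᶠ i : ℕ, (Nat.card (H M N i) : ℚ) ^ ((-1 : ℤ) ^ i)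

end Resolution

end PadicTorsion

end

/-! Everything rests on one identity over the finite quotients: if `a` is a matrix of (∂ + δ)_odd,
then the determinant of its image over ℚ_p[Γ/N] is ±χ(N, M)
(`FLResolution.quotientDet_eq_eulerChar`). Since the p-adic logarithm ignores signs
(`padicLog_neg`), the limit property of L turns this into L(t) = lim (Γ : Γ_n)⁻¹ log_p χ(Γ_n, M) for
every torsion class t. The right-hand side involves M only. As Γ is countable and residually finite,
at least one sequence Γ_n → e exists (`exists_tendsToUnit`), so uniqueness of limits gives the
independence of resolution, bases, orderings and δ, with no comparison of resolutions inside K₁.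

For the identity, the N-coinvariants of the resolution form a complex of lattices ℤ[Γ/N]^k. Its
homology is H_i(N, M), by dimension shifting and the vanishing of the higher homology of free
modules (`isZero_groupHomology_resRep`, `FLResolution.card_H`). Over ℚ_p it acquires a contraction,
the image of δ. What remains is linear algebra (`det_contraction`). If δ² = 0, then ∂ + δ carries
one basis made of integral cycles and of lifts of cycles to another such basis. The determinant of
each is, up to sign, the inverse of a product of elementary divisors of boundaries in cycles, so the
determinant of ∂ + δ is a quotient of orders of homology groups. A general δ changes ∂ + δ only by a
unipotent factor. Finiteness of the homology comes out of the same argument.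

Acyclicity of c₀(Γ) ⊗ F_• (`FLResolution.isAcyclic`) is right exactness at degree 0. In positive
degrees it is successive approximation: a cycle with ℤ_p-coefficients agrees modulo p with some u ∈
F_ν; u is corrected by a multiple of p to a cycle of F_•, hence to a boundary; the remainder is p
times another integral cycle, and the resulting series converges. For ν ≥ 2 the correction is
possible because the free modules have no p-torsion and F_• is exact. For ν = 1 the obstruction is a
component of an element of lim M_{p^i}, which is zero by hypothesis (`FLResolution.bd_eq_of_cycle`).
-/

noncomputable section

namespace PadicTorsion

/-! ### Determinants of contractions of complexes of lattices -/

section Lattice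

open Module

variable {K : Type*} [Field K] {Λ V : Type*} [AddCommGroup Λ] [AddCommGroup V] [Module K V]

/-- A basis of `Λ` adapted to the extension `0 → ker d → Λ → range d → 0`. -/
theorem exists_basis_ker_range (d : Λ →ₗ[ℤ] Λ) {κ κ' : Type*}
    (z : Basis κ ℤ (LinearMap.ker d)) (s : Basis κ' ℤ (LinearMap.range d)) :
    ∃ β : Basis (κ ⊕ κ') ℤ Λ, (∀ i, β (Sum.inl i) = z i) ∧ ∀ i, d (β (Sum.inr i)) = s i := by
  have : Module.Free ℤ (LinearMap.range d) := Module.Free.of_basis s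
  obtain ⟨σ, hσ⟩ := Module.projective_lifting_property d.rangeRestrict LinearMap.id
    d.surjective_rangeRestrict
  have hσ' : ∀ y, d (σ y) = y := fun y => congrArg Subtype.val (LinearMap.congr_fun hσ y)
  let e : (LinearMap.ker d × LinearMap.range d) ≃ₗ[ℤ] Λ :=
    { toFun := fun x => x.1 + σ x.2
      map_add' := fun x y => by simp; abel
      map_smul' := fun c x => by simp
      invFun := fun x => (⟨x - σ (d.rangeRestrict x), by simp [hσ']⟩, d.rangeRestrict x)
      left_inv := fun x => by
        have h : d.rangeRestrict (x.1 + σ x.2) = x.2 := by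
          ext
          simp [hσ']
        simp only [h]
        ext <;> simp
      right_inv := fun x => by simp }
  refine ⟨(z.prod s).map e, fun i => ?_, fun i => ?_⟩
  · simp [e]
  · simp [e, hσ']

variable {ι : Type*} [Fintype ι] [DecidableEq ι] (b : Basis ι ℤ Λ) (c : Basis ι K V)
  (j : Λ →ₗ[ℤ] V)

theorem repr_lattice (hj : ∀ i, j (b i) = c i) (x : Λ) (i : ι) :
    c.repr (j x) i = (b.repr x i : K) := by
  conv_lhs => rw [← b.sum_repr x]
  rw [map_sum, map_sum, Finsupp.finsetSum_apply, Finset.sum_eq_single i]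
  · rw [map_smul, hj, ← Int.cast_smul_eq_zsmul K, map_smul]
    simp
  · intro k _ hk
    rw [map_smul, hj, ← Int.cast_smul_eq_zsmul K, map_smul]
    simp [Finsupp.single_eq_of_ne' hk]
  · simp

theorem det_lattice (hj : ∀ i, j (b i) = c i) (v : ι → Λ) :
    c.det (j ∘ v) = (b.det v : K) := by
  rw [Basis.det_apply, Basis.det_apply]
  change _ = Int.castRingHom K _
  rw [RingHom.map_det]
  congr 1
  ext i k
  simp [Basis.toMatrix_apply, repr_lattice b c j hj]

/-- The change of basis is invertible over ℤ, so its determinant is a unit of ℤ. This is the source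
of the sign ambiguity in all determinants below. -/
theorem det_lattice_basis (hj : ∀ i, j (b i) = c i) {κ : Type*} (β : Basis κ ℤ Λ) (e : κ ≃ ι) :
    c.det (j ∘ β ∘ e.symm) = 1 ∨ c.det (j ∘ β ∘ e.symm) = -1 := by
  have h := b.isUnit_det (β.reindex e)
  rw [det_lattice b c j hj (β ∘ e.symm)]
  rw [Basis.coe_reindex] at h
  rcases Int.isUnit_iff.1 h with h | h <;> simp [h]

theorem exists_basis_lattice (hj : ∀ i, j (b i) = c i) {κ : Type*} (β : Basis κ ℤ Λ) :
    ∃ γ : Basis κ K V, ∀ i, γ i = j (β i) := by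
  let e : κ ≃ ι := β.indexEquiv b
  have hu : IsUnit (c.det (j ∘ β ∘ e.symm)) := by
    rcases det_lattice_basis b c j hj β e with h | h <;> rw [h]
    · exact isUnit_one
    · exact isUnit_one.neg
  obtain ⟨h1, h2⟩ := c.is_basis_iff_det.2 hu
  refine ⟨(Basis.mk h1 h2.ge).reindex e.symm, fun i => by simp⟩

/-- The image of `d` is free over ℤ, so the kernel splits off and `z` extends to a basis of the
whole lattice, which stays a basis over `K`. -/
theorem linearIndependent_lattice_ker (hj : ∀ i, j (b i) = c i) (d : Λ →ₗ[ℤ] Λ) {κ : Type*}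
    (z : Basis κ ℤ (LinearMap.ker d)) : LinearIndependent K fun i => j (z i) := by
  have := Module.Free.of_basis b
  have := Module.Finite.of_basis b
  obtain ⟨β, hβ, -⟩ := exists_basis_ker_range d z
    (Module.Free.chooseBasis ℤ (LinearMap.range d))
  obtain ⟨γ, hγ⟩ := exists_basis_lattice b c j hj β
  have := γ.linearIndependent.comp _ Sum.inl_injective
  simpa [Function.comp_def, hγ, hβ] using this

/-- Simultaneous bases of the cycles and the boundaries of a rationally acyclic lattice complex. -/
theorem exists_smith_basis [CharZero K] (hj : ∀ i, j (b i) = c i) (d d' : Λ →ₗ[ℤ] Λ)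
    (hdd : d' ∘ₗ d = 0)
    (D D' : V →ₗ[K] V) (hD : ∀ x, D (j x) = j (d x)) (hD' : ∀ x, D' (j x) = j (d' x))
    (hex : ∀ x, D' x = 0 → ∃ y, D y = x) :
    ∃ (n : ℕ) (z : Basis (Fin n) ℤ (LinearMap.ker d')) (a : Fin n → ℤ)
      (s : Basis (Fin n) ℤ (LinearMap.range d)), (∀ i, a i ≠ 0) ∧ (∀ i, (s i : Λ) = a i • z i) ∧
      ((∏ i, a i).natAbs =
        (LinearMap.range d).toAddSubgroup.relIndex (LinearMap.ker d').toAddSubgroup) := by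
  have hle : LinearMap.range d ≤ LinearMap.ker d' := by
    rintro _ ⟨x, rfl⟩
    exact LinearMap.congr_fun hdd x
  obtain ⟨n, m, snf⟩ := Submodule.smithNormalFormOfLE b _ _ hle
  have hli := linearIndependent_lattice_ker b c j hj d' snf.bM
  -- Boundaries have full rank in the cycles. A basis cycle missed by the Smith form is a rational
  -- boundary, hence lies in the span of the basis cycles that are hit, against linear independence.
  have hsurj : Function.Surjective snf.f := by
    intro i₀
    by_contra hi₀
    push Not at hi₀
    have hnot := (linearIndependent_iff_notMem_span.1 hli) i₀
    apply hnot
    obtain ⟨y, hy⟩ := hex (j (snf.bM i₀)) (by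
      rw [hD', LinearMap.mem_ker.1 (snf.bM i₀).2, map_zero])
    rw [← hy, ← c.sum_repr y, map_sum]
    refine Submodule.sum_mem _ fun k _ => ?_
    rw [map_smul]
    refine Submodule.smul_mem _ _ ?_
    rw [← hj, hD]
    let m₀ : Submodule.comap (LinearMap.ker d').subtype (LinearMap.range d) :=
      ⟨⟨d (b k), hle ⟨_, rfl⟩⟩, ⟨b k, rfl⟩⟩
    have hm : ((m₀ : LinearMap.ker d') : Λ) = d (b k) := rfl
    rw [← hm, ← snf.bN.sum_repr m₀]
    simp only [Submodule.coe_sum, Submodule.coe_smul, map_sum]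
    refine Submodule.sum_mem _ fun l _ => ?_
    rw [map_smul, snf.snf, Submodule.coe_smul, map_smul, ← Int.cast_smul_eq_zsmul K,
      ← Int.cast_smul_eq_zsmul K]
    refine Submodule.smul_mem _ _ (Submodule.smul_mem _ _ (Submodule.subset_span ?_))
    exact ⟨snf.f l, ⟨trivial, fun h => hi₀ l h⟩, rfl⟩
  let f : Fin m ≃ Fin n := Equiv.ofBijective snf.f ⟨snf.f.injective, hsurj⟩
  let bN := snf.bN.reindex f
  have hbN : ∀ i, ((bN i : LinearMap.ker d') : Λ) = snf.a (f.symm i) • (snf.bM i : Λ) := by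
    intro i
    have h := snf.snf (f.symm i)
    have h2 : snf.f (f.symm i) = i := f.apply_symm_apply i
    rw [h2] at h
    rw [Basis.reindex_apply, h, Submodule.coe_smul]
  let s : Basis (Fin n) ℤ (LinearMap.range d) :=
    bN.map (Submodule.comapSubtypeEquivOfLe hle)
  have hs : ∀ i, (s i : Λ) = ((bN i : LinearMap.ker d') : Λ) := fun i => rfl
  refine ⟨n, snf.bM, fun i => snf.a (f.symm i), s, fun i h0 => ?_, fun i => ?_, ?_⟩
  · refine s.ne_zero i (Subtype.ext ?_)
    rw [hs, hbN, show snf.a (f.symm i) = 0 from h0, zero_smul]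
    rfl
  · rw [hs, hbN]
  · have := Module.Free.of_basis snf.bM
    have := Module.Finite.of_basis snf.bM
    have h := Submodule.natAbs_det_basis_change snf.bM _ bN
    have h3 : ((↑) ∘ bN : Fin n → LinearMap.ker d') =
        fun i => snf.a (f.symm i) • snf.bM i := by
      ext i
      simp [hbN]
    rw [h3, AlternatingMap.map_smul_univ, Basis.det_self, smul_eq_mul, mul_one] at h
    exact h

/-- The determinant of a basis made from a basis `z` of the lattice of cycles and rational lifts
`w` of cycles `z'`. -/
theorem det_cycles_lifts [CharZero K] (hj : ∀ i, j (b i) = c i) (d : Λ →ₗ[ℤ] Λ)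
    (D : V →ₗ[K] V) (hD : ∀ x, D (j x) = j (d x)) {κ κ' : Type*} [Fintype κ] [Fintype κ']
    (z : Basis κ ℤ (LinearMap.ker d)) (s : Basis κ' ℤ (LinearMap.range d)) (z' : κ' → Λ)
    (a : κ' → ℤ) (ha : ∀ i, a i ≠ 0) (hs : ∀ i, (s i : Λ) = a i • z' i)
    (hli : LinearIndependent K fun i => j (z' i)) (w : κ' → V) (hw : ∀ i, D (w i) = j (z' i)) :
    Nonempty (κ ⊕ κ' ≃ ι) ∧ ∀ e : κ ⊕ κ' ≃ ι,
      c.det (Sum.elim (fun i => j (z i)) w ∘ e.symm) * (∏ i, a i : ℤ) = 1 ∨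
      c.det (Sum.elim (fun i => j (z i)) w ∘ e.symm) * (∏ i, a i : ℤ) = -1 := by
  classical
  obtain ⟨β, hβ1, hβ2⟩ := exists_basis_ker_range d z s
  refine ⟨⟨β.indexEquiv b⟩, fun e => ?_⟩
  obtain ⟨γ, hγ⟩ := exists_basis_lattice b c j hj β
  set u : κ ⊕ κ' → V := Sum.elim (fun i => j (z i)) w with hu
  have hdet : c.det (u ∘ e.symm) = c.det (j ∘ β ∘ e.symm) * γ.det u := by
    have h := congrArg (fun f => f (u ∘ e.symm))
      (AlternatingMap.eq_smul_basis_det (γ.reindex e) c.det)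
    simp only [AlternatingMap.smul_apply, smul_eq_mul] at h
    rw [h, Basis.det_reindex, Function.comp_assoc, e.symm_comp_self, Function.comp_id]
    congr 2
    ext i
    simp [hγ]
  have hDγ1 : ∀ i, D (γ (Sum.inl i)) = 0 := fun i => by
    rw [hγ, hD, hβ1, LinearMap.mem_ker.1 (z i).2, map_zero]
  have hDγ2 : ∀ i, D (γ (Sum.inr i)) = (a i : K) • j (z' i) := fun i => by
    rw [hγ, hD, hβ2, hs, map_zsmul, Int.cast_smul_eq_zsmul]
  -- Compare the two expansions of D(w_i) in the independent vectors j(z'_k): modulo the kernel of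
  -- D, w_i is a_i⁻¹ times the adapted basis vector.
  have hcoord : ∀ i k, γ.repr (w i) (Sum.inr k) * (a k : K) = if i = k then 1 else 0 := by
    intro i k
    have h := hw i
    rw [← γ.sum_repr (w i), map_sum, Fintype.sum_sum_type] at h
    simp only [map_smul, hDγ1, hDγ2, smul_zero, Finset.sum_const_zero, zero_add, smul_smul] at h
    have h' := sub_eq_zero.2 h
    have h2 : j (z' i) = ∑ l, (if i = l then (1 : K) else 0) • j (z' l) := by simp
    rw [h2, ← Finset.sum_sub_distrib] at h'
    simp only [← sub_smul] at h'
    exact sub_eq_zero.1 (Fintype.linearIndependent_iff.1 hli _ h' k)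
  have hγdet : γ.det u * (∏ i, a i : ℤ) = 1 := by
    -- The kernel part is unchanged and the lifts contribute a_i⁻¹ on the diagonal; the upper right
    -- block is arbitrary and irrelevant for the determinant.
    have hM : γ.toMatrix u = Matrix.fromBlocks 1
        (Matrix.of fun i k => γ.repr (w k) (Sum.inl i)) 0
        (Matrix.diagonal fun i => ((a i : K))⁻¹) := by
      have hz : ∀ k, j (z k) = γ (Sum.inl k) := fun k => by rw [hγ, hβ1]
      ext (i | i) (k | k)
      · simp [Basis.toMatrix_apply, hu, hz, Finsupp.single_apply, Matrix.one_apply, eq_comm]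
      · simp [Basis.toMatrix_apply, hu]
      · simp [Basis.toMatrix_apply, hu, hz]
      · have h0 : (a i : K) ≠ 0 := Int.cast_ne_zero.2 (ha i)
        have h1 := eq_div_of_mul_eq h0 (hcoord k i)
        simp only [Basis.toMatrix_apply, hu, Sum.elim_inr, Matrix.fromBlocks_apply₂₂,
          Matrix.diagonal_apply, h1]
        by_cases hik : k = i
        · simp [hik]
        · simp [hik, Ne.symm hik]
    rw [Basis.det_apply, hM, Matrix.det_fromBlocks_zero₂₁, Matrix.det_one, one_mul,
      Matrix.det_diagonal, Int.cast_prod, ← Finset.prod_mul_distrib]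
    exact Finset.prod_eq_one fun i _ => inv_mul_cancel₀ (Int.cast_ne_zero.2 (ha i))
  rw [hdet, mul_assoc, hγdet, mul_one]
  exact det_lattice_basis b c j hj β e

/-- The determinant of `∂ + δ` for a two-periodic complex of lattices and a rational contraction
`δ` with `δ² = 0`. -/
theorem det_contraction_of_sq_zero [CharZero K] (hj : ∀ i, j (b i) = c i) (d d' : Λ →ₗ[ℤ] Λ)
    (hdd : d' ∘ₗ d = 0) (hdd' : d ∘ₗ d' = 0)
    (D D' δ δ' : V →ₗ[K] V) (hD : ∀ x, D (j x) = j (d x)) (hD' : ∀ x, D' (j x) = j (d' x))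
    (h1 : ∀ x, D' (δ x) + δ' (D x) = x) (h2 : ∀ x, D (δ' x) + δ (D' x) = x)
    (hδ : ∀ x, δ (δ' x) = 0) :
    (LinearMap.range d).toAddSubgroup.relIndex (LinearMap.ker d').toAddSubgroup ≠ 0 ∧
    (LinearMap.range d').toAddSubgroup.relIndex (LinearMap.ker d).toAddSubgroup ≠ 0 ∧
    (LinearMap.det (D + δ) *
        (LinearMap.range d').toAddSubgroup.relIndex (LinearMap.ker d).toAddSubgroup =
      (LinearMap.range d).toAddSubgroup.relIndex (LinearMap.ker d').toAddSubgroup ∨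
     LinearMap.det (D + δ) *
        (LinearMap.range d').toAddSubgroup.relIndex (LinearMap.ker d).toAddSubgroup =
      -(LinearMap.range d).toAddSubgroup.relIndex (LinearMap.ker d').toAddSubgroup) := by
  obtain ⟨n, z, a, s, ha, hs, hidx⟩ := exists_smith_basis b c j hj d d' hdd D D' hD hD'
    (fun x hx => ⟨δ' x, by simpa [hx] using h2 x⟩)
  obtain ⟨n', z', a', s', ha', hs', hidx'⟩ := exists_smith_basis b c j hj d' d hdd' D' D hD' hD
    (fun x hx => ⟨δ x, by simpa [hx] using h1 x⟩)
  have hDz : ∀ i, D (j (z' i)) = 0 := fun i => by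
    rw [hD, LinearMap.mem_ker.1 (z' i).2, map_zero]
  have hDz' : ∀ i, D' (j (z i)) = 0 := fun i => by
    rw [hD', LinearMap.mem_ker.1 (z i).2, map_zero]
  obtain ⟨⟨e⟩, he⟩ := det_cycles_lifts b c j hj d D hD z' s (fun i => z i) a ha hs
    (linearIndependent_lattice_ker b c j hj d' z) (fun i => δ' (j (z i)))
    (fun i => by simpa [hDz'] using h2 (j (z i)))
  obtain ⟨-, he'⟩ := det_cycles_lifts b c j hj d' D' hD' z s' (fun i => z' i) a' ha' hs'
    (linearIndependent_lattice_ker b c j hj d z') (fun i => δ (j (z' i)))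
    (fun i => by simpa [hDz] using h1 (j (z' i)))
  have he := he e
  have he' := he' ((Equiv.sumComm _ _).trans e)
  -- D + δ sends z' to δ z' because D z' = 0, and δ' z to z because D' z = 0 and δ δ' = 0. It thus
  -- maps one basis of cycles and lifts to the other with the two blocks swapped, which
  -- `Equiv.sumComm` records.
  have hcomp : (D + δ) ∘ (Sum.elim (fun i => j (z' i)) (fun i => δ' (j (z i))) ∘ e.symm) =
      Sum.elim (fun i => j (z i)) (fun i => δ (j (z' i))) ∘
        ((Equiv.sumComm _ _).trans e).symm := by
    funext i
    rcases h : e.symm i with k | k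
    · simp [h, hDz]
    · have := h2 (j (z k))
      rw [hDz', map_zero, add_zero] at this
      simp [h, hδ, this]
  have hdet := c.det_comp (D + δ)
    (Sum.elim (fun i => j (z' i)) (fun i => δ' (j (z i))) ∘ e.symm)
  rw [hcomp] at hdet
  have hA : ∏ i, a i ≠ 0 := Finset.prod_ne_zero_iff.2 fun i _ => ha i
  have hA' : ∏ i, a' i ≠ 0 := Finset.prod_ne_zero_iff.2 fun i _ => ha' i
  rw [← hidx, ← hidx']
  refine ⟨by simpa using hA, by simpa using hA', ?_⟩
  set X := c.det (Sum.elim (fun i => j (z' i)) (fun i => δ' (j (z i))) ∘ e.symm)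
  set Y := c.det (Sum.elim (fun i => j (z i)) (fun i => δ (j (z' i))) ∘
        ((Equiv.sumComm _ _).trans e).symm)
  have hcast : ∀ m : ℤ, ((m.natAbs : ℕ) : K) = m ∨ ((m.natAbs : ℕ) : K) = -m := by
    intro m
    rcases Int.natAbs_eq m with h | h
    · left
      conv_rhs => rw [h]
      simp
    · right
      conv_rhs => rw [h]
      simp
  have key : LinearMap.det (D + δ) * (∏ i, a' i : ℤ) = (∏ i, a i : ℤ) ∨
      LinearMap.det (D + δ) * (∏ i, a' i : ℤ) = -(∏ i, a i : ℤ) := by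
    rcases he with he | he <;> rcases he' with he' | he' <;> rw [hdet] at he'
    · left; linear_combination (-(∏ i, a i : ℤ) : K) * -he' -
        (LinearMap.det (D + δ) * (∏ i, a' i : ℤ) : K) * he
    · right; linear_combination (-(∏ i, a i : ℤ) : K) * -he' -
        (LinearMap.det (D + δ) * (∏ i, a' i : ℤ) : K) * he
    · right; linear_combination ((∏ i, a i : ℤ) : K) * -he' +
        (LinearMap.det (D + δ) * (∏ i, a' i : ℤ) : K) * he
    · left; linear_combination ((∏ i, a i : ℤ) : K) * -he' +
        (LinearMap.det (D + δ) * (∏ i, a' i : ℤ) : K) * he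
  rcases hcast (∏ i, a i) with h | h <;> rcases hcast (∏ i, a' i) with h' | h' <;>
    rcases key with key | key <;> rw [h, h', ← sub_eq_zero, ← sub_eq_zero (b := -_)] <;>
    first
      | (left; linear_combination key)
      | (right; linear_combination key)
      | (left; linear_combination -key)
      | (right; linear_combination -key)

/-- The determinant of `∂ + δ` for a two-periodic complex of lattices and a rational contraction
`δ` with `δ²` nilpotent. -/
theorem det_contraction [CharZero K] (hj : ∀ i, j (b i) = c i) (d d' : Λ →ₗ[ℤ] Λ)
    (hdd : d' ∘ₗ d = 0) (hdd' : d ∘ₗ d' = 0)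
    (D D' δ δ' : Module.End K V) (hD : ∀ x, D (j x) = j (d x)) (hD' : ∀ x, D' (j x) = j (d' x))
    (h1 : D' * δ + δ' * D = 1) (h2 : D * δ' + δ * D' = 1)
    (hδ : IsNilpotent (δ * δ')) :
    (LinearMap.range d).toAddSubgroup.relIndex (LinearMap.ker d').toAddSubgroup ≠ 0 ∧
    (LinearMap.range d').toAddSubgroup.relIndex (LinearMap.ker d).toAddSubgroup ≠ 0 ∧
    (LinearMap.det (D + δ) *
        (LinearMap.range d').toAddSubgroup.relIndex (LinearMap.ker d).toAddSubgroup =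
      (LinearMap.range d).toAddSubgroup.relIndex (LinearMap.ker d').toAddSubgroup ∨
     LinearMap.det (D + δ) *
        (LinearMap.range d').toAddSubgroup.relIndex (LinearMap.ker d).toAddSubgroup =
      -(LinearMap.range d).toAddSubgroup.relIndex (LinearMap.ker d').toAddSubgroup) := by
  have hjb : ∀ i, c i = j (b i) := fun i => (hj i).symm
  have hDD : D' * D = 0 := c.ext fun i => by
    rw [hjb, Module.End.mul_apply, hD, hD', show d' (d (b i)) = 0 from LinearMap.congr_fun hdd _]
    simp
  have hDD' : D * D' = 0 := c.ext fun i => by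
    rw [hjb, Module.End.mul_apply, hD', hD, show d (d' (b i)) = 0 from LinearMap.congr_fun hdd' _]
    simp
  have e1 : D * δ' * D = D := by
    have := congrArg (D * ·) h1
    simpa [mul_add, ← mul_assoc, hDD'] using this
  have e2 : D' * δ * D' = D' := by
    have := congrArg (D' * ·) h2
    simpa [mul_add, ← mul_assoc, hDD] using this
  have q1 : δ' * D = 1 - D' * δ := eq_sub_of_add_eq' h1
  have q2 : D * δ' = 1 - δ * D' := eq_sub_of_add_eq h2
  -- `δ δ'` commutes with the projector `D δ'`.
  have hcomm : Commute (δ * δ') (D * δ') := by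
    change δ * δ' * (D * δ') = D * δ' * (δ * δ')
    have l : δ * δ' * (D * δ') = δ * (δ' * D) * δ' := by simp only [mul_assoc]
    have r : D * δ' * (δ * δ') = D * δ' * δ * δ' := by simp only [mul_assoc]
    rw [l, r, q1, q2]
    noncomm_ring
  have hnil : IsNilpotent (δ * δ' * (D * δ')) := hcomm.isNilpotent_mul_right hδ
  -- The standard repair of a contraction: δ D' δ and δ' D δ' still contract the complex, and the
  -- needed composite of the two vanishes.
  obtain ⟨r1, r2, r3⟩ := det_contraction_of_sq_zero b c j hj d d' hdd hdd' D D' (δ * D' * δ)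
    (δ' * D * δ') hD hD'
    (fun x => by
      have : D' * (δ * D' * δ) + δ' * D * δ' * D = 1 := by
        have a1 : D' * (δ * D' * δ) = D' * δ * D' * δ := by simp only [mul_assoc]
        have a2 : δ' * D * δ' * D = δ' * (D * δ' * D) := by simp only [mul_assoc]
        rw [a1, a2, e2, e1, h1]
      exact LinearMap.congr_fun this x)
    (fun x => by
      have : D * (δ' * D * δ') + δ * D' * δ * D' = 1 := by
        have a1 : D * (δ' * D * δ') = D * δ' * D * δ' := by simp only [mul_assoc]
        have a2 : δ * D' * δ * D' = δ * (D' * δ * D') := by simp only [mul_assoc]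
        rw [a1, a2, e2, e1, h2]
      exact LinearMap.congr_fun this x)
    (fun x => by
      have : δ * D' * δ * (δ' * D * δ') = 0 := by
        have a1 : δ * D' * δ * (δ' * D * δ') = δ * (D' * δ) * (δ' * D) * δ' := by
          simp only [mul_assoc]
        have a2 : (D' * δ) * (δ' * D) = 0 := by
          rw [q1, mul_sub, mul_one, ← mul_assoc, e2, sub_self]
        rw [a1, mul_assoc δ, a2, mul_zero, zero_mul]
      exact LinearMap.congr_fun this x)
  -- Replacing δ by δ D' δ costs only a left factor 1 + (nilpotent), of determinant 1.
  have hfac : D + δ = (1 + δ * δ' * (D * δ')) * (D + δ * D' * δ) := by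
    have b1 : δ * δ' * (D * δ') * D = δ - δ * D' * δ := by
      have : δ * δ' * (D * δ') * D = δ * (δ' * D * δ' * D) := by simp only [mul_assoc]
      rw [this, mul_assoc (δ' * D), q1]
      have : (1 - D' * δ) * (1 - D' * δ) = 1 - D' * δ := by
        have : D' * δ * (D' * δ) = D' * δ := by rw [← mul_assoc, e2]
        rw [sub_mul, one_mul, mul_sub, mul_one, this]
        abel
      rw [this, mul_sub, mul_one, ← mul_assoc]
    have b2 : δ * δ' * (D * δ') * (δ * D' * δ) = 0 := by
      have a1 : δ * δ' * (D * δ') * (δ * D' * δ) = δ * δ' * ((D * δ') * (δ * D')) * δ := by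
        simp only [mul_assoc]
      have a2 : (D * δ') * (δ * D') = 0 := by
        have : δ * D' = 1 - D * δ' := eq_sub_of_add_eq' h2
        rw [this, mul_sub, mul_one, ← mul_assoc, e1, sub_self]
      rw [a1, a2, mul_zero, zero_mul]
    rw [add_mul, one_mul, mul_add, b1, b2]
    abel
  have hdet : LinearMap.det (D + δ) = LinearMap.det (D + δ * D' * δ) := by
    have := Module.Free.of_basis c
    have := Module.Finite.of_basis c
    rw [hfac, map_mul]
    -- The value at 1 of the characteristic polynomial Xⁿ of the nilpotent map with opposite sign.
    have : LinearMap.det (1 + δ * δ' * (D * δ')) = 1 := by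
      have h := LinearMap.eval_charpoly (-(δ * δ' * (D * δ'))) 1
      rw [hnil.neg.charpoly_eq_X_pow_finrank] at h
      simpa using h.symm
    rw [this, one_mul]
  rw [hdet]
  exact ⟨r1, r2, r3⟩

end Lattice

/-! ### The `p`-adic logarithm is even -/

section PadicLog

variable {p : ℕ} [hp : Fact p.Prime]

theorem norm_natCast_inv_le (n : ℕ) : ‖((n : ℕ) : ℚ_[p])⁻¹‖ ≤ n := by
  rcases Nat.eq_zero_or_pos n with rfl | hn
  · simp
  have h0 : (n : ℚ_[p]) ≠ 0 := Nat.cast_ne_zero.2 hn.ne'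
  rw [norm_inv, Padic.norm_eq_zpow_neg_valuation h0, ← zpow_neg, neg_neg,
    Padic.valuation_natCast, zpow_natCast]
  exact_mod_cast Nat.le_of_dvd hn pow_padicValNat_dvd

/-- Pascal's rule gives C(m, k+1) = C(m+1, k+1) - C(m, k), and with m + 1 = pⁿ the term C(m+1, k+1)
= (m+1)/(k+1) · C(m, k) tends to 0 p-adically. -/
theorem tendsto_choose_pow_sub_one (k : ℕ) :
    Tendsto (fun n : ℕ => (((p ^ n - 1).choose k : ℕ) : ℚ_[p])) atTop (𝓝 ((-1) ^ k)) := by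
  have hpow : Tendsto (fun n : ℕ => ((p ^ n : ℕ) : ℚ_[p])) atTop (𝓝 0) := by
    have : ‖(p : ℚ_[p])‖ < 1 := Padic.norm_p_lt_one
    simpa using tendsto_pow_atTop_nhds_zero_of_norm_lt_one this
  induction k with
  | zero => simp
  | succ k ih =>
    have h : ∀ n : ℕ, (((p ^ n - 1).choose (k + 1) : ℕ) : ℚ_[p]) =
        ((p ^ n : ℕ) : ℚ_[p]) * ((p ^ n - 1).choose k : ℕ) * ((k + 1 : ℕ) : ℚ_[p])⁻¹ -
          ((p ^ n - 1).choose k : ℕ) := by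
      intro n
      obtain ⟨m, hm⟩ : ∃ m, p ^ n = m + 1 :=
        Nat.exists_eq_succ_of_ne_zero (pow_ne_zero _ hp.1.ne_zero)
      have h1 := Nat.add_one_mul_choose_eq m k
      have h2 := Nat.choose_succ_succ m k
      rw [hm, Nat.add_sub_cancel, ← Nat.cast_mul, h1, Nat.cast_mul,
        mul_assoc, mul_inv_cancel₀ (Nat.cast_ne_zero.2 k.succ_ne_zero), mul_one, h2]
      push_cast
      ring
    have h' := ((hpow.mul ih).mul_const ((k + 1 : ℕ) : ℚ_[p])⁻¹).sub ih
    rw [zero_mul, zero_mul, zero_sub] at h'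
    rw [pow_succ, mul_neg_one]
    exact h'.congr fun n => (h n).symm

/-- `-log (1 - t) = lim (1 - (1 - t) ^ (p ^ n)) / p ^ n`. -/
theorem tendsto_logSeries {t : ℚ_[p]} (ht : ‖t‖ < 1) :
    Tendsto (fun n : ℕ => ((p ^ n : ℕ) : ℚ_[p])⁻¹ * (1 - (1 - t) ^ (p ^ n))) atTop
      (𝓝 (∑' ν : ℕ, ((ν + 1 : ℕ) : ℚ_[p])⁻¹ * t ^ (ν + 1))) := by
  -- By the binomial theorem and C(pⁿ, k+1)/pⁿ = C(pⁿ - 1, k)/(k+1), the n-th term is this series,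
  -- which breaks off at k = pⁿ. The limit is taken termwise: binomial coefficients have norm at
  -- most 1 and |1/(k+1)|_p ≤ k+1, so (k+1)|t|^(k+1) dominates.
  have key : Tendsto (fun n : ℕ => ∑' k : ℕ, (((p ^ n - 1).choose k : ℕ) : ℚ_[p]) *
      ((-1) ^ k * (((k + 1 : ℕ) : ℚ_[p])⁻¹ * t ^ (k + 1)))) atTop
      (𝓝 (∑' k : ℕ, ((k + 1 : ℕ) : ℚ_[p])⁻¹ * t ^ (k + 1))) := by
    refine tendsto_tsum_of_dominated_convergence
      (bound := fun k : ℕ => ((k + 1 : ℕ) : ℝ) * ‖t‖ ^ (k + 1)) ?_ ?_ ?_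
    · have := summable_pow_mul_geometric_of_norm_lt_one (R := ℝ) 1 (r := ‖t‖) (by simpa using ht)
      simp only [pow_one] at this
      exact (summable_nat_add_iff (f := fun k : ℕ => (k : ℝ) * ‖t‖ ^ k) 1).2 this
    · intro k
      have := (tendsto_choose_pow_sub_one (p := p) k).mul_const
        ((-1) ^ k * (((k + 1 : ℕ) : ℚ_[p])⁻¹ * t ^ (k + 1)))
      have h1 : ((-1) ^ k * (-1) ^ k : ℚ_[p]) = 1 := by rw [← mul_pow]; simp
      rwa [← mul_assoc ((-1) ^ k) ((-1) ^ k), h1, one_mul] at this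
    · refine Eventually.of_forall fun n k => ?_
      rw [norm_mul, norm_mul, norm_mul, norm_pow, norm_pow, norm_neg, norm_one, one_pow, one_mul]
      have h1 : ‖(((p ^ n - 1).choose k : ℕ) : ℚ_[p])‖ ≤ 1 := by
        simpa using Padic.norm_int_le_one (p := p) ((p ^ n - 1).choose k : ℕ)
      calc _ ≤ 1 * (‖((k + 1 : ℕ) : ℚ_[p])⁻¹‖ * ‖t‖ ^ (k + 1)) := by gcongr
        _ ≤ _ := by
          rw [one_mul]
          gcongr
          exact norm_natCast_inv_le _
  refine key.congr fun n => ?_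
  obtain ⟨m, hm⟩ : ∃ m, p ^ n = m + 1 :=
    Nat.exists_eq_succ_of_ne_zero (pow_ne_zero _ hp.1.ne_zero)
  rw [hm, Nat.add_sub_cancel, tsum_eq_sum (s := Finset.range (m + 1))]
  · have h : (1 - t) ^ (m + 1) = 1 - ∑ k ∈ Finset.range (m + 1),
        ((m + 1).choose (k + 1) : ℚ_[p]) * ((-1) ^ k * t ^ (k + 1)) := by
      rw [sub_eq_add_neg, add_comm, add_pow, Finset.sum_range_succ']
      simp only [one_pow, mul_one, pow_zero, Nat.choose_zero_right, Nat.cast_one]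
      rw [add_comm, sub_eq_add_neg, ← Finset.sum_neg_distrib]
      congr 1
      refine Finset.sum_congr rfl fun k _ => ?_
      rw [neg_pow, pow_succ (-1 : ℚ_[p])]
      ring
    rw [h, sub_sub_cancel, Finset.mul_sum]
    refine Finset.sum_congr rfl fun k _ => ?_
    have h1 : ((m + 1 : ℕ) : ℚ_[p]) * (m.choose k : ℕ) =
        ((m + 1).choose (k + 1) : ℕ) * ((k + 1 : ℕ) : ℚ_[p]) := by
      exact_mod_cast Nat.add_one_mul_choose_eq m k
    have h2 : ((m + 1 : ℕ) : ℚ_[p]) ≠ 0 := Nat.cast_ne_zero.2 m.succ_ne_zero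
    have h3 : ((k + 1 : ℕ) : ℚ_[p]) ≠ 0 := Nat.cast_ne_zero.2 k.succ_ne_zero
    have h4 : ((m.choose k : ℕ) : ℚ_[p]) * ((k + 1 : ℕ) : ℚ_[p])⁻¹ =
        ((m + 1 : ℕ) : ℚ_[p])⁻¹ * ((m + 1).choose (k + 1) : ℕ) := by
      field_simp
      linear_combination h1
    linear_combination (-1) ^ k * t ^ (k + 1) * h4
  · intro k hk
    rw [Finset.mem_range, not_lt] at hk
    rw [Nat.choose_eq_zero_of_lt hk, Nat.cast_zero, zero_mul]

/-- The residue field has two elements, so every unit is congruent to 1. -/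
theorem norm_one_sub_lt_one_of_two {u : ℚ_[2]} (hu : ‖u‖ = 1) : ‖1 - u‖ < 1 := by
  let v : ℤ_[2] := ⟨u, hu.le⟩
  have hker : ∀ w : ℤ_[2], PadicInt.toZMod w = 0 ↔ ‖w‖ < 1 := fun w => by
    rw [← RingHom.mem_ker, PadicInt.ker_toZMod, IsLocalRing.mem_maximalIdeal,
      PadicInt.mem_nonunits]
  have hv : PadicInt.toZMod v ≠ 0 := fun h => ((hker v).1 h).ne hu
  have h2 : ∀ a : ZMod 2, a ≠ 0 → a = 1 := by decide
  exact (hker (1 - v)).1 (by rw [map_sub, map_one, h2 _ hv, sub_self])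

/-- For odd p the exponent p - 1 is even and the sign disappears. For p = 2 that exponent is 1;
instead log u and log(-u) are given by the same limit of (1 - u^(2ⁿ))/2ⁿ, since 2ⁿ is even for n ≥
1. -/
theorem padicLog_neg (x : ℚ_[p]) : padicLog p (-x) = padicLog p x := by
  by_cases hx : x = 0
  · simp [hx]
  have hval : (-x).valuation = x.valuation := by
    rw [← neg_one_mul, Padic.valuation_mul (by simp) hx,
      show (-1 : ℚ_[p]) = ((-1 : ℤ) : ℚ_[p]) by simp, Padic.valuation_intCast]
    simp [padicValInt]
  rcases hp.1.eq_two_or_odd' with rfl | hodd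
  · unfold padicLog
    have hu : ‖x * ((2 : ℕ) : ℚ_[2]) ^ (-x.valuation)‖ = 1 := by
      rw [norm_mul, norm_zpow, Padic.norm_p, Padic.norm_eq_zpow_neg_valuation hx]
      simp [inv_mul_cancel₀ (zpow_ne_zero _ (two_ne_zero' ℝ))]
    set u := x * ((2 : ℕ) : ℚ_[2]) ^ (-x.valuation) with hudef
    have hu' : -x * ((2 : ℕ) : ℚ_[2]) ^ (-(-x).valuation) = -u := by rw [hval, neg_mul]
    rw [hu']
    have h1 := tendsto_logSeries (norm_one_sub_lt_one_of_two hu)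
    have h2 := tendsto_logSeries (norm_one_sub_lt_one_of_two (u := -u) (by simpa using hu))
    simp only [sub_sub_cancel] at h1 h2
    have h3 := tendsto_nhds_unique_of_eventuallyEq h1 h2 (by
      filter_upwards [eventually_ge_atTop 1] with n hn
      have : Even (2 ^ n) := (Nat.even_pow.2 ⟨even_two, by omega⟩)
      rw [this.neg_pow])
    simp only [Nat.add_one_sub_one, pow_one, h3]
  · unfold padicLog
    rw [hval, neg_mul, (Nat.Odd.sub_odd hodd odd_one : Even (p - 1)).neg_pow]

end PadicLog

/-! ### The homomorphisms `c₀(Γ) → ℚ_p[Γ/N]` -/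

section ToQuotient

variable {p : ℕ} [hp : Fact p.Prime] {Γ : Type*} [Group Γ] (N : FiniteIndexNormalSubgroup Γ)

open scoped Classical in
theorem coeff_toQuotient (x : C0 p Γ) (δ : Γ ⧸ N.toSubgroup) :
    (C0.toQuotient N x).coeff δ = ∑' γ : Γ, if (γ : Γ ⧸ N.toSubgroup) = δ then x.coeff γ else 0 := by
  change ∑' γ : ({γ : Γ | (γ : Γ ⧸ N.toSubgroup) = δ} : Set Γ), x.coeff γ = _
  rw [tsum_subtype]
  refine tsum_congr fun γ => ?_
  simp [Set.indicator_apply]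

theorem summable_ite {ι : Type*} {f : ι → ℚ_[p]} (hf : Summable f) (P : ι → Prop)
    [DecidablePred P] : Summable fun i => if P i then f i else 0 := by
  refine NonarchimedeanAddGroup.summable_of_tendsto_cofinite_zero ?_
  have h := hf.tendsto_cofinite_zero
  rw [tendsto_zero_iff_norm_tendsto_zero] at h ⊢
  refine squeeze_zero (fun _ => norm_nonneg _) (fun i => ?_) h
  split_ifs <;> simp

theorem coeff_mul_quotient {G : Type*} [Group G] [Finite G] {A : Type*} [Semiring A]
    (X Y : A[G]) (δ : G) :
    (X * Y).coeff δ = ∑ᶠ ε : G, X.coeff ε * Y.coeff (ε⁻¹ * δ) := by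
  classical
  have := Fintype.ofFinite G
  rw [MonoidAlgebra.coeff_mul, Finsupp.sum_fintype _ _ (fun i => by simp),
    finsum_eq_sum_of_fintype]
  refine Finset.sum_congr rfl fun ε _ => ?_
  rw [Finsupp.sum_fintype _ _ (fun i => by simp), Finset.sum_eq_single (ε⁻¹ * δ)]
  · simp
  · intro m _ hm
    rw [if_neg]
    rintro rfl
    exact hm (by simp)
  · simp

/-- The convolution is summed over a coset and the double sum is rearranged. Restricting a null
family to a subset leaves it null, hence summable in a nonarchimedean field, so the interchange is
allowed. -/
theorem toQuotient_mul (x y : C0 p Γ) :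
    C0.toQuotient N (x * y) = C0.toQuotient N x * C0.toQuotient N y := by
  classical
  have := Fintype.ofFinite (Γ ⧸ N.toSubgroup)
  ext δ
  rw [coeff_mul_quotient, finsum_eq_sum_of_fintype, coeff_toQuotient]
  have hs := summable_ite (x.summable_conv' y)
    (fun q : Γ × Γ => (q.1 : Γ ⧸ N.toSubgroup) = δ)
  calc (∑' γ : Γ, if (γ : Γ ⧸ N.toSubgroup) = δ then (x * y).coeff γ else 0)
      = ∑' γ : Γ, ∑' α : Γ, if (γ : Γ ⧸ N.toSubgroup) = δ then x.coeff α * y.coeff (α⁻¹ * γ) else 0 := by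
        refine tsum_congr fun γ => ?_
        split_ifs
        · rw [C0.coeff_mul]
        · simp
    _ = ∑' α : Γ, ∑' γ : Γ, if (γ : Γ ⧸ N.toSubgroup) = δ then x.coeff α * y.coeff (α⁻¹ * γ) else 0 :=
        Summable.tsum_comm (f := fun α γ : Γ => if (γ : Γ ⧸ N.toSubgroup) = δ then
          x.coeff α * y.coeff (α⁻¹ * γ) else 0) hs.prod_symm
    _ = ∑' α : Γ, x.coeff α * (C0.toQuotient N y).coeff ((α : Γ ⧸ N.toSubgroup)⁻¹ * δ) := by
        refine tsum_congr fun α => ?_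
        rw [coeff_toQuotient, ← tsum_mul_left, ← (Equiv.mulLeft α).tsum_eq]
        refine tsum_congr fun β => ?_
        simp only [Equiv.coe_mulLeft, QuotientGroup.mk_mul, inv_mul_cancel_left, mul_ite, mul_zero,
          eq_inv_mul_iff_mul_eq]
    _ = ∑' α : Γ, ∑ ε : Γ ⧸ N.toSubgroup, (if (α : Γ ⧸ N.toSubgroup) = ε then x.coeff α else 0) *
          (C0.toQuotient N y).coeff (ε⁻¹ * δ) := by
        refine tsum_congr fun α => ?_
        simp [ite_mul]
    _ = ∑ ε : Γ ⧸ N.toSubgroup, (C0.toQuotient N x).coeff ε *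
          (C0.toQuotient N y).coeff (ε⁻¹ * δ) := by
        rw [Summable.tsum_finsetSum
          (fun ε _ => (summable_ite x.summable (fun α => (α : Γ ⧸ N.toSubgroup) = ε)).mul_right _)]
        refine Finset.sum_congr rfl fun ε _ => ?_
        rw [tsum_mul_right, coeff_toQuotient N x]

theorem toQuotient_single (γ : Γ) :
    C0.toQuotient N (C0.single γ : C0 p Γ) = MonoidAlgebra.single (γ : Γ ⧸ N.toSubgroup) 1 := by
  classical
  ext δ
  rw [coeff_toQuotient, tsum_eq_single γ]
  · simp [C0.coeff_single, Finsupp.single_apply]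
  · intro α hα
    simp [C0.coeff_single, hα]

/-- The canonical map `c₀(Γ) → ℚ_p[Γ/N]` as a homomorphism of rings. -/
def toQuotientHom : C0 p Γ →+* ℚ_[p][Γ ⧸ N.toSubgroup] where
  toFun := C0.toQuotient N
  map_one' := toQuotient_single N 1
  map_mul' := toQuotient_mul N
  map_zero' := by
    classical
    ext δ
    rw [coeff_toQuotient]
    simp
  map_add' x y := by
    classical
    ext δ
    rw [MonoidAlgebra.coeff_add, Finsupp.add_apply]
    simp only [coeff_toQuotient]
    rw [← (summable_ite x.summable _).tsum_add (summable_ite y.summable _)]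
    refine tsum_congr fun γ => ?_
    split_ifs <;> simp

/-- The projection `ℤΓ → ℤ[Γ/N]`. -/
def groupRingProj (N : Subgroup Γ) [N.Normal] : ℤ[Γ] →+* ℤ[Γ ⧸ N] :=
  MonoidAlgebra.mapDomainRingHom ℤ (QuotientGroup.mk' N)

/-- Both composites are ring homomorphisms agreeing on ℤ and on Γ. Through this square the matrices
of ∂ over ℚ_p[Γ/N] come from matrices over ℤ[Γ/N], which provides the lattices. -/
theorem toQuotientHom_groupRingToC0 (x : ℤ[Γ]) :
    toQuotientHom N (groupRingToC0 p Γ x) =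
      MonoidAlgebra.mapRingHom _ (Int.castRingHom ℚ_[p]) (groupRingProj N.toSubgroup x) := by
  have h : (toQuotientHom N).comp (groupRingToC0 p Γ) =
      (MonoidAlgebra.mapRingHom _ (Int.castRingHom ℚ_[p])).comp (groupRingProj N.toSubgroup) := by
    refine MonoidAlgebra.ringHom_ext (fun r => ?_) (fun γ => ?_)
    · exact RingHom.congr_fun (RingHom.ext_int
        (((toQuotientHom N).comp (groupRingToC0 p Γ)).comp MonoidAlgebra.singleOneRingHom)
        (((MonoidAlgebra.mapRingHom _ (Int.castRingHom ℚ_[p])).comp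
          (groupRingProj N.toSubgroup)).comp MonoidAlgebra.singleOneRingHom)) r
    · have h1 : groupRingToC0 p Γ (MonoidAlgebra.single γ 1) = C0.single γ := by
        simp [groupRingToC0, C0.of]
      rw [RingHom.comp_apply, h1]
      change C0.toQuotient N _ = _
      rw [toQuotient_single]
      simp [groupRingProj]
  exact RingHom.congr_fun h x

/-- With N = Γ the quotient map, followed by the augmentation, is a ring homomorphism to the field
ℚ_p, and invariance of rank descends along it. It makes 𝔟_odd and 𝔟_even equally large. -/
instance : InvariantBasisNumber (C0 p Γ) := by
  let N : FiniteIndexNormalSubgroup Γ := FiniteIndexNormalSubgroup.ofSubgroup ⊤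
  let f : C0 p Γ →+* ℚ_[p] :=
    (MonoidAlgebra.lift ℚ_[p] ℚ_[p] (Γ ⧸ N.toSubgroup) 1).toRingHom.comp (toQuotientHom N)
  refine invariantBasisNumber_iff_matrix.2 fun n m A B hAB hBA => ?_
  refine invariantBasisNumber_iff_matrix.1 (inferInstanceAs (InvariantBasisNumber ℚ_[p])) n m
    (A.map f) (B.map f) ?_ ?_
  · rw [← Matrix.map_mul, hAB, Matrix.map_one _ f.map_zero f.map_one]
  · rw [← Matrix.map_mul, hBA, Matrix.map_one _ f.map_zero f.map_one]

end ToQuotient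

/-- Enumerate Γ, choose for each γ_k a normal subgroup H_k of finite index that excludes γ_k unless
γ_k = 1, and take Γ_n = H_0 ∩ ⋯ ∩ H_n. The sequence decreases, so any infinite set of indices has
the same trivial intersection. -/
theorem exists_tendsToUnit (Γ : Type*) [Group Γ] [Countable Γ] [Group.ResiduallyFinite Γ] :
    ∃ N : ℕ → FiniteIndexNormalSubgroup Γ, TendsToUnit N := by
  obtain ⟨g, hg⟩ := exists_surjective_nat Γ
  have h : ∀ γ : Γ, ∃ H : FiniteIndexNormalSubgroup Γ, γ ∈ H → γ = 1 := by
    intro γ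
    by_contra! hc
    obtain ⟨h1, h2⟩ := hc (FiniteIndexNormalSubgroup.ofSubgroup ⊤)
    exact h2 (Group.eq_one_iff_forall_finiteIndexNormalSubroup γ fun H => (hc H).1)
  choose H hH using h
  let N : ℕ → FiniteIndexNormalSubgroup Γ :=
    fun n => Nat.rec (H (g 0)) (fun k K => K ⊓ H (g (k + 1))) n
  have hN : ∀ n k, k ≤ n → N n ≤ H (g k) := by
    intro n
    induction n with
    | zero =>
      intro k hk
      rw [Nat.le_zero.1 hk]
      exact le_rfl
    | succ n ih =>
      intro k hk
      rcases Nat.le_succ_iff.1 hk with hk | rfl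
      · exact inf_le_left.trans (ih k hk)
      · exact inf_le_right
  refine ⟨N, fun I hI => ?_⟩
  rw [eq_bot_iff]
  intro γ hγ
  obtain ⟨k, rfl⟩ := hg γ
  obtain ⟨n, hn, hkn⟩ := hI.exists_gt k
  rw [Subgroup.mem_iInf] at hγ
  have := Subgroup.mem_iInf.1 (hγ n) hn
  exact hH _ (hN n k hkn.le this)

/-! ### The odd and even parts of a graded module -/

section Collapse

theorem dfinsupp_single_of_ne {ι : Type*} [DecidableEq ι] {β : ι → Type*} [∀ i, Zero (β i)]
    {i k : ι} {x : β i} (h : i ≠ k) : DFinsupp.single i x k = 0 :=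
  DFinsupp.single_eq_of_ne (Ne.symm h)

@[elab_as_elim]
theorem dfinsupp_induction_linear {ι : Type*} [DecidableEq ι] {β : ι → Type*}
    [∀ i, AddCommMonoid (β i)] {P : (Π₀ i, β i) → Prop} (x : Π₀ i, β i) (h0 : P 0)
    (hadd : ∀ x y, P x → P y → P (x + y)) (hsingle : ∀ i x, P (DFinsupp.single i x)) : P x :=
  DFinsupp.induction x h0 fun _ _ _ _ _ hf => hadd _ _ (hsingle _ _) hf

variable {A : Type*} [Ring A] {X : ℕ → Type*} [∀ ν, AddCommGroup (X ν)] [∀ ν, Module A (X ν)]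
  (d : ∀ ν, X (ν + 1) →ₗ[A] X ν) (δ : ∀ ν, X ν →ₗ[A] X (ν + 1))

/-- The differential from the odd to the even part. -/
def oddD : (Π₀ k : ℕ, X (2 * k + 1)) →ₗ[A] (Π₀ k : ℕ, X (2 * k)) :=
  DFinsupp.lsum ℕ fun k => DFinsupp.lsingle (M := fun k => X (2 * k)) k ∘ₗ d (2 * k)

/-- The differential from the even to the odd part. -/
def evenD : (Π₀ k : ℕ, X (2 * k)) →ₗ[A] (Π₀ k : ℕ, X (2 * k + 1)) :=
  DFinsupp.lsum ℕ fun k => match k with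
    | 0 => 0
    | k + 1 => DFinsupp.lsingle (M := fun k => X (2 * k + 1)) k ∘ₗ d (2 * k + 1)

/-- A map of degree one from the odd to the even part. -/
def oddδ : (Π₀ k : ℕ, X (2 * k + 1)) →ₗ[A] (Π₀ k : ℕ, X (2 * k)) :=
  DFinsupp.lsum ℕ fun k => DFinsupp.lsingle (M := fun k => X (2 * k)) (k + 1) ∘ₗ δ (2 * k + 1)

/-- A map of degree one from the even to the odd part. -/
def evenδ : (Π₀ k : ℕ, X (2 * k)) →ₗ[A] (Π₀ k : ℕ, X (2 * k + 1)) :=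
  DFinsupp.lsum ℕ fun k => DFinsupp.lsingle (M := fun k => X (2 * k + 1)) k ∘ₗ δ (2 * k)

theorem oddD_apply (x : Π₀ k : ℕ, X (2 * k + 1)) (k : ℕ) : oddD d x k = d (2 * k) (x k) := by
  induction x using dfinsupp_induction_linear with
  | h0 => simp
  | hadd x y hx hy => simp [hx, hy]
  | hsingle i x =>
    rcases eq_or_ne i k with rfl | h
    · simp [oddD]
    · simp [oddD, dfinsupp_single_of_ne h]

theorem evenD_apply (x : Π₀ k : ℕ, X (2 * k)) (k : ℕ) :
    evenD d x k = d (2 * k + 1) (x (k + 1)) := by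
  induction x using dfinsupp_induction_linear with
  | h0 => simp
  | hadd x y hx hy => simp [hx, hy]
  | hsingle i x =>
    cases i with
    | zero => 
      rw [dfinsupp_single_of_ne (Nat.succ_ne_zero k).symm]
      simp [evenD]
    | succ i =>
      rcases eq_or_ne i k with rfl | h
      · simp [evenD]
      · rw [dfinsupp_single_of_ne (fun h' => h (Nat.succ_injective h'))]
        simp [evenD, dfinsupp_single_of_ne h]

theorem oddδ_apply_zero (x : Π₀ k : ℕ, X (2 * k + 1)) : oddδ δ x 0 = 0 := by
  induction x using dfinsupp_induction_linear with
  | h0 => simp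
  | hadd x y hx hy => simp [hx, hy]
  | hsingle i x =>
    simp only [oddδ, DFinsupp.lsum_single, LinearMap.comp_apply, DFinsupp.lsingle_apply]
    exact dfinsupp_single_of_ne (Nat.succ_ne_zero i)

theorem oddδ_apply_succ (x : Π₀ k : ℕ, X (2 * k + 1)) (k : ℕ) :
    oddδ δ x (k + 1) = δ (2 * k + 1) (x k) := by
  induction x using dfinsupp_induction_linear with
  | h0 => simp
  | hadd x y hx hy => simp [hx, hy]
  | hsingle i x =>
    rcases eq_or_ne i k with rfl | h
    · simp [oddδ]
    · rw [dfinsupp_single_of_ne h]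
      simp only [oddδ, DFinsupp.lsum_single, LinearMap.comp_apply, DFinsupp.lsingle_apply, map_zero]
      exact dfinsupp_single_of_ne (fun h' => h (Nat.succ_injective h'))

theorem evenδ_apply (x : Π₀ k : ℕ, X (2 * k)) (k : ℕ) : evenδ δ x k = δ (2 * k) (x k) := by
  induction x using dfinsupp_induction_linear with
  | h0 => simp
  | hadd x y hx hy => simp [hx, hy]
  | hsingle i x =>
    rcases eq_or_ne i k with rfl | h
    · simp [evenδ]
    · simp [evenδ, dfinsupp_single_of_ne h]

variable {d δ}

theorem evenD_comp_oddD (hd : ∀ ν, d ν ∘ₗ d (ν + 1) = 0) : evenD d ∘ₗ oddD d = 0 := by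
  refine LinearMap.ext fun x => DFinsupp.ext fun k => ?_
  rw [LinearMap.comp_apply, evenD_apply, oddD_apply]
  exact LinearMap.congr_fun (hd (2 * k + 1)) _

theorem oddD_comp_evenD (hd : ∀ ν, d ν ∘ₗ d (ν + 1) = 0) : oddD d ∘ₗ evenD d = 0 := by
  refine LinearMap.ext fun x => DFinsupp.ext fun k => ?_
  rw [LinearMap.comp_apply, oddD_apply, evenD_apply]
  exact LinearMap.congr_fun (hd (2 * k)) _

theorem contraction_odd
    (hδ : ∀ ν, δ ν ∘ₗ d ν + d (ν + 1) ∘ₗ δ (ν + 1) = LinearMap.id) :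
    evenD d ∘ₗ oddδ δ + evenδ δ ∘ₗ oddD d = LinearMap.id := by
  refine LinearMap.ext fun x => DFinsupp.ext fun k => ?_
  rw [LinearMap.add_apply, LinearMap.comp_apply, LinearMap.comp_apply, DFinsupp.add_apply,
    evenD_apply, oddδ_apply_succ, evenδ_apply, oddD_apply]
  exact (add_comm _ _).trans (LinearMap.congr_fun (hδ (2 * k)) _)

theorem contraction_even (h0 : d 0 ∘ₗ δ 0 = LinearMap.id)
    (hδ : ∀ ν, δ ν ∘ₗ d ν + d (ν + 1) ∘ₗ δ (ν + 1) = LinearMap.id) :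
    oddD d ∘ₗ evenδ δ + oddδ δ ∘ₗ evenD d = LinearMap.id := by
  refine LinearMap.ext fun x => DFinsupp.ext fun k => ?_
  rw [LinearMap.add_apply, LinearMap.comp_apply, LinearMap.comp_apply, DFinsupp.add_apply,
    oddD_apply, evenδ_apply]
  cases k with
  | zero =>
    rw [oddδ_apply_zero, add_zero]
    exact LinearMap.congr_fun h0 _
  | succ k =>
    rw [oddδ_apply_succ, evenD_apply]
    exact (add_comm _ _).trans (LinearMap.congr_fun (hδ (2 * k + 1)) _)

/-- Each application raises the degree by two, so the l-th power has no components with index below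
l, while the modules vanish in large degrees. -/
theorem isNilpotent_oddδ_evenδ {m : ℕ} (hX : ∀ ν, m < ν → Subsingleton (X ν)) :
    IsNilpotent ((oddδ δ ∘ₗ evenδ δ : Module.End A (Π₀ k : ℕ, X (2 * k)))) := by
  have h : ∀ l : ℕ, ∀ x : Π₀ k : ℕ, X (2 * k), ∀ k < l,
      ((oddδ δ ∘ₗ evenδ δ : Module.End A (Π₀ k : ℕ, X (2 * k))) ^ l) x k = 0 := by
    intro l
    induction l with
    | zero => simp
    | succ l ih =>
      intro x k hk
      rw [pow_succ', Module.End.mul_apply, LinearMap.comp_apply]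
      cases k with
      | zero => exact oddδ_apply_zero _ _
      | succ k => rw [oddδ_apply_succ, evenδ_apply, ih _ _ (by omega), map_zero, map_zero]
  refine ⟨m + 1, LinearMap.ext fun x => DFinsupp.ext fun k => ?_⟩
  by_cases hk : k < m + 1
  · exact h _ _ _ hk
  · have := hX (2 * k) (by omega)
    exact Subsingleton.elim _ _

theorem isNilpotent_evenδ_oddδ {m : ℕ} (hX : ∀ ν, m < ν → Subsingleton (X ν)) :
    IsNilpotent ((evenδ δ ∘ₗ oddδ δ : Module.End A (Π₀ k : ℕ, X (2 * k + 1)))) := by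
  have h : ∀ l : ℕ, ∀ x : Π₀ k : ℕ, X (2 * k + 1), ∀ k < l,
      ((evenδ δ ∘ₗ oddδ δ : Module.End A (Π₀ k : ℕ, X (2 * k + 1))) ^ l) x k = 0 := by
    intro l
    induction l with
    | zero => simp
    | succ l ih =>
      intro x k hk
      rw [pow_succ', Module.End.mul_apply, LinearMap.comp_apply, evenδ_apply]
      cases k with
      | zero => 
        rw [oddδ_apply_zero]
        exact map_zero _
      | succ k =>
        rw [oddδ_apply_succ, ih _ _ (by omega), map_zero]
        exact map_zero _
  refine ⟨m + 1, LinearMap.ext fun x => DFinsupp.ext fun k => ?_⟩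
  by_cases hk : k < m + 1
  · exact h _ _ _ hk
  · have := hX (2 * k + 1) (by omega)
    exact Subsingleton.elim _ _

/-- Composing with ∂ + δ on the even part, in either order, gives 1 + δ², which is invertible
because δ² is nilpotent. -/
theorem bijective_oddD_add_oddδ {m : ℕ} (hX : ∀ ν, m < ν → Subsingleton (X ν))
    (hd : ∀ ν, d ν ∘ₗ d (ν + 1) = 0) (h0 : d 0 ∘ₗ δ 0 = LinearMap.id)
    (hδ : ∀ ν, δ ν ∘ₗ d ν + d (ν + 1) ∘ₗ δ (ν + 1) = LinearMap.id) :
    Function.Bijective (oddD d + oddδ δ) := by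
  have h1 : (evenD d + evenδ δ) ∘ₗ (oddD d + oddδ δ) =
      (1 + evenδ δ ∘ₗ oddδ δ : Module.End A (Π₀ k : ℕ, X (2 * k + 1))) := by
    have := contraction_odd hδ
    rw [LinearMap.add_comp, LinearMap.comp_add, LinearMap.comp_add, evenD_comp_oddD hd, zero_add,
      ← add_assoc, this]
    rfl
  have h2 : (oddD d + oddδ δ) ∘ₗ (evenD d + evenδ δ) =
      (1 + oddδ δ ∘ₗ evenδ δ : Module.End A (Π₀ k : ℕ, X (2 * k))) := by
    have := contraction_even h0 hδ
    rw [LinearMap.add_comp, LinearMap.comp_add, LinearMap.comp_add, oddD_comp_evenD hd, zero_add,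
      ← add_assoc, this]
    rfl
  have b1 := (Module.End.isUnit_iff _).1 (isNilpotent_evenδ_oddδ (δ := δ) hX).isUnit_one_add
  have b2 := (Module.End.isUnit_iff _).1 (isNilpotent_oddδ_evenδ (δ := δ) hX).isUnit_one_add
  rw [← h1] at b1
  rw [← h2] at b2
  refine ⟨?_, ?_⟩
  · exact Function.Injective.of_comp (f := evenD d + evenδ δ) b1.1
  · exact Function.Surjective.of_comp (g := evenD d + evenδ δ) b2.2

/-- An acyclic complex of projective modules is contractible. -/
theorem exists_contraction [∀ ν, Module.Projective A (X ν)] (hsurj : Function.Surjective (d 0))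
    (hex : ∀ ν, Function.Exact (d (ν + 1)) (d ν)) :
    ∃ δ : ∀ ν, X ν →ₗ[A] X (ν + 1), d 0 ∘ₗ δ 0 = LinearMap.id ∧
      ∀ ν, δ ν ∘ₗ d ν + d (ν + 1) ∘ₗ δ (ν + 1) = LinearMap.id := by
  obtain ⟨δ₀, hδ₀⟩ := Module.projective_lifting_property (d 0) LinearMap.id hsurj
  -- The invariant ∂ f ∂ = ∂ of the recursion says that id - f ∂ takes values in the cycles, hence
  -- in the boundaries, so projectivity lifts it through the next differential. The lift satisfies
  -- the invariant again.
  have step : ∀ ν (f : {f : X ν →ₗ[A] X (ν + 1) // d ν ∘ₗ f ∘ₗ d ν = d ν}),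
      ∃ g : {g : X (ν + 1) →ₗ[A] X (ν + 1 + 1) // d (ν + 1) ∘ₗ g ∘ₗ d (ν + 1) = d (ν + 1)},
        f.1 ∘ₗ d ν + d (ν + 1) ∘ₗ g.1 = LinearMap.id := by
    rintro ν ⟨f, hf⟩
    have hmem : ∀ x, (LinearMap.id - f ∘ₗ d ν : X (ν + 1) →ₗ[A] X (ν + 1)) x ∈ LinearMap.range (d (ν + 1)) := by
      intro x
      refine (hex ν _).1 ?_
      have := LinearMap.congr_fun hf x
      simp only [LinearMap.comp_apply] at this
      simp [this]
    obtain ⟨g, hg⟩ := Module.projective_lifting_property (d (ν + 1)).rangeRestrict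
      ((LinearMap.id - f ∘ₗ d ν).codRestrict _ hmem) (d (ν + 1)).surjective_rangeRestrict
    have hg' : d (ν + 1) ∘ₗ g = LinearMap.id - f ∘ₗ d ν :=
      LinearMap.ext fun x => congrArg Subtype.val (LinearMap.congr_fun hg x)
    refine ⟨⟨g, ?_⟩, ?_⟩
    · rw [← LinearMap.comp_assoc, hg', LinearMap.sub_comp, LinearMap.comp_assoc,
        (hex ν).linearMap_comp_eq_zero, LinearMap.comp_zero, sub_zero, LinearMap.id_comp]
    · rw [hg', add_sub_cancel]
  choose next hnext using step
  let δ : ∀ ν, {f : X ν →ₗ[A] X (ν + 1) // d ν ∘ₗ f ∘ₗ d ν = d ν} :=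
    fun ν => Nat.rec ⟨δ₀, by rw [← LinearMap.comp_assoc, hδ₀, LinearMap.id_comp]⟩ next ν
  exact ⟨fun ν => (δ ν).1, hδ₀, fun ν => hnext ν (δ ν)⟩

end Collapse

/-! ### Matrices of linear maps, acting on rows -/

section RowMatrix

set_option linter.unusedSectionVars false

open Module

variable {A A' : Type*} [Ring A] [Ring A'] {X Y Z : Type*} [AddCommGroup X] [AddCommGroup Y]
  [AddCommGroup Z] [Module A X] [Module A Y] [Module A Z] {ι κ μ : Type*} [Fintype ι] [Fintype κ]
  [Fintype μ] [DecidableEq ι] [DecidableEq κ] (B : Basis ι A X) (B' : Basis κ A Y)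
  (B'' : Basis μ A Z)

/-- The matrix of a linear map over a not necessarily commutative ring, `e_i ↦ ∑ a_ij e_j`. -/
def rowMatrix (f : X →ₗ[A] Y) : Matrix ι κ A := fun i j => B'.repr (f (B i)) j

/-- Maps of left modules over a noncommutative ring act on rows, so the matrices appear in the order
opposite to composition. -/
theorem rowMatrix_comp (f : X →ₗ[A] Y) (g : Y →ₗ[A] Z) :
    rowMatrix B B'' (g ∘ₗ f) = rowMatrix B B' f * rowMatrix B' B'' g := by
  ext i j
  rw [Matrix.mul_apply, rowMatrix, LinearMap.comp_apply]
  conv_lhs => rw [← B'.sum_repr (f (B i))]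
  simp only [map_sum, map_smul, Finsupp.coe_finsetSum, Finset.sum_apply, Finsupp.smul_apply,
    smul_eq_mul, rowMatrix]

theorem rowMatrix_add (f g : X →ₗ[A] Y) :
    rowMatrix B B' (f + g) = rowMatrix B B' f + rowMatrix B B' g := by
  ext i j
  simp [rowMatrix]

theorem rowMatrix_zero : rowMatrix B B' (0 : X →ₗ[A] Y) = 0 := by
  ext i j
  simp [rowMatrix]

theorem rowMatrix_id : rowMatrix B B LinearMap.id = 1 := by
  ext i j
  simp [rowMatrix, Finsupp.single_apply, Matrix.one_apply]

theorem repr_apply_eq_vecMul (f : X →ₗ[A] Y) (x : X) :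
    (fun j => B'.repr (f x) j) = Matrix.vecMul (fun i => B.repr x i) (rowMatrix B B' f) := by
  ext j
  conv_lhs => rw [← B.sum_repr x]
  simp only [map_sum, map_smul, Finsupp.coe_finsetSum, Finset.sum_apply, Finsupp.smul_apply,
    smul_eq_mul, rowMatrix, Matrix.vecMul, dotProduct]

end RowMatrix

/-! ### Existence of the torsion -/

section TorsionExists

namespace FLResolution

variable {p : ℕ} [hp : Fact p.Prime] {Γ : Type} [Group Γ] {M : Type} [AddCommGroup M]
  [Module ℤ[Γ] M] {F : FLResolution Γ M}

theorem oddMap_eq (δ : ∀ ν, F.C p ν →ₗ[C0 p Γ] F.C p (ν + 1)) :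
    oddMap δ = oddD (F.bdC p) + oddδ δ := by
  refine DFinsupp.lhom_ext' fun k => LinearMap.ext fun x => ?_
  simp [oddMap, oddD, oddδ]

theorem subsingleton_C (ν : ℕ) (hν : F.d < ν) : Subsingleton (F.C p ν) := by
  have := F.subsingleton ν hν
  refine subsingleton_of_forall_eq 0 fun x => ?_
  induction x using BaseChange.induction with
  | zero => rfl
  | tmul s m => rw [Subsingleton.elim m 0, BaseChange.tmul_zero]
  | add x y hx hy => rw [hx, hy, add_zero]

theorem bdC_comp (ν : ℕ) : F.bdC p ν ∘ₗ F.bdC p (ν + 1) = 0 := by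
  ext1 x
  induction x using BaseChange.induction with
  | zero => simp
  | tmul s m =>
    rw [LinearMap.comp_apply, bdC, bdC, BaseChange.map_tmul, BaseChange.map_tmul,
      (F.exact_succ ν).apply_apply_eq_zero, BaseChange.tmul_zero]
    rfl
  | add x y hx hy => rw [map_add, hx, hy, map_add]

variable {n : ℕ → ℕ} (b : ∀ ν, Module.Basis (Fin (n ν)) ℤ[Γ] (F.F ν))

include b in
theorem rank_eq_zero (ν : ℕ) (hν : F.d < ν) : n ν = 0 := by
  have := F.subsingleton ν hν
  by_contra h
  exact (b ν).ne_zero ⟨0, Nat.pos_of_ne_zero h⟩ (Subsingleton.elim _ _)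

include b in
theorem finite_index (f : ℕ → ℕ) (hf : ∀ k, k ≤ f k) : Finite (Σ k : ℕ, Fin (n (f k))) := by
  refine Finite.of_injective
    (β := Σ k : Fin (F.d + 1), Fin (n (f k))) (fun x => ⟨⟨x.1, ?_⟩, x.2⟩) ?_
  · by_contra h
    have h1 := rank_eq_zero b (f x.1) (by have := hf x.1; omega)
    exact (Fin.cast h1 x.2).elim0
  · rintro ⟨k, i⟩ ⟨l, j⟩ h
    simp only [Sigma.mk.injEq, Fin.mk.injEq] at h
    obtain ⟨rfl, h⟩ := h
    rw [eq_of_heq h]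

/-- An acyclic complex of free modules has a contraction, and (∂ + δ)_odd is then bijective.
Transporting the odd basis along it and invoking invariance of rank matches the two index sets, so
the matrix is square and invertible. -/
theorem exists_isTorsion (hF : F.IsAcyclic p) : ∃ t, IsTorsion p b t := by
  have hproj : ∀ ν, Module.Projective (C0 p Γ) (F.C p ν) := fun ν =>
    Module.Projective.of_basis (BaseChange.basis _ (b ν))
  obtain ⟨δ, h0, hδ⟩ := exists_contraction hF.1 hF.2
  have hbij := bijective_oddD_add_oddδ (F.subsingleton_C) (F.bdC_comp (p := p)) h0 hδ
  have f1 := finite_index b (fun k => 2 * k + 1) (fun k => by omega)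
  have f2 := finite_index b (fun k => 2 * k) (fun k => by omega)
  obtain ⟨r, ⟨eOdd⟩⟩ := Finite.exists_equiv_fin (Σ k : ℕ, Fin (n (2 * k + 1)))
  let e := LinearEquiv.ofBijective _ hbij
  let ee : (Σ k : ℕ, Fin (n (2 * k + 1))) ≃ Σ k : ℕ, Fin (n (2 * k)) :=
    ((basisOdd p b).map e).indexEquiv (basisEven p b)
  let eEven := ee.symm.trans eOdd
  let B := (basisOdd p b).reindex eOdd
  let B' := (basisEven p b).reindex eEven
  let a : GLr (C0 p Γ) r :=
    { val := rowMatrix B B' e.toLinearMap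
      inv := rowMatrix B' B e.symm.toLinearMap
      val_inv := by rw [← rowMatrix_comp, LinearEquiv.symm_comp, rowMatrix_id]
      inv_val := by rw [← rowMatrix_comp, LinearEquiv.comp_symm, rowMatrix_id] }
  refine ⟨_, δ, r, eOdd, eEven, a, ⟨h0, hδ⟩, fun i j => ?_, rfl⟩
  rw [oddMap_eq]
  simp only [a, rowMatrix, B, B', Module.Basis.repr_reindex_apply, Module.Basis.reindex_apply]
  rfl

end FLResolution

end TorsionExists

/-! ### Series with coefficients in `ℤ_p` -/

section IntegralSeries

variable {p : ℕ} [hp : Fact p.Prime] {Γ : Type*} [Group Γ]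

theorem norm_tsum_le_one {ι : Type*} {f : ι → ℚ_[p]} (hf : Summable f) (h : ∀ i, ‖f i‖ ≤ 1) :
    ‖∑' i, f i‖ ≤ 1 := by
  have hc : IsClosed {x : ℚ_[p] | ‖x‖ ≤ 1} := isClosed_le continuous_norm continuous_const
  exact hc.mem_of_tendsto hf.hasSum (Eventually.of_forall fun s =>
    (PadicInt.subring p).sum_mem fun i _ => h i)

variable (p Γ) in
/-- The subring of `c₀(Γ)` of the series with coefficients in `ℤ_p`. -/
def c0Int : Subring (C0 p Γ) where
  carrier := {x | ∀ γ, ‖x.coeff γ‖ ≤ 1}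
  mul_mem' {x y} hx hy γ := by
    rw [C0.coeff_mul]
    exact norm_tsum_le_one (x.summable_conv y γ) fun α =>
      (PadicInt.subring p).mul_mem (hx α) (hy _)
  one_mem' γ := by
    classical
    change ‖(C0.single 1 : C0 p Γ).coeff γ‖ ≤ 1
    rw [C0.coeff_single]
    split_ifs <;> simp
  add_mem' {x y} hx hy γ := (PadicInt.subring p).add_mem (hx γ) (hy γ)
  zero_mem' γ := by simp
  neg_mem' {x} hx γ := by simpa using hx γ

theorem C0.coeff_nsmul (m : ℕ) (x : C0 p Γ) (γ : Γ) : (m • x).coeff γ = m * x.coeff γ := by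
  rw [← Nat.cast_smul_eq_nsmul ℚ_[p], C0.coeff_smul, Pi.smul_apply, smul_eq_mul]

theorem C0.nsmul_inv_smul {m : ℕ} (hm : m ≠ 0) (x : C0 p Γ) : m • ((m : ℚ_[p])⁻¹ • x) = x := by
  rw [← Nat.cast_smul_eq_nsmul ℚ_[p], smul_smul, mul_inv_cancel₀ (Nat.cast_ne_zero.2 hm), one_smul]

theorem coeff_groupRingToC0 (u : ℤ[Γ]) (γ : Γ) :
    (groupRingToC0 p Γ u).coeff γ = (u.coeff γ : ℚ_[p]) := by
  classical
  induction u using MonoidAlgebra.induction_linear with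
  | zero => simp
  | add x y hx hy => simp [hx, hy]
  | single γ' m =>
    have : groupRingToC0 p Γ (MonoidAlgebra.single γ' m) = m • C0.single γ' := by
      simp [groupRingToC0, C0.of]
    rw [this, ← Int.cast_smul_eq_zsmul ℚ_[p], C0.coeff_smul, Pi.smul_apply, C0.coeff_single]
    by_cases h : γ' = γ
    · simp [h]
    · simp [Ne.symm h]

theorem groupRingToC0_mem (u : ℤ[Γ]) : groupRingToC0 p Γ u ∈ c0Int p Γ := fun γ => by
  rw [coeff_groupRingToC0]
  exact Padic.norm_int_le_one _

theorem exists_pow_smul_mem (x : C0 p Γ) : ∃ k : ℕ, ∀ l, k ≤ l → p ^ l • x ∈ c0Int p Γ := by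
  obtain ⟨k, hk⟩ := pow_unbounded_of_one_lt ‖x‖ (y := (p : ℝ)) (by exact_mod_cast hp.1.one_lt)
  refine ⟨k, fun l hl γ => ?_⟩
  have h1 : ‖x.coeff γ‖ ≤ (p : ℝ) ^ l := (x.norm_coeff_le γ).trans (hk.le.trans
    (pow_le_pow_right₀ (by exact_mod_cast hp.1.one_lt.le) hl))
  rw [C0.coeff_nsmul, norm_mul, Nat.cast_pow, norm_pow, Padic.norm_p, inv_pow]
  have : (0 : ℝ) < (p : ℝ) ^ l := pow_pos (by exact_mod_cast hp.1.pos) _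
  rwa [inv_mul_le_iff₀ this, mul_one]

theorem norm_le_of_eq_pow_smul {x y : C0 p Γ} {k : ℕ} (hy : y ∈ c0Int p Γ) (h : x = p ^ k • y)
    (γ : Γ) : ‖x.coeff γ‖ ≤ (p : ℝ) ^ (-k : ℤ) := by
  rw [h, C0.coeff_nsmul, norm_mul, Nat.cast_pow, norm_pow, Padic.norm_p, zpow_neg, zpow_natCast,
    inv_pow]
  exact mul_le_of_le_one_right (by positivity) (hy γ)

/-- All but finitely many coefficients of a null series are divisible by p, so modulo p an integral
series is already an element of ℤΓ. -/
theorem exists_approx {x : C0 p Γ} (hx : x ∈ c0Int p Γ) :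
    ∃ (u : ℤ[Γ]) (x' : C0 p Γ), x' ∈ c0Int p Γ ∧ x = groupRingToC0 p Γ u + p • x' := by
  -- Choosing the representative 0 whenever |x_γ| < 1 is what makes the support of `m` finite.
  have h1 : ∀ γ, ∃ m : ℤ, ‖x.coeff γ - m‖ < 1 ∧ (‖x.coeff γ‖ < 1 → m = 0) := by
    intro γ
    by_cases h : ‖x.coeff γ‖ < 1
    · exact ⟨0, by simpa using h, fun _ => rfl⟩
    · obtain ⟨z, hz⟩ : ∃ z : ℤ_[p], (z : ℚ_[p]) = x.coeff γ := ⟨⟨_, hx γ⟩, rfl⟩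
      obtain ⟨m, -, hm⟩ := PadicInt.exists_mem_range z
      refine ⟨m, ?_, fun h' => absurd h' h⟩
      rw [IsLocalRing.mem_maximalIdeal, PadicInt.mem_nonunits, PadicInt.norm_def,
        PadicInt.coe_sub, PadicInt.coe_natCast, hz] at hm
      rwa [Int.cast_natCast]
  choose m hm1 hm2 using h1
  have hfin : (Function.support m).Finite := by
    have h : Tendsto (fun γ => ‖x.coeff γ‖) cofinite (𝓝 0) := by
      simpa using x.tendsto_coeff.norm
    have h1 : {γ | ¬ ‖x.coeff γ‖ < 1}.Finite := h.eventually (gt_mem_nhds one_pos)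
    exact h1.subset fun γ hγ h => hγ (hm2 γ h)
  let u : ℤ[Γ] := .ofCoeff (Finsupp.ofSupportFinite m hfin)
  have hu : ∀ γ, u.coeff γ = m γ := fun γ => rfl
  refine ⟨u, (p : ℚ_[p])⁻¹ • (x - groupRingToC0 p Γ u), fun γ => ?_, ?_⟩
  -- The value group is discrete: norm below 1 means norm at most p⁻¹.
  · have h2 : ‖x.coeff γ - m γ‖ ≤ (p : ℝ) ^ (-1 : ℤ) :=
      (Padic.norm_le_pow_iff_norm_lt_pow_add_one _ _).2 (by simpa using hm1 γ)
    have h0 : (0 : ℝ) < p := by exact_mod_cast hp.1.pos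
    rw [C0.coeff_smul, Pi.smul_apply, sub_eq_add_neg, C0.coeff_add, C0.coeff_neg, Pi.add_apply,
      Pi.neg_apply, coeff_groupRingToC0, hu, ← sub_eq_add_neg, smul_eq_mul, norm_mul, norm_inv,
      Padic.norm_p, inv_inv]
    rw [zpow_neg_one] at h2
    calc _ ≤ (p : ℝ) * (p : ℝ)⁻¹ := by gcongr
      _ = 1 := mul_inv_cancel₀ h0.ne'
  · rw [C0.nsmul_inv_smul hp.1.ne_zero, add_sub_cancel]

/-- Divisibility by p^k can be tested on coefficients, and for an integer it is the same in ℤ as in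
ℤ_p. The approximation argument returns from c₀(Γ) to ℤΓ through this. -/
theorem exists_eq_pow_smul {u : ℤ[Γ]} {y : C0 p Γ} {k : ℕ} (hy : y ∈ c0Int p Γ)
    (h : groupRingToC0 p Γ u = p ^ k • y) : ∃ u' : ℤ[Γ], u = p ^ k • u' := by
  have hdvd : ∀ γ, (p ^ k : ℤ) ∣ u.coeff γ := fun γ => by
    rw [← Padic.norm_int_le_pow_iff_dvd (p := p), ← coeff_groupRingToC0]
    exact norm_le_of_eq_pow_smul hy h γ
  refine ⟨.ofCoeff (u.coeff.mapRange (· / (p ^ k : ℤ)) (by simp)), ?_⟩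
  ext γ
  have := Int.mul_ediv_cancel' (hdvd γ)
  change u.coeff γ = p ^ k • (u.coeff γ / (p ^ k : ℤ))
  rw [nsmul_eq_mul, Nat.cast_pow]
  exact this.symm

theorem eq_zero_of_forall_pow_smul {x : C0 p Γ}
    (h : ∀ k : ℕ, ∃ y ∈ c0Int p Γ, x = p ^ k • y) : x = 0 := by
  refine C0.ext fun γ => ?_
  rw [C0.coeff_zero, Pi.zero_apply, ← norm_le_zero_iff]
  have ht : Tendsto (fun k : ℕ => ((p : ℝ)⁻¹) ^ k) atTop (𝓝 0) :=
    tendsto_pow_atTop_nhds_zero_of_lt_one (by positivity)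
      (inv_lt_one_of_one_lt₀ (by exact_mod_cast hp.1.one_lt))
  refine ge_of_tendsto' ht fun k => ?_
  obtain ⟨y, hy, hxy⟩ := h k
  have := norm_le_of_eq_pow_smul hy hxy γ
  rwa [zpow_neg, zpow_natCast, ← inv_pow] at this

/-- This is p-adic completeness of the integral series. The sum ∑ p^k w_k is formed coefficientwise;
its coefficients tend to 0 by dominated convergence against the geometric series, and `y` is the
tail divided by p^K. -/
theorem exists_series (w : ℕ → C0 p Γ) (hw : ∀ k, w k ∈ c0Int p Γ) :
    ∃ x ∈ c0Int p Γ, ∀ K : ℕ, ∃ y ∈ c0Int p Γ,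
      x = ∑ k ∈ Finset.range K, p ^ k • w k + p ^ K • y := by
  have hbound : ∀ (v : ℕ → C0 p Γ), (∀ k, v k ∈ c0Int p Γ) → ∀ (γ : Γ) (k : ℕ),
      ‖(p : ℚ_[p]) ^ k * (v k).coeff γ‖ ≤ ((p : ℝ)⁻¹) ^ k := by
    intro v hv γ k
    rw [norm_mul, norm_pow, Padic.norm_p]
    exact mul_le_of_le_one_right (by positivity) (hv k γ)
  have hgeo : Summable fun k : ℕ => ((p : ℝ)⁻¹) ^ k :=
    summable_geometric_of_lt_one (by positivity)
      (inv_lt_one_of_one_lt₀ (by exact_mod_cast hp.1.one_lt))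
  have hsum : ∀ (v : ℕ → C0 p Γ), (∀ k, v k ∈ c0Int p Γ) → ∀ γ : Γ,
      Summable fun k => (p : ℚ_[p]) ^ k * (v k).coeff γ :=
    fun v hv γ => Summable.of_norm_bounded hgeo (hbound v hv γ)
  have hlim : ∀ (v : ℕ → C0 p Γ), (∀ k, v k ∈ c0Int p Γ) →
      Tendsto (fun γ => ∑' k, (p : ℚ_[p]) ^ k * (v k).coeff γ) cofinite (𝓝 0) := by
    intro v hv
    have := tendsto_tsum_of_dominated_convergence (𝓕 := cofinite)
      (f := fun (γ : Γ) (k : ℕ) => (p : ℚ_[p]) ^ k * (v k).coeff γ) (g := fun _ => 0) hgeo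
      (fun k => by simpa using (v k).tendsto_coeff.const_mul ((p : ℚ_[p]) ^ k))
      (Eventually.of_forall fun γ k => hbound v hv γ k)
    simpa using this
  have hmem : ∀ (v : ℕ → C0 p Γ) (hv : ∀ k, v k ∈ c0Int p Γ),
      C0.mk _ (hlim v hv) ∈ c0Int p Γ := fun v hv γ => by
    rw [C0.coeff_mk]
    refine norm_tsum_le_one (hsum v hv γ) fun k => (hbound v hv γ k).trans ?_
    exact pow_le_one₀ (by positivity)
      (inv_le_one_of_one_le₀ (by exact_mod_cast hp.1.one_lt.le))
  refine ⟨C0.mk _ (hlim w hw), hmem w hw, fun K =>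
    ⟨C0.mk _ (hlim (fun k => w (K + k)) fun k => hw _),
      hmem (fun k => w (K + k)) (fun k => hw _), C0.ext fun γ => ?_⟩⟩
  have hcs : ∀ s : Finset ℕ, (∑ k ∈ s, p ^ k • w k).coeff γ =
      ∑ k ∈ s, (p : ℚ_[p]) ^ k * (w k).coeff γ := by
    intro s
    induction s using Finset.induction_on with
    | empty => simp
    | insert a s ha ih =>
      rw [Finset.sum_insert ha, Finset.sum_insert ha, C0.coeff_add, Pi.add_apply, ih,
        C0.coeff_nsmul, Nat.cast_pow]
  rw [C0.coeff_add, Pi.add_apply, hcs, C0.coeff_nsmul, C0.coeff_mk, C0.coeff_mk, ← tsum_mul_left,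
    ← (hsum w hw γ).sum_add_tsum_nat_add K]
  congr 1
  refine tsum_congr fun k => ?_
  rw [Nat.cast_pow, ← mul_assoc, ← pow_add, add_comm k K]

end IntegralSeries

/-! ### Integral elements of `c₀(Γ) ⊗ F` -/

section IntegralElements

open Module

variable {p : ℕ} [hp : Fact p.Prime] {Γ : Type*} [Group Γ] {ι ι' : Type*} [Fintype ι] [Fintype ι']
  {F F' : Type*} [AddCommGroup F] [Module ℤ[Γ] F] [AddCommGroup F'] [Module ℤ[Γ] F']
  (b : Basis ι ℤ[Γ] F) (b' : Basis ι' ℤ[Γ] F')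

theorem basis_repr_tmul (s : C0 p Γ) (m : F) (i : ι) :
    (BaseChange.basis (groupRingToC0 p Γ) b).repr (BaseChange.tmul _ s m) i =
      s * groupRingToC0 p Γ (b.repr m i) := rfl

/-- The coordinates of `x` with respect to `1 ⊗ b` have coefficients in `ℤ_p`. -/
def IsInt (x : BaseChange (groupRingToC0 p Γ) F) : Prop :=
  ∀ i, (BaseChange.basis (groupRingToC0 p Γ) b).repr x i ∈ c0Int p Γ

theorem IsInt.add {x y : BaseChange (groupRingToC0 p Γ) F} (hx : IsInt b x) (hy : IsInt b y) :
    IsInt b (x + y) := fun i => by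
  rw [map_add, Finsupp.add_apply]
  exact add_mem (hx i) (hy i)

theorem IsInt.neg {x : BaseChange (groupRingToC0 p Γ) F} (hx : IsInt b x) :
    IsInt b (-x) := fun i => by
  rw [map_neg, Finsupp.neg_apply]
  exact neg_mem (hx i)

theorem isInt_tmul (m : F) : IsInt b (BaseChange.tmul (groupRingToC0 p Γ) 1 m) := fun i => by
  rw [basis_repr_tmul, one_mul]
  exact groupRingToC0_mem _

theorem IsInt.map {x : BaseChange (groupRingToC0 p Γ) F} (hx : IsInt b x) (f : F →ₗ[ℤ[Γ]] F') :
    IsInt b' (BaseChange.map _ f x) := fun j => by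
  rw [← (BaseChange.basis (groupRingToC0 p Γ) b).sum_repr x, map_sum, map_sum,
    Finsupp.finsetSum_apply]
  refine sum_mem fun i _ => ?_
  rw [map_smul, map_smul, Finsupp.smul_apply, smul_eq_mul, BaseChange.basis_apply,
    BaseChange.map_tmul]
  exact mul_mem (hx i) (isInt_tmul b' _ j)

theorem basis_repr_nsmul (m : ℕ) (x : BaseChange (groupRingToC0 p Γ) F) (i : ι) :
    (BaseChange.basis (groupRingToC0 p Γ) b).repr (m • x) i =
      m • (BaseChange.basis (groupRingToC0 p Γ) b).repr x i := by
  rw [map_nsmul, Finsupp.smul_apply]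

theorem exists_pow_smul_isInt (x : BaseChange (groupRingToC0 p Γ) F) :
    ∃ k : ℕ, IsInt b (p ^ k • x) := by
  choose k hk using fun i =>
    exists_pow_smul_mem ((BaseChange.basis (groupRingToC0 p Γ) b).repr x i)
  refine ⟨∑ i, k i, fun i => ?_⟩
  rw [basis_repr_nsmul]
  exact hk i _ (Finset.single_le_sum (f := k) (fun _ _ => Nat.zero_le _) (Finset.mem_univ i))

theorem IsInt.exists_approx {x : BaseChange (groupRingToC0 p Γ) F} (hx : IsInt b x) :
    ∃ (u : F) (x' : BaseChange (groupRingToC0 p Γ) F), IsInt b x' ∧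
      x = BaseChange.tmul _ 1 u + p • x' := by
  choose u y hy hxy using fun i => PadicTorsion.exists_approx (hx i)
  let B := BaseChange.basis (groupRingToC0 p Γ) b
  refine ⟨b.equivFun.symm u, B.equivFun.symm y, fun i => ?_, ?_⟩
  · change B.equivFun (B.equivFun.symm y) i ∈ _
    rw [LinearEquiv.apply_symm_apply]
    exact hy i
  · refine B.ext_elem fun i => ?_
    rw [map_add, Finsupp.add_apply]
    change B.repr x i = (BaseChange.basis (groupRingToC0 p Γ) b).repr _ i +
      (BaseChange.basis (groupRingToC0 p Γ) b).repr _ i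
    rw [basis_repr_nsmul, basis_repr_tmul, one_mul]
    change _ = groupRingToC0 p Γ (b.equivFun (b.equivFun.symm u) i) +
      p • B.equivFun (B.equivFun.symm y) i
    rw [LinearEquiv.apply_symm_apply, LinearEquiv.apply_symm_apply]
    exact hxy i

theorem exists_eq_pow_smul_of_tmul {u : F} {y : BaseChange (groupRingToC0 p Γ) F} {k : ℕ}
    (hy : IsInt b y) (h : BaseChange.tmul (groupRingToC0 p Γ) 1 u = p ^ k • y) :
    ∃ u' : F, u = p ^ k • u' := by
  have h' : ∀ i, ∃ v : ℤ[Γ], b.repr u i = p ^ k • v := fun i => by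
    refine exists_eq_pow_smul (hy i) ?_
    rw [← basis_repr_nsmul, ← h, basis_repr_tmul, one_mul]
  choose v hv using h'
  refine ⟨b.equivFun.symm v, b.ext_elem fun i => ?_⟩
  rw [hv, map_nsmul, Finsupp.smul_apply]
  congr 1
  exact (congrFun (b.equivFun.apply_symm_apply v) i).symm

theorem IsInt.eq_zero {x : BaseChange (groupRingToC0 p Γ) F}
    (h : ∀ k : ℕ, ∃ y, IsInt b y ∧ x = p ^ k • y) : x = 0 := by
  refine (BaseChange.basis (groupRingToC0 p Γ) b).ext_elem fun i => ?_
  rw [map_zero, Finsupp.zero_apply]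
  refine eq_zero_of_forall_pow_smul fun k => ?_
  obtain ⟨y, hy, hxy⟩ := h k
  exact ⟨_, hy i, by rw [hxy, basis_repr_nsmul]⟩

theorem IsInt.exists_series (w : ℕ → BaseChange (groupRingToC0 p Γ) F) (hw : ∀ k, IsInt b (w k)) :
    ∃ x, ∀ K : ℕ, ∃ y, IsInt b y ∧ x = ∑ k ∈ Finset.range K, p ^ k • w k + p ^ K • y := by
  choose x _ y hy hxy using fun i => PadicTorsion.exists_series (fun k =>
    (BaseChange.basis (groupRingToC0 p Γ) b).repr (w k) i) (fun k => hw k i)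
  let B := BaseChange.basis (groupRingToC0 p Γ) b
  refine ⟨B.equivFun.symm x, fun K => ⟨B.equivFun.symm fun i => y i K, fun i => ?_, ?_⟩⟩
  · change B.equivFun (B.equivFun.symm _) i ∈ _
    rw [LinearEquiv.apply_symm_apply]
    exact hy i K
  · refine B.ext_elem fun i => ?_
    change B.equivFun (B.equivFun.symm _) i = _
    rw [LinearEquiv.apply_symm_apply, hxy i K, map_add, Finsupp.add_apply, map_sum,
      Finsupp.finsetSum_apply]
    congr 1
    · exact Finset.sum_congr rfl fun k _ => (basis_repr_nsmul b _ _ _).symm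
    · refine Eq.trans ?_ (basis_repr_nsmul b _ _ _).symm
      congr 1
      exact (congrFun (B.equivFun.apply_symm_apply fun i => y i K) i).symm

theorem nsmul_injective_baseChange {m : ℕ} (hm : m ≠ 0) {x : BaseChange (groupRingToC0 p Γ) F}
    (h : m • x = 0) : x = 0 := by
  have h1 : (m : C0 p Γ) • x = 0 := by rw [Nat.cast_smul_eq_nsmul, h]
  have h2 : algebraMap ℚ_[p] (C0 p Γ) ((m : ℚ_[p])⁻¹) * (m : C0 p Γ) = 1 := by
    rw [← map_natCast (algebraMap ℚ_[p] (C0 p Γ)), ← map_mul,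
      inv_mul_cancel₀ (Nat.cast_ne_zero.2 hm), map_one]
  rw [← one_smul (C0 p Γ) x, ← h2, mul_smul, h1, smul_zero]

theorem exists_nsmul_eq_baseChange {m : ℕ} (hm : m ≠ 0) (x : BaseChange (groupRingToC0 p Γ) F) :
    ∃ y, m • y = x := by
  refine ⟨algebraMap ℚ_[p] (C0 p Γ) ((m : ℚ_[p])⁻¹) • x, ?_⟩
  have h2 : (m : C0 p Γ) * algebraMap ℚ_[p] (C0 p Γ) ((m : ℚ_[p])⁻¹) = 1 := by
    rw [← map_natCast (algebraMap ℚ_[p] (C0 p Γ)), ← map_mul,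
      mul_inv_cancel₀ (Nat.cast_ne_zero.2 hm), map_one]
  rw [← Nat.cast_smul_eq_nsmul (C0 p Γ), smul_smul, h2, one_smul]

include b in
theorem nsmul_injective_free {m : ℕ} (hm : m ≠ 0) {x : F} (h : m • x = 0) : x = 0 := by
  refine b.ext_elem fun i => ?_
  rw [map_zero, Finsupp.zero_apply]
  have h1 : m • b.repr x i = 0 := by
    rw [← Finsupp.smul_apply, ← map_nsmul, h, map_zero, Finsupp.zero_apply]
  ext γ
  have h2 : m • (b.repr x i).coeff γ = 0 := by
    rw [← Finsupp.smul_apply, ← MonoidAlgebra.coeff_smul, h1]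
    rfl
  simpa [hm] using h2

end IntegralElements

/-! ### Right exactness of the tensor product -/

/-- Lifting m to F' and passing to the cokernel of id ⊗ f gives, by exactness, a well defined
φ-semilinear map on M. It extends to S ⊗ M = 0, so the projection to the cokernel vanishes on all
tensors. -/
theorem surjective_baseChange_map {R S : Type*} [Ring R] [Ring S] (φ : R →+* S)
    {F F' M : Type*} [AddCommGroup F] [AddCommGroup F'] [AddCommGroup M] [Module R F]
    [Module R F'] [Module R M] (f : F →ₗ[R] F') (π : F' →ₗ[R] M) (hπ : Function.Surjective π)
    (hf : Function.Exact f π) (hM : Subsingleton (BaseChange φ M)) :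
    Function.Surjective (BaseChange.map φ f) := by
  let Q := BaseChange φ F' ⧸ LinearMap.range (BaseChange.map φ f)
  let q : BaseChange φ F' →ₗ[S] Q := (LinearMap.range (BaseChange.map φ f)).mkQ
  let σ := Function.surjInv hπ
  have hσ : ∀ m, π (σ m) = m := Function.surjInv_eq hπ
  have key : ∀ x y, π x = π y → q (BaseChange.tmul φ 1 x) = q (BaseChange.tmul φ 1 y) := by
    intro x y hxy
    obtain ⟨z, hz⟩ := (hf (x - y)).1 (by rw [map_sub, hxy, sub_self])
    have h0 : q (BaseChange.tmul φ 1 (x - y)) = 0 := by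
      rw [← hz, ← BaseChange.map_tmul]
      exact (Submodule.Quotient.mk_eq_zero _).2 ⟨_, rfl⟩
    have : BaseChange.tmul φ 1 x = BaseChange.tmul φ 1 (x - y) + BaseChange.tmul φ 1 y := by
      rw [← BaseChange.tmul_add, sub_add_cancel]
    rw [this, map_add, h0, zero_add]
  let g : M →+ Q :=
    { toFun := fun m => q (BaseChange.tmul φ 1 (σ m))
      map_zero' := by
        rw [key (σ 0) 0 (by rw [hσ, map_zero]), BaseChange.tmul_zero, map_zero]
      map_add' := fun m n => by
        rw [key (σ (m + n)) (σ m + σ n) (by simp [hσ]), BaseChange.tmul_add, map_add] }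
  have hg : ∀ (r : R) (m : M), g (r • m) = φ r • g m := fun r m => by
    change q (BaseChange.tmul φ 1 (σ (r • m))) = φ r • q (BaseChange.tmul φ 1 (σ m))
    rw [key (σ (r • m)) (r • σ m) (by simp [hσ]), BaseChange.tmul_smul, ← map_smul,
      BaseChange.smul_tmul, one_mul, mul_one]
  have hq : ∀ x, q x = 0 := by
    intro x
    induction x using BaseChange.induction with
    | zero => exact map_zero _
    | tmul s m =>
      have h1 := BaseChange.lift_tmul φ g hg s (π m)
      rw [Subsingleton.elim (BaseChange.tmul φ s (π m)) 0, map_zero] at h1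
      have h2 : g (π m) = q (BaseChange.tmul φ 1 m) := key _ _ (hσ _)
      rw [h2, ← map_smul, BaseChange.smul_tmul, mul_one] at h1
      exact h1.symm
    | add x y hx hy => rw [map_add, hx, hy, add_zero]
  intro x
  exact (Submodule.Quotient.mk_eq_zero _).1 (hq x)

/-! ### Acyclicity -/

section Acyclic

namespace FLResolution

variable {p : ℕ} [hp : Fact p.Prime] {Γ : Type} [Group Γ] {M : Type} [AddCommGroup M]
  [Module ℤ[Γ] M] (F : FLResolution Γ M)

theorem bdC_tmul (ν : ℕ) (u : F.F (ν + 1)) :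
    F.bdC p ν (BaseChange.tmul _ 1 u) = BaseChange.tmul _ 1 (F.bd ν u) := BaseChange.map_tmul _ _ _ _

theorem exists_basis : ∃ (n : ℕ → ℕ), Nonempty (∀ ν, Module.Basis (Fin (n ν)) ℤ[Γ] (F.F ν)) := by
  refine ⟨fun ν => Fintype.card (Module.Free.ChooseBasisIndex ℤ[Γ] (F.F ν)),
    ⟨fun ν => (Module.Free.chooseBasis ℤ[Γ] (F.F ν)).reindex (Fintype.equivFin _)⟩⟩

variable {F} {n : ℕ → ℕ} (b : ∀ ν, Module.Basis (Fin (n ν)) ℤ[Γ] (F.F ν))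

/-- The point is to make u - p z a cycle of F_•. Since x is a cycle, ∂u = p w for some w. If ν ≥ 1,
then w is a cycle because F is torsion free, hence a boundary. If ν = 0, finer approximations U_k of
x modulo p^(k+1) give ∂U_k = p^(k+1) w_k with p w_{k+1} = w_k + ∂v_k; the classes of the w_k in M
form an element of lim M_{p^i} = 0, so w_0 is a boundary. -/
theorem bd_eq_of_cycle (hlim : limTorsion p M = ⊥) (ν : ℕ) {x : F.C p (ν + 1)}
    (hx : IsInt (b (ν + 1)) x) (hcyc : F.bdC p ν x = 0) {u : F.F (ν + 1)} {x' : F.C p (ν + 1)}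
    (hx' : IsInt (b (ν + 1)) x') (hu : x = BaseChange.tmul _ 1 u + p • x') :
    ∃ z, F.bd ν u = p • F.bd ν z := by
  have hp0 : p ≠ 0 := hp.1.ne_zero
  -- an integral cycle which is `u` modulo `p ^ k` gives `bd u ∈ p ^ k F`
  have hdiv : ∀ (k : ℕ) (v : F.F (ν + 1)) (y : F.C p (ν + 1)), IsInt (b (ν + 1)) y →
      x = BaseChange.tmul _ 1 v + p ^ k • y → ∃ w, F.bd ν v = p ^ k • w := by
    intro k v y hy hv
    have h := hcyc
    rw [hv, map_add, map_nsmul, bdC_tmul] at h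
    refine exists_eq_pow_smul_of_tmul (b ν) (y := -F.bdC p ν y) ((hy.map _ (b ν) _).neg) ?_
    rw [smul_neg]
    exact eq_neg_of_add_eq_zero_left h
  rcases ν with _ | ν
  · have hstep : ∀ y : {y : F.C p 1 // IsInt (b 1) y}, ∃ (v : F.F 1)
        (y' : {y : F.C p 1 // IsInt (b 1) y}), y.1 = BaseChange.tmul _ 1 v + p • y'.1 := by
      rintro ⟨y, hy⟩
      obtain ⟨v, y', hy', h⟩ := hy.exists_approx
      exact ⟨v, ⟨y', hy'⟩, h⟩
    choose v next hnext using hstep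
    let y : ℕ → {y : F.C p 1 // IsInt (b 1) y} := fun k => Nat.rec ⟨x', hx'⟩ (fun _ => next) k
    let U : ℕ → F.F 1 := fun k => u + ∑ l ∈ Finset.range k, p ^ (l + 1) • v (y l)
    have hU : ∀ k, x = BaseChange.tmul _ 1 (U k) + p ^ (k + 1) • (y k).1 := by
      intro k
      induction k with
      | zero =>
        simp only [U, Finset.range_zero, Finset.sum_empty, add_zero, zero_add, pow_one]
        exact hu
      | succ k ih =>
        have h1 : U (k + 1) = U k + p ^ (k + 1) • v (y k) := by
          simp only [U, Finset.sum_range_succ, add_assoc]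
        have h2 : (y k).1 = BaseChange.tmul _ 1 (v (y k)) + p • (y (k + 1)).1 := hnext (y k)
        have h3 : BaseChange.tmul (groupRingToC0 p Γ) 1 (U (k + 1)) =
            BaseChange.tmul _ 1 (U k) + p ^ (k + 1) • BaseChange.tmul _ 1 (v (y k)) := by
          rw [h1]
          exact (BaseChange.tmul_add _ 1 (U k) _).trans (congrArg _
            (map_nsmul (AddMonoidHom.mk' (BaseChange.tmul (groupRingToC0 p Γ) 1)
              (BaseChange.tmul_add _ 1)) (p ^ (k + 1)) (v (y k))))
        rw [ih, h2, h3, smul_add, smul_smul, ← pow_succ, ← add_assoc]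
    choose w hw using fun k => hdiv (k + 1) (U k) (y k).1 (y k).2 (hU k)
    have hww : ∀ k, p • w (k + 1) = w k + F.bd 0 (v (y k)) := by
      intro k
      have h1 : U (k + 1) = U k + p ^ (k + 1) • v (y k) := by
        simp only [U, Finset.sum_range_succ, add_assoc]
      have h2 := hw (k + 1)
      rw [h1, map_add, hw k, map_nsmul, ← smul_add, pow_succ p (k + 1), mul_smul] at h2
      refine (sub_eq_zero.1 (nsmul_injective_free (b 0) (pow_ne_zero (k + 1) hp0) ?_)).symm
      rw [smul_sub, h2, sub_self]
    have hπ : ∀ z, F.π (F.bd 0 z) = 0 := F.exact_zero.apply_apply_eq_zero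
    -- The index is shifted by one: the class of `w k` is killed by p^(k+1), and slot 0 needs an
    -- element killed by p⁰ = 1.
    let m : ℕ → M := fun k => Nat.casesOn k (p • F.π (w 0)) fun k => F.π (w k)
    have hm : m ∈ limTorsion p M := by
      have hw0 : ∀ k, p ^ (k + 1) • F.π (w k) = 0 := fun k => by
        rw [← map_nsmul, ← hw k, hπ]
      intro i
      cases i with
      | zero =>
        refine ⟨?_, rfl⟩
        have := hw0 0
        simpa [m] using this
      | succ k =>
        refine ⟨hw0 k, ?_⟩
        change p • F.π (w (k + 1)) = F.π (w k)
        rw [← map_nsmul, hww, map_add, hπ, add_zero]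
    rw [hlim, AddSubgroup.mem_bot] at hm
    obtain ⟨z, hz⟩ := (F.exact_zero (w 0)).1 (congrFun hm 1)
    refine ⟨z, ?_⟩
    have h0 := hw 0
    simp only [U, Finset.range_zero, Finset.sum_empty, add_zero, zero_add, pow_one] at h0
    rw [h0, hz]
  · obtain ⟨w, hw⟩ := hdiv 1 u x' hx' (by rw [pow_one]; exact hu)
    rw [pow_one] at hw
    obtain ⟨z, hz⟩ := (F.exact_succ ν w).1 (by
      refine nsmul_injective_free (b ν) hp0 ?_
      rw [← map_nsmul, ← hw, (F.exact_succ ν).apply_apply_eq_zero])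
    exact ⟨z, by rw [hw, hz]⟩

/-- One step of the successive approximation: u - p z is a cycle of F_•, hence a boundary. The
remainder is again an integral cycle, because multiplication by p is injective, so the step can be
repeated. -/
theorem exists_bd_approx (hlim : limTorsion p M = ⊥) (ν : ℕ) {x : F.C p (ν + 1)}
    (hx : IsInt (b (ν + 1)) x) (hcyc : F.bdC p ν x = 0) :
    ∃ (w : F.F (ν + 1 + 1)) (x' : F.C p (ν + 1)), IsInt (b (ν + 1)) x' ∧ F.bdC p ν x' = 0 ∧
      x = F.bdC p (ν + 1) (BaseChange.tmul _ 1 w) + p • x' := by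
  obtain ⟨u, y, hy, hu⟩ := hx.exists_approx
  obtain ⟨z, hz⟩ := bd_eq_of_cycle b hlim ν hx hcyc hy hu
  obtain ⟨w, hw⟩ := (F.exact_succ ν (u - p • z)).1 (by rw [map_sub, map_nsmul, hz, sub_self])
  have hx2 : x = F.bdC p (ν + 1) (BaseChange.tmul _ 1 w) + p • (BaseChange.tmul _ 1 z + y) := by
    rw [bdC_tmul, hw, smul_add, ← add_assoc, hu]
    congr 1
    have h1 : BaseChange.tmul (groupRingToC0 p Γ) 1 (p • z) = p • BaseChange.tmul _ 1 z :=
      map_nsmul (AddMonoidHom.mk' (BaseChange.tmul (groupRingToC0 p Γ) 1)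
        (BaseChange.tmul_add _ 1)) p z
    rw [← h1, ← BaseChange.tmul_add, sub_add_cancel]
  refine ⟨w, _, (isInt_tmul _ z).add _ hy, ?_, hx2⟩
  refine nsmul_injective_baseChange hp.1.ne_zero ?_
  have h2 := hcyc
  rw [hx2, map_add, map_nsmul] at h2
  have h3 : F.bdC p ν (F.bdC p (ν + 1) (BaseChange.tmul _ 1 w)) = 0 :=
    LinearMap.congr_fun (F.bdC_comp (p := p) ν) (BaseChange.tmul _ 1 w)
  rwa [h3, zero_add] at h2

theorem isAcyclic (hexp : IsPadicallyExpansive Γ M p) (hlim : limTorsion p M = ⊥) :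
    F.IsAcyclic p := by
  obtain ⟨n, ⟨b⟩⟩ := F.exists_basis
  refine ⟨surjective_baseChange_map _ (F.bd 0) F.π F.surjective F.exact_zero hexp, fun ν x => ?_⟩
  refine ⟨fun hx => ?_, ?_⟩
  swap
  · rintro ⟨y, rfl⟩
    exact LinearMap.congr_fun (F.bdC_comp ν) _
  -- reduction to integral cycles
  suffices h : ∀ x : F.C p (ν + 1), IsInt (b (ν + 1)) x → F.bdC p ν x = 0 →
      ∃ w, F.bdC p (ν + 1) w = x by
    obtain ⟨k, hk⟩ := exists_pow_smul_isInt (b (ν + 1)) x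
    obtain ⟨w, hw⟩ := h _ hk (by rw [map_nsmul, hx, smul_zero])
    obtain ⟨w', rfl⟩ := exists_nsmul_eq_baseChange (pow_ne_zero k hp.1.ne_zero) w
    refine ⟨w', sub_eq_zero.1 (nsmul_injective_baseChange (pow_ne_zero k hp.1.ne_zero) ?_)⟩
    rw [smul_sub, ← map_nsmul, hw, sub_self]
  intro x hxint hxcyc
  have hstep : ∀ x : {x : F.C p (ν + 1) // IsInt (b (ν + 1)) x ∧ F.bdC p ν x = 0},
      ∃ (w : F.F (ν + 1 + 1)) (x' : {x : F.C p (ν + 1) // IsInt (b (ν + 1)) x ∧ F.bdC p ν x = 0}),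
        x.1 = F.bdC p (ν + 1) (BaseChange.tmul _ 1 w) + p • x'.1 := by
    rintro ⟨x, hx1, hx2⟩
    obtain ⟨w, x', h1, h2, h3⟩ := exists_bd_approx b hlim ν hx1 hx2
    exact ⟨w, ⟨x', h1, h2⟩, h3⟩
  choose w next hnext using hstep
  let X : ℕ → {x : F.C p (ν + 1) // IsInt (b (ν + 1)) x ∧ F.bdC p ν x = 0} :=
    fun k => Nat.rec ⟨x, hxint, hxcyc⟩ (fun _ => next) k
  have hX : ∀ k, x = F.bdC p (ν + 1) (∑ l ∈ Finset.range k,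
      p ^ l • BaseChange.tmul (groupRingToC0 p Γ) 1 (w (X l))) + p ^ k • (X k).1 := by
    intro k
    induction k with
    | zero => simp [X]
    | succ k ih =>
      have h2 : (X k).1 = F.bdC p (ν + 1) (BaseChange.tmul _ 1 (w (X k))) + p • (X (k + 1)).1 :=
        hnext (X k)
      conv_lhs => rw [ih, h2]
      rw [Finset.sum_range_succ, map_add, smul_add, smul_smul, ← pow_succ, map_nsmul]
      exact (add_assoc _ _ _).symm
  obtain ⟨W, hW⟩ := IsInt.exists_series (b (ν + 1 + 1))
    (fun l => BaseChange.tmul (groupRingToC0 p Γ) 1 (w (X l))) (fun l => isInt_tmul _ _)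
  -- The partial sums and the tail of W show that x - ∂W is divisible by every p^k among the
  -- integral elements, hence is zero.
  refine ⟨W, (sub_eq_zero.1 (IsInt.eq_zero (b (ν + 1)) fun k => ?_)).symm⟩
  obtain ⟨y, hy, hWy⟩ := hW k
  refine ⟨(X k).1 + -F.bdC p (ν + 1) y, (X k).2.1.add _ (hy.map _ _ _).neg, ?_⟩
  conv_lhs => rw [hX k, hWy]
  rw [map_add, map_nsmul, smul_add, smul_neg]
  abel

end FLResolution

end Acyclic

open CategoryTheory

/-! ### Vanishing of the homology of free modules -/

section Vanishing

variable {k : Type} [CommRing k] {G : Type} [Group G] {J : Type*} (A : Rep.{0} k G) (β : Module.Basis J k A)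
  (act : G → J → J) (t : J → G) (x : J → J)

/-- The contraction of the complex of inhomogeneous chains for a representation with a basis that
is freely permuted. -/
def chainContraction (n : ℕ) : ((Fin n → G) →₀ A) →ₗ[k] ((Fin (n + 1) → G) →₀ A) :=
  Finsupp.lsum k fun g => β.constr k fun j => Finsupp.single (Fin.cons (t j)⁻¹ g) (β (x j))

theorem chainContraction_single (n : ℕ) (g : Fin n → G) (j : J) :
    chainContraction A β t x n (Finsupp.single g (β j)) =
      Finsupp.single (Fin.cons (t j)⁻¹ g) (β (x j)) := by
  simp [chainContraction]

theorem chainContraction_smul_single (n : ℕ) (c : k) (g : Fin n → G) (j : J) :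
    chainContraction A β t x n (c • Finsupp.single g (β j)) =
      c • Finsupp.single (Fin.cons (t j)⁻¹ g) (β (x j)) := by
  rw [map_smul, chainContraction_single]

theorem contractNth_cons_succ {n : ℕ} (j : Fin (n + 1)) (h : G) (g : Fin (n + 1) → G) :
    Fin.contractNth j.succ (· * ·) (Fin.cons h g : Fin (n + 2) → G) =
      Fin.cons h (Fin.contractNth j (· * ·) g) := by
  funext l
  refine Fin.cases ?_ (fun l => ?_) l
  · rw [Fin.contractNth_apply_of_lt _ _ _ _ (by simp)]
    rfl
  · rcases lt_trichotomy (l : ℕ) j with hl | hl | hl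
    · rw [Fin.contractNth_apply_of_lt _ _ _ _ (by simpa using hl)]
      exact (Fin.contractNth_apply_of_lt _ _ _ _ hl).symm
    · rw [Fin.contractNth_apply_of_eq _ _ _ _ (by simpa using hl)]
      exact (Fin.contractNth_apply_of_eq _ _ _ _ hl).symm
    · rw [Fin.contractNth_apply_of_gt _ _ _ _ (by simpa using hl)]
      exact (Fin.contractNth_apply_of_gt _ _ _ _ hl).symm

theorem contractNth_cons_zero {n : ℕ} (h : G) (g : Fin (n + 1) → G) :
    Fin.contractNth 0 (· * ·) (Fin.cons h g : Fin (n + 2) → G) =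
      Fin.cons (h * g 0) (fun i => g i.succ) := by
  funext l
  refine Fin.cases ?_ (fun l => ?_) l
  · rw [Fin.contractNth_apply_of_eq _ _ _ _ (by simp)]
    rfl
  · rw [Fin.contractNth_apply_of_gt _ _ _ _ (by simp)]
    rfl

variable (hact : ∀ g j, A.ρ g (β j) = β (act g j)) (ht : ∀ g j, t (act g j) = g * t j)
  (hx : ∀ g j, x (act g j) = x j) (htx : ∀ j, A.ρ (t j) (β (x j)) = β j)

include hact ht hx htx

/-- The first face of the prolonged chain undoes the prolongation, as t_j carries the orbit
representative to β_j. The next face, with entry t_j⁻¹ g_0 = t(g_0⁻¹ j)⁻¹, cancels the contraction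
of the first face of g; the remaining faces cancel in pairs. -/
theorem d_chainContraction (n : ℕ) (c : (Fin (n + 1) → G) →₀ A) :
    groupHomology.inhomogeneousChains.d A (n + 1) (chainContraction A β t x (n + 1) c) +
      chainContraction A β t x n (groupHomology.inhomogeneousChains.d A n c) = c := by
  let D : ∀ m, ((Fin (m + 1) → G) →₀ A) →ₗ[k] ((Fin m → G) →₀ A) :=
    fun m => (groupHomology.inhomogeneousChains.d A m).hom
  suffices h : D (n + 1) ∘ₗ chainContraction A β t x (n + 1) +
      chainContraction A β t x n ∘ₗ D n = LinearMap.id from LinearMap.congr_fun h c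
  refine Finsupp.lhom_ext' fun g => β.ext fun j => ?_
  have hD : ∀ (m : ℕ) (g : Fin (m + 1) → G) (a : A), D m (Finsupp.single g a) =
      Finsupp.single (fun i => g i.succ) (A.ρ (g 0)⁻¹ a) + ∑ j : Fin (m + 1),
        (-1 : k) ^ ((j : ℕ) + 1) • Finsupp.single (Fin.contractNth j (· * ·) g) a :=
    fun m g a => groupHomology.inhomogeneousChains.d_single m g a
  change D (n + 1) (chainContraction A β t x (n + 1) (Finsupp.single g (β j))) +
      chainContraction A β t x n (D n (Finsupp.single g (β j))) = Finsupp.single g (β j)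
  rw [chainContraction_single, hD, hD, Fin.sum_univ_succ]
  simp only [Fin.cons_zero, Fin.cons_succ, inv_inv, htx, contractNth_cons_succ,
    contractNth_cons_zero, hact, map_add, map_sum, chainContraction_smul_single,
    chainContraction_single, ht, hx, mul_inv_rev, Fin.val_zero, Fin.val_succ]
  simp [-Finsupp.smul_single, pow_succ]
  abel

theorem isZero_groupHomology_succ (n : ℕ) : Limits.IsZero (groupHomology A (n + 1)) := by
  refine (HomologicalComplex.exactAt_iff_isZero_homology _ _).1 ?_
  rw [HomologicalComplex.exactAt_iff' _ (n + 2) (n + 1) n (by simp) (by simp),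
    ShortComplex.moduleCat_exact_iff]
  intro c hc
  refine ⟨chainContraction A β t x (n + 1) c, ?_⟩
  have h := d_chainContraction A β act t x hact ht hx htx n c
  have hc' : groupHomology.inhomogeneousChains.d A n c = 0 := by
    rw [← groupHomology.inhomogeneousChains.d_def]
    exact hc
  rw [hc', map_zero, add_zero, ← groupHomology.inhomogeneousChains.d_def] at h
  exact h

end Vanishing

/-! ### Restriction of `ℤΓ`-modules -/

section Restriction

variable {Γ : Type} [Group Γ] (N : Subgroup Γ) {A B C : Type} [AddCommGroup A] [AddCommGroup B]
  [AddCommGroup C] [Module ℤ[Γ] A] [Module ℤ[Γ] B] [Module ℤ[Γ] C]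

variable (A) in
/-- The representation of the subgroup `N` on the `ℤΓ`-module `A`. -/
abbrev resRep : Rep ℤ N :=
  Rep.of ((Representation.ofModule' (k := ℤ) (G := Γ) A).comp N.subtype)

/-- A homomorphism of `ℤΓ`-modules as a morphism of representations of `N`. -/
def resMap (f : A →ₗ[ℤ[Γ]] B) : resRep N A ⟶ resRep N B :=
  Rep.ofHom (LinearMap.intertwiningMap_of_isIntertwiningMap _ _ f.toAddMonoidHom.toIntLinearMap
    fun h a => f.map_smul (MonoidAlgebra.single (h : Γ) (1 : ℤ)) a)

theorem resMap_comp_eq_zero {f : A →ₗ[ℤ[Γ]] B} {g : B →ₗ[ℤ[Γ]] C} (h : Function.Exact f g) :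
    resMap N f ≫ resMap N g = 0 := by
  ext a
  exact h.apply_apply_eq_zero a

theorem rep_shortExact {k G : Type} [CommRing k] [Group G] (X : ShortComplex (Rep.{0} k G))
    (hf : Function.Injective X.f.hom) (hg : Function.Surjective X.g.hom)
    (h : Function.Exact X.f.hom X.g.hom) : X.ShortExact where
  exact := by
    rw [← ShortComplex.exact_map_iff_of_faithful _ (forget₂ (Rep.{0} k G) (ModuleCat.{0} k)),
      ShortComplex.moduleCat_exact_iff]
    exact fun b hb => (h b).1 hb
  mono_f := (Rep.mono_iff_injective _).2 hf
  epi_g := (Rep.epi_iff_surjective _).2 hg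

theorem resMap_shortExact {f : A →ₗ[ℤ[Γ]] B} {g : B →ₗ[ℤ[Γ]] C} (hf : Function.Injective f)
    (hg : Function.Surjective g) (h : Function.Exact f g) :
    (ShortComplex.mk (resMap N f) (resMap N g) (resMap_comp_eq_zero N h)).ShortExact :=
  rep_shortExact _ hf hg h

/-- The elements γ b_i form a ℤ-basis on which N acts freely by left translation. The orbits are the
cosets of N; with a representative s(γ), the translating element γ s(γ)⁻¹ lies in N. -/
theorem isZero_groupHomology_resRep [N.Normal] {ι : Type*} (b : Module.Basis ι ℤ[Γ] A) (n : ℕ) :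
    Limits.IsZero (groupHomology (resRep N A) (n + 1)) := by
  let s : Γ → Γ := fun γ => Quotient.out (γ : Γ ⧸ N)
  have hs : ∀ γ, ((s γ : Γ) : Γ ⧸ N) = γ := fun γ => Quotient.out_eq' _
  have hsN : ∀ γ, γ * (s γ)⁻¹ ∈ N := fun γ => by
    rw [← QuotientGroup.eq_one_iff, QuotientGroup.mk_mul, QuotientGroup.mk_inv, hs,
      mul_inv_cancel]
  have hsmul : ∀ (h : N) (γ : Γ), s (h * γ) = s γ := fun h γ => by
    change Quotient.out ((h * γ : Γ) : Γ ⧸ N) = _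
    rw [QuotientGroup.mk_mul, (QuotientGroup.eq_one_iff (h : Γ)).2 h.2, one_mul]
  let β : Module.Basis (Γ × ι) ℤ A := (MonoidAlgebra.basis Γ ℤ).smulTower b
  have hβ : ∀ γ i, β (γ, i) = (MonoidAlgebra.single γ (1 : ℤ) : ℤ[Γ]) • b i := fun γ i => by
    rw [Module.Basis.smulTower_apply]
    rfl
  have key : ∀ (h γ : Γ) (i : ι), (MonoidAlgebra.single h (1 : ℤ) : ℤ[Γ]) • β (γ, i) =
      β (h * γ, i) := fun h γ i => by
    rw [hβ, hβ, smul_smul, MonoidAlgebra.single_mul_single, one_mul]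
  refine isZero_groupHomology_succ (resRep N A) β (fun h j => (h * j.1, j.2))
    (fun j => ⟨j.1 * (s j.1)⁻¹, hsN _⟩) (fun j => (s j.1, j.2)) ?_ ?_ ?_ ?_ n
  · rintro h ⟨γ, i⟩
    exact key _ _ _
  · rintro h ⟨γ, i⟩
    exact Subtype.ext (by simp [hsmul, mul_assoc])
  · rintro h ⟨γ, i⟩
    exact Prod.ext (hsmul _ _) rfl
  · rintro ⟨γ, i⟩
    exact (key _ _ _).trans (congrArg β (Prod.ext (inv_mul_cancel_right γ (s γ)) rfl))

/-- The subgroup of `A` generated by the elements `h a - a` with `h ∈ N`. -/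
def augSub (N : Subgroup Γ) (A : Type) [AddCommGroup A] [Module ℤ[Γ] A] : AddSubgroup A :=
  AddSubgroup.closure {x | ∃ h ∈ N, ∃ a : A, x = (MonoidAlgebra.single h (1 : ℤ) : ℤ[Γ]) • a - a}

theorem coinvariantsKer_resRep :
    (Representation.Coinvariants.ker (resRep N A).ρ).toAddSubgroup = augSub N A := by
  refine le_antisymm (fun x hx => ?_) ((AddSubgroup.closure_le _).2 ?_)
  · refine Submodule.span_induction (p := fun x _ => x ∈ augSub N A) ?_ (zero_mem _)
      (fun _ _ _ _ => add_mem) (fun c _ _ h => zsmul_mem h c) hx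
    rintro _ ⟨⟨h, a⟩, rfl⟩
    exact AddSubgroup.subset_closure ⟨h, h.2, a, rfl⟩
  · rintro _ ⟨h, hh, a, rfl⟩
    exact Representation.Coinvariants.sub_mem_ker (ρ := (resRep N A).ρ) ⟨h, hh⟩ a

theorem map_augSub_of_surjective {f : A →ₗ[ℤ[Γ]] B} (hf : Function.Surjective f) :
    (augSub N A).map f.toAddMonoidHom = augSub N B := by
  rw [augSub, augSub, AddMonoidHom.map_closure]
  congr 1
  ext x
  constructor
  · rintro ⟨_, ⟨h, hh, a, rfl⟩, rfl⟩
    exact ⟨h, hh, f a, by simp⟩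
  · rintro ⟨h, hh, b, rfl⟩
    obtain ⟨a, rfl⟩ := hf b
    exact ⟨_, ⟨h, hh, a, rfl⟩, by simp⟩

theorem map_mem_augSub (f : A →ₗ[ℤ[Γ]] B) {a : A} (ha : a ∈ augSub N A) : f a ∈ augSub N B := by
  induction ha using AddSubgroup.closure_induction with
  | mem a ha =>
    obtain ⟨h, hh, a, rfl⟩ := ha
    exact AddSubgroup.subset_closure ⟨h, hh, f a, by simp⟩
  | zero => rw [map_zero]; exact zero_mem _
  | add a b _ _ ha hb => rw [map_add]; exact add_mem ha hb
  | neg a _ ha => rw [map_neg]; exact neg_mem ha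

/-! ### Low degrees -/

/-- Z is the kernel of the map induced by f between the quotients by ker p and ker q, that is, the
image under p of f⁻¹(ker q). No finiteness is needed: infinite cardinalities and infinite indices
are both 0, and this convention persists until the indices are shown to be nonzero. -/
theorem card_eq_relIndex {X Y X' Y' Z : Type*} [AddCommGroup X] [AddCommGroup Y] [AddCommGroup X']
    [AddCommGroup Y'] [AddCommGroup Z] (f : X →+ Y) (p : X →+ X') (hp : Function.Surjective p)
    (q : Y →+ Y') (m : X' →+ Y') (hm : ∀ x, m (p x) = q (f x)) (δ : Z →+ X')
    (hδ : Function.Injective δ) (h : Function.Exact δ m) :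
    Nat.card Z = p.ker.relIndex (q.ker.comap f) := by
  rw [AddSubgroup.relIndex_ker]
  refine Nat.card_congr ((AddMonoidHom.ofInjective hδ).toEquiv.trans (Equiv.setCongr ?_))
  ext y
  constructor
  · rintro ⟨z, rfl⟩
    obtain ⟨x, hx⟩ := hp (δ z)
    refine ⟨x, ?_, hx⟩
    change q (f x) = 0
    rw [← hm, hx, h.apply_apply_eq_zero]
  · rintro ⟨x, hx, rfl⟩
    exact (h _).1 ((hm x).trans hx)

theorem H0π_surjective {k G : Type} [CommRing k] [Group G] (X : Rep.{0} k G) :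
    Function.Surjective (groupHomology.H0π X) :=
  (ModuleCat.epi_iff_surjective _).1 inferInstance

theorem ker_H0π {k G : Type} [CommRing k] [Group G] (X : Rep.{0} k G) :
    (groupHomology.H0π X).hom.toAddMonoidHom.ker =
      (Representation.Coinvariants.ker X.ρ).toAddSubgroup := by
  ext a
  change groupHomology.H0π X a = 0 ↔ a ∈ Representation.Coinvariants.ker X.ρ
  rw [← Representation.Coinvariants.mk_eq_zero]
  have h : (groupHomology.H0Iso X).hom (groupHomology.H0π X a) =
      Representation.Coinvariants.mk X.ρ a :=
    ConcreteCategory.congr_hom (groupHomology.H0π_comp_H0Iso_hom X) a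
  rw [← h]
  exact (map_eq_zero_iff (groupHomology.H0Iso X).toLinearEquiv (LinearEquiv.injective _)).symm

theorem card_groupHomology_zero {k G : Type} [CommRing k] [Group G] (X : Rep.{0} k G) :
    Nat.card (groupHomology X 0) = (Representation.Coinvariants.ker X.ρ).toAddSubgroup.index := by
  rw [← ker_H0π, AddSubgroup.index_ker]
  exact (Nat.card_congr (Equiv.subtypeUnivEquiv (H0π_surjective _))).symm

theorem card_H_zero : Nat.card (H A N 0) = (augSub N A).index := by
  rw [← coinvariantsKer_resRep]
  exact card_groupHomology_zero (resRep N A)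

/-- Dimension shifting: the middle term has no homology in positive degrees, so the connecting map
is an isomorphism. -/
theorem card_H_succ_succ {f : A →ₗ[ℤ[Γ]] B} {g : B →ₗ[ℤ[Γ]] C} (hf : Function.Injective f)
    (hg : Function.Surjective g) (h : Function.Exact f g) [N.Normal] {ι : Type*}
    (b : Module.Basis ι ℤ[Γ] B) (n : ℕ) :
    Nat.card (H C N (n + 2)) = Nat.card (H A N (n + 1)) := by
  have := groupHomology.isIso_δ_of_isZero (resMap_shortExact N hf hg h) (n + 1)
    (isZero_groupHomology_resRep N b (n + 1)) (isZero_groupHomology_resRep N b n)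
  exact Nat.card_congr (asIso (groupHomology.δ (resMap_shortExact N hf hg h) (n + 1 + 1)
    (n + 1) rfl)).toLinearEquiv.toEquiv

/-- In low degrees the connecting map identifies H₁ of the quotient only with the kernel of H₀(X₁) →
H₀(X₂). -/
theorem card_groupHomology_one {k G : Type} [CommRing k] [Group G] {X : ShortComplex (Rep.{0} k G)}
    (hX : X.ShortExact) (h : Limits.IsZero (groupHomology X.X₂ 1)) :
    Nat.card (groupHomology X.X₃ 1) =
      (Representation.Coinvariants.ker X.X₁.ρ).toAddSubgroup.relIndex
        ((Representation.Coinvariants.ker X.X₂.ρ).toAddSubgroup.comap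
          X.f.hom.toLinearMap.toAddMonoidHom) := by
  have hmono := groupHomology.mono_δ_of_isZero hX 0 h
  have hex := (ShortComplex.ShortExact.moduleCat_exact_iff_function_exact _).1
    (groupHomology.mapShortComplex₁_exact hX (zero_add 1))
  rw [← ker_H0π, ← ker_H0π]
  exact card_eq_relIndex _ _ (H0π_surjective X.X₁) _
    (groupHomology.map (MonoidHom.id G) X.f 0).hom.toAddMonoidHom
    (fun a => groupHomology.H0π_comp_map_apply (MonoidHom.id G) X.f a)
    (groupHomology.δ hX 1 0 rfl).hom.toAddMonoidHom
    ((ModuleCat.mono_iff_injective _).1 hmono) hex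

theorem card_H_one {f : A →ₗ[ℤ[Γ]] B} {g : B →ₗ[ℤ[Γ]] C} (hf : Function.Injective f)
    (hg : Function.Surjective g) (h : Function.Exact f g) [N.Normal] {ι : Type*}
    (b : Module.Basis ι ℤ[Γ] B) :
    Nat.card (H C N 1) = (augSub N A).relIndex ((augSub N B).comap f.toAddMonoidHom) := by
  rw [← coinvariantsKer_resRep, ← coinvariantsKer_resRep]
  have hS := resMap_shortExact N hf hg h
  have hB : Limits.IsZero (groupHomology (ShortComplex.mk (resMap N f) (resMap N g)
      (resMap_comp_eq_zero N h)).X₂ 1) := isZero_groupHomology_resRep N b 0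
  have hcard := card_groupHomology_one hS hB
  exact hcard

end Restriction

/-! ### The homology of `N` with coefficients in `M` in terms of a resolution -/

theorem relIndex_map_of_map_eq {A B : Type*} [AddCommGroup A] [AddCommGroup B] (q : A →+ B)
    {H K : AddSubgroup A} {K' : AddSubgroup B} (hK : K.map q = K') :
    (H.map q).relIndex K' = (H ⊔ q.ker).relIndex K := by
  rw [← hK, ← AddSubgroup.relIndex_comap, AddSubgroup.comap_map_eq]

namespace FLResolution

variable {Γ : Type} [Group Γ] {M : Type} [AddCommGroup M] [Module ℤ[Γ] M] (F : FLResolution Γ M)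
  (N : Subgroup Γ)

/-- The elements of `F_ν` which are boundaries modulo the action of `N`. -/
def coinvBoundaries (ν : ℕ) : AddSubgroup (F.F ν) :=
  augSub N (F.F ν) ⊔ (F.bd ν).toAddMonoidHom.range

/-- The elements of `F_ν` which are cycles modulo the action of `N`. -/
def coinvCycles : ∀ ν, AddSubgroup (F.F ν)
  | 0 => ⊤
  | ν + 1 => (augSub N (F.F ν)).comap (F.bd ν).toAddMonoidHom

/-- In 0 → im ∂_ν → F_ν → C → 0 the coinvariants of im ∂_ν are computed by pulling back along
F_{ν+1} → im ∂_ν, whose kernel is the image of the next differential. -/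
theorem card_H_one_of_range [N.Normal] {ν : ℕ} {C : Type} [AddCommGroup C] [Module ℤ[Γ] C]
    (g : F.F ν →ₗ[ℤ[Γ]] C) (hg : Function.Surjective g) (h : Function.Exact (F.bd ν) g) :
    Nat.card (H C N 1) = (F.coinvBoundaries N (ν + 1)).relIndex (F.coinvCycles N (ν + 1)) := by
  have hex : Function.Exact (LinearMap.range (F.bd ν)).subtype g := fun x => by
    rw [h x]
    simp
  rw [card_H_one N (Submodule.injective_subtype _) hg hex
    (Module.Free.chooseBasis ℤ[Γ] (F.F ν)),
    ← map_augSub_of_surjective N (F.bd ν).surjective_rangeRestrict,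
    relIndex_map_of_map_eq (K := F.coinvCycles N (ν + 1))]
  · congr 2
    ext x
    change (F.bd ν).rangeRestrict x = 0 ↔ x ∈ Set.range (F.bd (ν + 1))
    rw [← F.exact_succ ν x, ← Subtype.val_inj]
    rfl
  · ext ⟨y, x, hx⟩
    constructor
    · rintro ⟨z, hz, hzx⟩
      rw [← hzx]
      exact hz
    · intro hy
      refine ⟨x, ?_, Subtype.ext hx⟩
      change F.bd ν x ∈ augSub N (F.F ν)
      rw [hx]
      exact hy

/-- Each shift replaces the syzygy im ∂_ν by im ∂_{ν+1} and lowers the degree by one, until degree 1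
is reached. -/
theorem card_H_range [N.Normal] (n ν : ℕ) :
    Nat.card (H (LinearMap.range (F.bd ν)) N (n + 1)) =
      (F.coinvBoundaries N (ν + 1 + n + 1)).relIndex (F.coinvCycles N (ν + 1 + n + 1)) := by
  have hex : ∀ ν, Function.Exact (F.bd (ν + 1)) (F.bd ν).rangeRestrict := fun ν x => by
    rw [← F.exact_succ ν x, ← Subtype.val_inj]
    rfl
  induction n generalizing ν with
  | zero => exact card_H_one_of_range F N _ (F.bd ν).surjective_rangeRestrict (hex ν)
  | succ n ih =>
    have hex' : Function.Exact (LinearMap.range (F.bd (ν + 1))).subtype (F.bd ν).rangeRestrict :=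
      fun x => by
        rw [hex ν x]
        simp
    rw [card_H_succ_succ N (Submodule.injective_subtype _) (F.bd ν).surjective_rangeRestrict hex'
      (Module.Free.chooseBasis ℤ[Γ] (F.F (ν + 1))) n, ih (ν + 1),
      show ν + 1 + 1 + n = ν + 1 + (n + 1) by omega]

/-- Group homology is the homology of the coinvariants of the resolution, here in the form of
indices of subgroups of F_ν itself. Degrees 0 and 1 are direct, higher ones are shifted down along
the syzygies. -/
theorem card_H [N.Normal] (ν : ℕ) :
    Nat.card (H M N ν) = (F.coinvBoundaries N ν).relIndex (F.coinvCycles N ν) := by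
  match ν with
  | 0 =>
    rw [card_H_zero, ← map_augSub_of_surjective N F.surjective, coinvCycles,
      ← AddSubgroup.relIndex_top_right,
      relIndex_map_of_map_eq (K := (⊤ : AddSubgroup (F.F 0)))]
    · congr 2
      ext x
      exact F.exact_zero x
    · exact AddSubgroup.map_top_of_surjective _ F.surjective
  | 1 => exact card_H_one_of_range F N _ F.surjective F.exact_zero
  | n + 2 =>
    have hex' : Function.Exact (LinearMap.range (F.bd 0)).subtype F.π := fun x => by
      rw [F.exact_zero x]
      simp
    rw [card_H_succ_succ N (Submodule.injective_subtype _) F.surjective hex'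
      (Module.Free.chooseBasis ℤ[Γ] (F.F 0)) n, card_H_range, show 0 + 1 + n + 1 = n + 2 by omega]

end FLResolution

/-! ### Coinvariants of free modules -/

section Coordinates

variable {Γ : Type} [Group Γ] (N : Subgroup Γ) [N.Normal] {ι : Type*} [Fintype ι] {A : Type}
  [AddCommGroup A] [Module ℤ[Γ] A] (b : Module.Basis ι ℤ[Γ] A)

theorem groupRingProj_single (γ : Γ) (c : ℤ) :
    groupRingProj N (MonoidAlgebra.single γ c) = MonoidAlgebra.single (γ : Γ ⧸ N) c :=
  MonoidAlgebra.mapDomain_single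

theorem groupRingProj_surjective : Function.Surjective (groupRingProj N) := by
  intro y
  induction y using MonoidAlgebra.induction_linear with
  | zero => exact ⟨0, map_zero _⟩
  | add x y hx hy =>
    obtain ⟨x, rfl⟩ := hx
    obtain ⟨y, rfl⟩ := hy
    exact ⟨x + y, map_add _ _ _⟩
  | single g c =>
    obtain ⟨γ, rfl⟩ := QuotientGroup.mk_surjective g
    exact ⟨_, groupRingProj_single N γ c⟩

/-- The coordinates of the class of an element of a free module in the coinvariants. -/
def coinvCoords : A →+ (ι → ℤ[Γ ⧸ N]) where
  toFun x i := groupRingProj N (b.repr x i)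
  map_zero' := by ext1 i; simp
  map_add' x y := by ext1 i; simp

theorem coinvCoords_surjective : Function.Surjective (coinvCoords N b) := by
  intro y
  choose z hz using fun i => groupRingProj_surjective N (y i)
  refine ⟨b.equivFun.symm z, funext fun i => ?_⟩
  rw [← hz i]
  exact congrArg (groupRingProj N) (congrFun (b.equivFun.apply_symm_apply z) i)

/-- σ lifts each coset to a chosen representative δ; since γδ⁻¹ ∈ N, the actions of γ and δ agree
modulo `augSub`. -/
theorem exists_smul_sub_mem_augSub :
    ∃ σ : ℤ[Γ ⧸ N] →+ ℤ[Γ], ∀ (r : ℤ[Γ]) (a : A), r • a - σ (groupRingProj N r) • a ∈ augSub N A := by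
  refine ⟨⟨⟨MonoidAlgebra.mapDomain Quotient.out, MonoidAlgebra.mapDomain_zero _⟩,
    MonoidAlgebra.mapDomain_add _⟩, fun r a => ?_⟩
  induction r using MonoidAlgebra.induction_linear with
  | zero => simp
  | add r s hr hs =>
    rw [map_add, map_add, add_smul, add_smul, add_sub_add_comm]
    exact add_mem hr hs
  | single γ c =>
    rw [groupRingProj_single]
    change _ - MonoidAlgebra.mapDomain Quotient.out (MonoidAlgebra.single (γ : Γ ⧸ N) c) • a ∈ _
    rw [MonoidAlgebra.mapDomain_single]
    set δ : Γ := Quotient.out (γ : Γ ⧸ N) with hδ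
    have hδN : γ * δ⁻¹ ∈ N := by
      rw [← QuotientGroup.eq_one_iff, QuotientGroup.mk_mul, QuotientGroup.mk_inv, hδ,
        QuotientGroup.out_eq', mul_inv_cancel]
    refine AddSubgroup.subset_closure ⟨_, hδN, (MonoidAlgebra.single δ c : ℤ[Γ]) • a, ?_⟩
    rw [smul_smul, MonoidAlgebra.single_mul_single, one_mul, inv_mul_cancel_right]

/-- In coordinates, the coinvariants of ℤΓ^k are ℤ[Γ/N]^k. An element whose coordinates die in
ℤ[Γ/N] is, by the lift σ, a sum of elements of `augSub`. -/
theorem coinvCoords_eq_zero_iff (x : A) : coinvCoords N b x = 0 ↔ x ∈ augSub N A := by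
  constructor
  · intro h
    obtain ⟨σ, hσ⟩ := exists_smul_sub_mem_augSub (A := A) N
    rw [← b.sum_repr x]
    refine sum_mem fun i _ => ?_
    have h1 := hσ (b.repr x i) (b i)
    have h2 : groupRingProj N (b.repr x i) = 0 := congrFun h i
    rwa [h2, map_zero, zero_smul, sub_zero] at h1
  · intro h
    induction h using AddSubgroup.closure_induction with
    | mem x hx =>
      obtain ⟨h, hh, a, rfl⟩ := hx
      funext i
      change groupRingProj N (b.repr _ i) = 0
      rw [map_sub, map_smul, Finsupp.sub_apply, Finsupp.smul_apply, map_sub, smul_eq_mul, map_mul,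
        groupRingProj_single, (QuotientGroup.eq_one_iff h).2 hh]
      exact sub_eq_zero.2 (one_mul _)
    | zero => exact map_zero _
    | add x y _ _ hx hy => rw [map_add, hx, hy, add_zero]
    | neg x _ hx => rw [map_neg, hx, neg_zero]

end Coordinates

/-! ### Indices in direct sums -/

/-- The quotient of a direct sum by a componentwise subgroup is the product of the quotients, and
only the first K factors can be nontrivial. -/
theorem relIndex_dfinsupp {X : ℕ → Type*} [∀ k, AddCommGroup (X k)] {K : ℕ}
    (hX : ∀ k, K ≤ k → Subsingleton (X k)) (A B : ∀ k, AddSubgroup (X k))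
    (P Q : AddSubgroup (Π₀ k, X k)) (hP : ∀ x, x ∈ P ↔ ∀ k, x k ∈ A k)
    (hQ : ∀ x, x ∈ Q ↔ ∀ k, x k ∈ B k) :
    P.relIndex Q = ∏ k ∈ Finset.range K, (A k).relIndex (B k) := by
  let f : (Π₀ k, X k) →+ ∀ k : Fin K, X k ⧸ A k :=
    { toFun := fun x k => (x k : X k ⧸ A k)
      map_zero' := rfl
      map_add' := fun _ _ => rfl }
  have hf : f.ker = P := by
    ext x
    rw [hP]
    constructor
    · intro h k
      rcases lt_or_ge k K with hk | hk
      · exact (QuotientAddGroup.eq_zero_iff _).1 (congrFun h ⟨k, hk⟩)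
      · have := hX k hk
        rw [Subsingleton.elim (x k) 0]
        exact zero_mem _
    · exact fun h => funext fun k => (QuotientAddGroup.eq_zero_iff _).2 (h k)
  have hQ' : Q.map f = AddSubgroup.pi Set.univ
      fun k : Fin K => (B k).map (QuotientAddGroup.mk' (A k)) := by
    ext y
    rw [AddSubgroup.mem_pi]
    constructor
    · rintro ⟨x, hx, rfl⟩ k -
      exact ⟨x k, (hQ x).1 hx k, rfl⟩
    · intro h
      choose z hz hzy using fun k : Fin K => h k (Set.mem_univ _)
      refine ⟨DFinsupp.mk (Finset.range K) fun k => z ⟨k, Finset.mem_range.1 k.2⟩,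
        (hQ _).2 fun k => ?_, funext fun k => ?_⟩
      · rw [DFinsupp.mk_apply]
        split_ifs with hk
        · exact hz ⟨k, Finset.mem_range.1 hk⟩
        · exact zero_mem _
      · rw [← hzy k]
        change ((DFinsupp.mk (Finset.range K) _ (k : ℕ) : X k) : X k ⧸ A k) = _
        rw [DFinsupp.mk_apply, dif_pos (Finset.mem_range.2 k.2)]
        rfl
  rw [← hf, AddSubgroup.relIndex_ker, hQ', ← Fin.prod_univ_eq_prod_range (fun k => (A k).relIndex (B k))]
  refine (Nat.card_congr (Equiv.Set.univPi fun k : Fin K =>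
    ((B k).map (QuotientAddGroup.mk' (A k)) : Set (X k ⧸ A k)))).trans ?_
  rw [Nat.card_pi]
  refine Finset.prod_congr rfl fun k _ => ?_
  conv_rhs => rw [← QuotientAddGroup.ker_mk' (A k), AddSubgroup.relIndex_ker]
  rfl

/-! ### Determinants of matrices over group rings -/

section GroupRingMatrices

/-- The homomorphism `K[G]^r → K[G]^s` of right multiplication with a matrix, as a `k`-linear map. -/
def rightMul (k : Type*) [CommRing k] {S : Type*} [Ring S] [Algebra k S] {r : ℕ}
    (a : Matrix (Fin r) (Fin r) S) : Module.End k (Fin r → S) :=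
  (Matrix.toLinearMapRight' a).restrictScalars k

section

variable {k : Type*} [CommRing k] {S : Type*} [Ring S] [Algebra k S] {r : ℕ}

theorem rightMul_mul (a b : Matrix (Fin r) (Fin r) S) :
    rightMul k (a * b) = rightMul k b * rightMul k a :=
  LinearMap.ext fun x => (Matrix.vecMul_vecMul x a b).symm

theorem rightMul_add (a b : Matrix (Fin r) (Fin r) S) :
    rightMul k (a + b) = rightMul k a + rightMul k b :=
  LinearMap.ext fun x => Matrix.vecMul_add a b x

theorem rightMul_one : rightMul k (1 : Matrix (Fin r) (Fin r) S) = 1 :=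
  LinearMap.ext fun x => Matrix.vecMul_one x

theorem rightMul_zero : rightMul k (0 : Matrix (Fin r) (Fin r) S) = 0 :=
  LinearMap.ext fun x => Matrix.vecMul_zero x

theorem rightMul_pow (a : Matrix (Fin r) (Fin r) S) (n : ℕ) :
    rightMul k (a ^ n) = rightMul k a ^ n := by
  induction n with
  | zero => rw [pow_zero, pow_zero, rightMul_one]
  | succ n ih => rw [pow_succ, rightMul_mul, ih, pow_succ']

end

/-- The standard basis of `R[G]^r` over `R`. -/
def groupRingPiBasis (R G : Type*) [CommRing R] (r : ℕ) :
    Module.Basis (Σ _ : Fin r, G) R (Fin r → R[G]) :=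
  Pi.basis fun _ => MonoidAlgebra.basis G R

theorem groupRingPiBasis_apply (R G : Type*) [CommRing R] (r : ℕ) (i : Fin r) (g : G) :
    groupRingPiBasis R G r ⟨i, g⟩ = Pi.single i (MonoidAlgebra.single g 1) := by
  rw [groupRingPiBasis, Pi.basis_apply]
  rfl

/-- The lattice ℤ[G]^r in K[G]^r, with matrices acting on rows, is an instance of the linear algebra
of `det_contraction`. Right multiplication reverses products, so `e' * e` stands for δ δ'. -/
theorem det_rightMul_contraction {K : Type*} [Field K] [CharZero K] {G : Type*} [Group G] [Finite G]
    {r : ℕ} (m m' : Matrix (Fin r) (Fin r) ℤ[G]) (e e' : Matrix (Fin r) (Fin r) K[G])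
    (hm : m * m' = 0) (hm' : m' * m = 0)
    (h1 : e * m'.map (MonoidAlgebra.mapRingHom G (Int.castRingHom K)) +
      m.map (MonoidAlgebra.mapRingHom G (Int.castRingHom K)) * e' = 1)
    (h2 : e' * m.map (MonoidAlgebra.mapRingHom G (Int.castRingHom K)) +
      m'.map (MonoidAlgebra.mapRingHom G (Int.castRingHom K)) * e = 1)
    (hnil : IsNilpotent (e' * e)) :
    (LinearMap.range (rightMul ℤ m)).toAddSubgroup.relIndex
      (LinearMap.ker (rightMul ℤ m')).toAddSubgroup ≠ 0 ∧
    (LinearMap.range (rightMul ℤ m')).toAddSubgroup.relIndex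
      (LinearMap.ker (rightMul ℤ m)).toAddSubgroup ≠ 0 ∧
    (LinearMap.det (rightMul K (m.map (MonoidAlgebra.mapRingHom G (Int.castRingHom K)) + e)) *
        (LinearMap.range (rightMul ℤ m')).toAddSubgroup.relIndex
          (LinearMap.ker (rightMul ℤ m)).toAddSubgroup =
      (LinearMap.range (rightMul ℤ m)).toAddSubgroup.relIndex
        (LinearMap.ker (rightMul ℤ m')).toAddSubgroup ∨
     LinearMap.det (rightMul K (m.map (MonoidAlgebra.mapRingHom G (Int.castRingHom K)) + e)) *
        (LinearMap.range (rightMul ℤ m')).toAddSubgroup.relIndex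
          (LinearMap.ker (rightMul ℤ m)).toAddSubgroup =
      -(LinearMap.range (rightMul ℤ m)).toAddSubgroup.relIndex
        (LinearMap.ker (rightMul ℤ m')).toAddSubgroup) := by
  classical
  have := Fintype.ofFinite G
  let φ : ℤ[G] →+* K[G] := MonoidAlgebra.mapRingHom G (Int.castRingHom K)
  let j : (Fin r → ℤ[G]) →ₗ[ℤ] (Fin r → K[G]) :=
    LinearMap.compLeft φ.toAddMonoidHom.toIntLinearMap (Fin r)
  have hjm : ∀ (a : Matrix (Fin r) (Fin r) ℤ[G]) x,
      rightMul K (a.map φ) (j x) = j (rightMul ℤ a x) := fun a x =>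
    funext fun i => (RingHom.map_vecMul φ a x i).symm
  rw [rightMul_add]
  refine det_contraction (groupRingPiBasis ℤ G r) (groupRingPiBasis K G r) j ?_
    (rightMul ℤ m) (rightMul ℤ m') ?_ ?_ (rightMul K (m.map φ)) (rightMul K (m'.map φ))
    (rightMul K e) (rightMul K e') (hjm m) (hjm m') ?_ ?_ ?_
  · rintro ⟨i, g⟩
    rw [groupRingPiBasis_apply, groupRingPiBasis_apply]
    funext l
    change φ (Pi.single (M := fun _ => ℤ[G]) i (MonoidAlgebra.single g 1) l) = _
    rcases eq_or_ne l i with rfl | hl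
    · rw [Pi.single_eq_same, Pi.single_eq_same]
      simp [φ]
    · rw [Pi.single_eq_of_ne hl, Pi.single_eq_of_ne hl, map_zero]
  · exact (rightMul_mul m m').symm.trans (by rw [hm, rightMul_zero])
  · exact (rightMul_mul m' m).symm.trans (by rw [hm', rightMul_zero])
  · rw [← rightMul_mul, ← rightMul_mul, ← rightMul_add, h1, rightMul_one]
  · rw [← rightMul_mul, ← rightMul_mul, ← rightMul_add, h2, rightMul_one]
  · obtain ⟨n, hn⟩ := hnil
    exact ⟨n, by rw [← rightMul_mul, ← rightMul_pow, hn, rightMul_zero]⟩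

end GroupRingMatrices

/-! ### Differentials on coinvariants as integral matrices -/

section CoinvariantMatrices

variable {Γ : Type} [Group Γ] (N : Subgroup Γ) [N.Normal] {r : ℕ} {A A' A'' : Type}
  [AddCommGroup A] [AddCommGroup A'] [AddCommGroup A''] [Module ℤ[Γ] A] [Module ℤ[Γ] A']
  [Module ℤ[Γ] A''] (b : Module.Basis (Fin r) ℤ[Γ] A) (b' : Module.Basis (Fin r) ℤ[Γ] A')
  (b'' : Module.Basis (Fin r) ℤ[Γ] A'')

theorem coinvCoords_map (f : A →ₗ[ℤ[Γ]] A') (x : A) :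
    coinvCoords N b' (f x) =
      rightMul ℤ ((rowMatrix b b' f).map (groupRingProj N)) (coinvCoords N b x) := by
  funext j
  refine (congrArg (groupRingProj N) (congrFun (repr_apply_eq_vecMul b b' f x) j)).trans ?_
  exact RingHom.map_vecMul (groupRingProj N) _ _ j

/-- The coordinate map onto ℤ[Γ/N]^r is surjective with kernel `augSub`, so an index in ℤ[Γ/N]^r
equals the index of the preimages in A'. -/
theorem relIndex_rightMul (f : A →ₗ[ℤ[Γ]] A') (g : A' →ₗ[ℤ[Γ]] A'') :
    (LinearMap.range (rightMul ℤ ((rowMatrix b b' f).map (groupRingProj N)))).toAddSubgroup.relIndex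
      (LinearMap.ker (rightMul ℤ ((rowMatrix b' b'' g).map (groupRingProj N)))).toAddSubgroup =
    (augSub N A' ⊔ f.toAddMonoidHom.range).relIndex ((augSub N A'').comap g.toAddMonoidHom) := by
  have h1 : (coinvCoords N b').ker = augSub N A' := by
    ext x
    exact coinvCoords_eq_zero_iff N b' x
  have h2 : (LinearMap.range (rightMul ℤ ((rowMatrix b b' f).map
      (groupRingProj N)))).toAddSubgroup = f.toAddMonoidHom.range.map (coinvCoords N b') := by
    ext y
    constructor
    · rintro ⟨x, rfl⟩
      obtain ⟨x, rfl⟩ := coinvCoords_surjective N b x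
      exact ⟨f x, ⟨x, rfl⟩, coinvCoords_map N b b' f x⟩
    · rintro ⟨_, ⟨x, rfl⟩, rfl⟩
      exact ⟨_, (coinvCoords_map N b b' f x).symm⟩
  rw [h2, relIndex_map_of_map_eq (K := (augSub N A'').comap g.toAddMonoidHom), h1, sup_comm]
  ext y
  constructor
  · rintro ⟨x, hx, rfl⟩
    exact (coinvCoords_map N b' b'' g x).symm.trans ((coinvCoords_eq_zero_iff N b'' _).2 hx)
  · intro hy
    obtain ⟨x, rfl⟩ := coinvCoords_surjective N b' y
    exact ⟨x, (coinvCoords_eq_zero_iff N b'' _).1 ((coinvCoords_map N b' b'' g x).trans hy), rfl⟩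

end CoinvariantMatrices

/-! ### Odd and even parts of a resolution -/

section DirectSums

theorem mem_iff_forall_of_single_mem {X : ℕ → Type*} [∀ k, AddCommGroup (X k)]
    {P : AddSubgroup (Π₀ k, X k)} {A : ∀ k, AddSubgroup (X k)} (h1 : ∀ x ∈ P, ∀ k, x k ∈ A k)
    (h2 : ∀ k, ∀ a ∈ A k, DFinsupp.single k a ∈ P) (x : Π₀ k, X k) : x ∈ P ↔ ∀ k, x k ∈ A k := by
  classical
  refine ⟨h1 x, fun h => ?_⟩
  rw [← DFinsupp.sum_single (f := x)]
  exact sum_mem fun k _ => h2 k _ (h k)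

variable {Γ : Type} [Group Γ] (N : Subgroup Γ) {X Y : ℕ → Type} [∀ k, AddCommGroup (X k)]
  [∀ k, Module ℤ[Γ] (X k)] [∀ k, AddCommGroup (Y k)] [∀ k, Module ℤ[Γ] (Y k)]

theorem mem_augSub_dfinsupp_iff (x : Π₀ k, X k) :
    x ∈ augSub N (Π₀ k, X k) ↔ ∀ k, x k ∈ augSub N (X k) :=
  mem_iff_forall_of_single_mem (fun _ hx k => map_mem_augSub N (DFinsupp.lapply k) hx)
    (fun k _ ha => map_mem_augSub N (DFinsupp.lsingle k) ha) x

end DirectSums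

theorem dfinsupp_basis_repr {R : Type*} [Ring R] {X : ℕ → Type*} [∀ k, AddCommGroup (X k)]
    [∀ k, Module R (X k)] {ι : ℕ → Type*} (b : ∀ k, Module.Basis (ι k) R (X k)) (x : Π₀ k, X k)
    (l : ℕ) (j : ι l) : (DFinsupp.basis b).repr x ⟨l, j⟩ = (b l).repr (x l) j := rfl

theorem dfinsupp_basis_apply {R : Type*} [Ring R] {X : ℕ → Type*} [∀ k, AddCommGroup (X k)]
    [∀ k, Module R (X k)] {ι : ℕ → Type*} (b : ∀ k, Module.Basis (ι k) R (X k)) (k : ℕ) (i : ι k) :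
    DFinsupp.basis b ⟨k, i⟩ = DFinsupp.single k (b k i) := by
  classical
  refine (DFinsupp.basis b).ext_elem fun ⟨l, j⟩ => ?_
  rw [Module.Basis.repr_self, dfinsupp_basis_repr]
  rcases eq_or_ne k l with rfl | h
  · rw [DFinsupp.single_eq_same, Module.Basis.repr_self, Finsupp.single_apply,
      Finsupp.single_apply]
    simp
  · rw [dfinsupp_single_of_ne h, map_zero, Finsupp.zero_apply, Finsupp.single_apply, if_neg]
    exact fun h' => h (congrArg Sigma.fst h')

namespace FLResolution

section Coinvariants

variable {Γ : Type} [Group Γ] {M : Type} [AddCommGroup M] [Module ℤ[Γ] M] (F : FLResolution Γ M)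
  (N : Subgroup Γ)

theorem relIndex_even : (augSub N (Π₀ k : ℕ, F.F (2 * k)) ⊔
      (oddD F.bd).toAddMonoidHom.range).relIndex
        ((augSub N (Π₀ k : ℕ, F.F (2 * k + 1))).comap (evenD F.bd).toAddMonoidHom) =
    ∏ k ∈ Finset.range (F.d + 1),
      (F.coinvBoundaries N (2 * k)).relIndex (F.coinvCycles N (2 * k)) := by
  refine relIndex_dfinsupp (fun k hk => F.subsingleton _ (by omega)) _ _ _ _
    (mem_iff_forall_of_single_mem (fun x hx k => ?_) fun k a ha => ?_) fun x => ?_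
  · obtain ⟨y, hy, _, ⟨z, rfl⟩, rfl⟩ := AddSubgroup.mem_sup.1 hx
    refine AddSubgroup.add_mem_sup ((mem_augSub_dfinsupp_iff N y).1 hy k) ⟨z k, ?_⟩
    exact (oddD_apply F.bd z k).symm
  · obtain ⟨y, hy, _, ⟨z, rfl⟩, rfl⟩ := AddSubgroup.mem_sup.1 ha
    rw [DFinsupp.single_add]
    refine AddSubgroup.add_mem_sup (map_mem_augSub N
      (DFinsupp.lsingle (R := ℤ[Γ]) (M := fun k => F.F (2 * k)) k) hy) ⟨DFinsupp.single k z, ?_⟩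
    simp [oddD]
  · refine (mem_augSub_dfinsupp_iff N _).trans ⟨fun h k => ?_, fun h k => ?_⟩
    · cases k with
      | zero => exact AddSubgroup.mem_top _
      | succ k =>
        have h1 := h k
        rwa [LinearMap.toAddMonoidHom_coe, evenD_apply] at h1
    · rw [LinearMap.toAddMonoidHom_coe, evenD_apply]
      exact h (k + 1)

theorem relIndex_odd : (augSub N (Π₀ k : ℕ, F.F (2 * k + 1)) ⊔
      (evenD F.bd).toAddMonoidHom.range).relIndex
        ((augSub N (Π₀ k : ℕ, F.F (2 * k))).comap (oddD F.bd).toAddMonoidHom) =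
    ∏ k ∈ Finset.range (F.d + 1),
      (F.coinvBoundaries N (2 * k + 1)).relIndex (F.coinvCycles N (2 * k + 1)) := by
  refine relIndex_dfinsupp (fun k hk => F.subsingleton _ (by omega)) _ _ _ _
    (mem_iff_forall_of_single_mem (fun x hx k => ?_) fun k a ha => ?_) fun x => ?_
  · obtain ⟨y, hy, _, ⟨z, rfl⟩, rfl⟩ := AddSubgroup.mem_sup.1 hx
    refine AddSubgroup.add_mem_sup ((mem_augSub_dfinsupp_iff N y).1 hy k) ⟨z (k + 1), ?_⟩
    exact (evenD_apply F.bd z k).symm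
  · obtain ⟨y, hy, _, ⟨z, rfl⟩, rfl⟩ := AddSubgroup.mem_sup.1 ha
    rw [DFinsupp.single_add]
    refine AddSubgroup.add_mem_sup (map_mem_augSub N
      (DFinsupp.lsingle (R := ℤ[Γ]) (M := fun k => F.F (2 * k + 1)) k) hy)
      ⟨DFinsupp.single (k + 1) z, ?_⟩
    simp [evenD]
  · refine (mem_augSub_dfinsupp_iff N _).trans (forall_congr' fun k => ?_)
    rw [LinearMap.toAddMonoidHom_coe, oddD_apply]
    rfl

variable [N.Normal]

theorem card_H_eq_one {ν : ℕ} (hν : F.d < ν) : Nat.card (H M N ν) = 1 := by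
  have := F.subsingleton ν hν
  rw [F.card_H N ν, show F.coinvBoundaries N ν = F.coinvCycles N ν from
    AddSubgroup.ext fun x => by simp [Subsingleton.elim x 0, zero_mem]]
  exact AddSubgroup.relIndex_self _

/-- Even degrees contribute to the numerator and odd ones to the denominator. The range d + 1 is
generous: every degree from 2(d + 1) on lies beyond the resolution and contributes 1. -/
theorem eulerChar_eq : eulerChar M N =
    (∏ k ∈ Finset.range (F.d + 1), (Nat.card (H M N (2 * k)) : ℚ)) /
      ∏ k ∈ Finset.range (F.d + 1), (Nat.card (H M N (2 * k + 1)) : ℚ) := by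
  have hprod : ∀ K, ∏ i ∈ Finset.range (2 * K), (Nat.card (H M N i) : ℚ) ^ ((-1 : ℤ) ^ i) =
      (∏ k ∈ Finset.range K, (Nat.card (H M N (2 * k)) : ℚ)) /
        ∏ k ∈ Finset.range K, (Nat.card (H M N (2 * k + 1)) : ℚ) := by
    intro K
    induction K with
    | zero => simp
    | succ K ih =>
      rw [show 2 * (K + 1) = 2 * K + 1 + 1 by ring, Finset.prod_range_succ, Finset.prod_range_succ,
        ih, Finset.prod_range_succ, Finset.prod_range_succ, (even_two_mul K).neg_one_pow,
        (odd_two_mul_add_one K).neg_one_pow, zpow_one, zpow_neg_one, mul_div_mul_comm, mul_assoc,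
        div_eq_mul_inv (Nat.card (H M N (2 * K)) : ℚ)]
  rw [← hprod, eulerChar]
  refine finprod_eq_prod_of_mulSupport_subset _ fun i hi => ?_
  by_contra h
  rw [Finset.mem_coe, Finset.mem_range] at h
  refine hi ?_
  change (Nat.card (H M N i) : ℚ) ^ ((-1 : ℤ) ^ i) = 1
  rw [F.card_H_eq_one N (by omega), Nat.cast_one, one_zpow]

/-- An infinite homology group would have `Nat.card` equal to 0, so nonvanishing of the two products
already encodes finiteness. -/
theorem isEulerDefined
    (h0 : ∏ k ∈ Finset.range (F.d + 1), Nat.card (H M N (2 * k)) ≠ 0)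
    (h1 : ∏ k ∈ Finset.range (F.d + 1), Nat.card (H M N (2 * k + 1)) ≠ 0) :
    IsEulerDefined M N := by
  rw [Finset.prod_ne_zero_iff] at h0 h1
  refine ⟨fun i => Nat.finite_of_card_ne_zero ?_, ?_⟩
  · rcases lt_or_ge F.d i with hi | hi
    · rw [F.card_H_eq_one N hi]
      exact one_ne_zero
    · obtain ⟨k, rfl | rfl⟩ := Nat.even_or_odd' i
      · exact h0 k (Finset.mem_range.2 (by omega))
      · exact h1 k (Finset.mem_range.2 (by omega))
  · filter_upwards [eventually_gt_atTop F.d] with i hi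
    exact (Nat.card_eq_one_iff_unique.1 (F.card_H_eq_one N hi)).1

end Coinvariants

/-! ### The torsion in the quotients `ℚ_p[Γ/N]` -/

section Quotient

variable {p : ℕ} [hp : Fact p.Prime] {Γ : Type} [Group Γ] {M : Type} [AddCommGroup M]
  [Module ℤ[Γ] M] {F : FLResolution Γ M} {n : ℕ → ℕ}
  (b : ∀ ν, Module.Basis (Fin (n ν)) ℤ[Γ] (F.F ν))

theorem basisOdd_apply (x : Σ k : ℕ, Fin (n (2 * k + 1))) (l : ℕ) :
    basisOdd p b x l = BaseChange.tmul _ 1 (DFinsupp.basis (fun k => b (2 * k + 1)) x l) := by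
  obtain ⟨k, i⟩ := x
  rw [basisOdd, dfinsupp_basis_apply, dfinsupp_basis_apply]
  rcases eq_or_ne k l with rfl | h
  · rw [DFinsupp.single_eq_same, DFinsupp.single_eq_same, BaseChange.basis_apply]
  · rw [dfinsupp_single_of_ne h, dfinsupp_single_of_ne h, BaseChange.tmul_zero]

theorem basisEven_apply (x : Σ k : ℕ, Fin (n (2 * k))) (l : ℕ) :
    basisEven p b x l = BaseChange.tmul _ 1 (DFinsupp.basis (fun k => b (2 * k)) x l) := by
  obtain ⟨k, i⟩ := x
  rw [basisEven, dfinsupp_basis_apply, dfinsupp_basis_apply]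
  rcases eq_or_ne k l with rfl | h
  · rw [DFinsupp.single_eq_same, DFinsupp.single_eq_same, BaseChange.basis_apply]
  · rw [dfinsupp_single_of_ne h, dfinsupp_single_of_ne h, BaseChange.tmul_zero]

variable {r : ℕ} (eOdd : (Σ k : ℕ, Fin (n (2 * k + 1))) ≃ Fin r)
  (eEven : (Σ k : ℕ, Fin (n (2 * k))) ≃ Fin r)

theorem rowMatrix_oddD : rowMatrix ((basisOdd p b).reindex eOdd) ((basisEven p b).reindex eEven)
      (oddD (F.bdC p)) =
    (rowMatrix ((DFinsupp.basis fun k => b (2 * k + 1)).reindex eOdd)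
      ((DFinsupp.basis fun k => b (2 * k)).reindex eEven) (oddD F.bd)).map (groupRingToC0 p Γ) := by
  ext i j
  obtain ⟨⟨l, j⟩, rfl⟩ := eEven.surjective j
  rw [Matrix.map_apply, rowMatrix, rowMatrix, Module.Basis.repr_reindex_apply,
    Module.Basis.repr_reindex_apply, Module.Basis.reindex_apply, Module.Basis.reindex_apply,
    Equiv.symm_apply_apply, basisEven, dfinsupp_basis_repr, dfinsupp_basis_repr, oddD_apply,
    oddD_apply, basisOdd_apply, bdC_tmul, basis_repr_tmul, one_mul]

theorem rowMatrix_evenD : rowMatrix ((basisEven p b).reindex eEven) ((basisOdd p b).reindex eOdd)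
      (evenD (F.bdC p)) =
    (rowMatrix ((DFinsupp.basis fun k => b (2 * k)).reindex eEven)
      ((DFinsupp.basis fun k => b (2 * k + 1)).reindex eOdd) (evenD F.bd)).map
        (groupRingToC0 p Γ) := by
  ext i j
  obtain ⟨⟨l, j⟩, rfl⟩ := eOdd.surjective j
  rw [Matrix.map_apply, rowMatrix, rowMatrix, Module.Basis.repr_reindex_apply,
    Module.Basis.repr_reindex_apply, Module.Basis.reindex_apply, Module.Basis.reindex_apply,
    Equiv.symm_apply_apply, basisOdd, dfinsupp_basis_repr, dfinsupp_basis_repr, evenD_apply,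
    evenD_apply, basisEven_apply, bdC_tmul, basis_repr_tmul, one_mul]

theorem bd_comp (ν : ℕ) : F.bd ν ∘ₗ F.bd (ν + 1) = 0 :=
  LinearMap.ext fun x => (F.exact_succ ν).apply_apply_eq_zero x

theorem map_toQuotientHom_groupRingToC0 (N : FiniteIndexNormalSubgroup Γ)
    (m : Matrix (Fin r) (Fin r) ℤ[Γ]) :
    (m.map (groupRingToC0 p Γ)).map (toQuotientHom N) =
      (m.map (groupRingProj N.toSubgroup)).map
        (MonoidAlgebra.mapRingHom _ (Int.castRingHom ℚ_[p])) :=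
  Matrix.ext fun _ _ => toQuotientHom_groupRingToC0 N _

/-- The determinant of a matrix of the torsion over `ℚ_p[Γ/N]` is the multiplicative Euler
characteristic of `N` up to sign. -/
theorem quotientDet_eq_eulerChar (N : FiniteIndexNormalSubgroup Γ)
    {δ : ∀ ν, F.C p ν →ₗ[C0 p Γ] F.C p (ν + 1)} (hδ : IsContraction δ)
    {a : Matrix (Fin r) (Fin r) (C0 p Γ)} (ha : ∀ i j, a i j =
      (basisEven p b).repr (oddMap δ (basisOdd p b (eOdd.symm i))) (eEven.symm j)) :
    IsEulerDefined M N.toSubgroup ∧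
      (quotientDet N a = (eulerChar M N.toSubgroup : ℚ_[p]) ∨
        quotientDet N a = -(eulerChar M N.toSubgroup : ℚ_[p])) := by
  let b₁ := (DFinsupp.basis fun k => b (2 * k + 1)).reindex eOdd
  let b₀ := (DFinsupp.basis fun k => b (2 * k)).reindex eEven
  let B₁ := (basisOdd p b).reindex eOdd
  let B₀ := (basisEven p b).reindex eEven
  let q := toQuotientHom (p := p) N
  let m := (rowMatrix b₁ b₀ (oddD F.bd)).map (groupRingProj N.toSubgroup)
  let m' := (rowMatrix b₀ b₁ (evenD F.bd)).map (groupRingProj N.toSubgroup)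
  -- Unlike the differentials `m` and `m'`, which are integral, the contraction lives only over
  -- ℚ_p[Γ/N].
  let e := (rowMatrix B₁ B₀ (oddδ δ)).map q
  let e' := (rowMatrix B₀ B₁ (evenδ δ)).map q
  have hmq : m.map (MonoidAlgebra.mapRingHom _ (Int.castRingHom ℚ_[p])) =
      (rowMatrix B₁ B₀ (oddD (F.bdC p))).map q := by
    rw [rowMatrix_oddD, map_toQuotientHom_groupRingToC0]
  have hmq' : m'.map (MonoidAlgebra.mapRingHom _ (Int.castRingHom ℚ_[p])) =
      (rowMatrix B₀ B₁ (evenD (F.bdC p))).map q := by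
    rw [rowMatrix_evenD, map_toQuotientHom_groupRingToC0]
  have hpow : ∀ (f : Module.End (C0 p Γ) (F.CEven p)) (k : ℕ),
      rowMatrix B₀ B₀ (f ^ k) = rowMatrix B₀ B₀ f ^ k := by
    intro f k
    induction k with
    | zero => rw [pow_zero, pow_zero]; exact rowMatrix_id B₀
    | succ k ih =>
      rw [pow_succ', pow_succ, ← ih]
      exact rowMatrix_comp B₀ B₀ B₀ (f ^ k) f
  have haq : quotientDet N a =
      LinearMap.det (rightMul ℚ_[p] (m.map (MonoidAlgebra.mapRingHom _ (Int.castRingHom ℚ_[p])) + e)) := by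
    have : a = rowMatrix B₁ B₀ (oddD (F.bdC p)) + rowMatrix B₁ B₀ (oddδ δ) := by
      rw [← rowMatrix_add, ← oddMap_eq]
      ext i j
      rw [ha, rowMatrix, Module.Basis.repr_reindex_apply, Module.Basis.reindex_apply]
    rw [hmq, ← Matrix.map_add _ (map_add q), ← this]
    rfl
  have hmm : m * m' = 0 := by
    rw [← Matrix.map_mul, ← rowMatrix_comp, evenD_comp_oddD F.bd_comp, rowMatrix_zero,
      Matrix.map_zero _ (map_zero _)]
  have hmm' : m' * m = 0 := by
    rw [← Matrix.map_mul, ← rowMatrix_comp, oddD_comp_evenD F.bd_comp, rowMatrix_zero,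
      Matrix.map_zero _ (map_zero _)]
  have h1 : e * m'.map (MonoidAlgebra.mapRingHom _ (Int.castRingHom ℚ_[p])) +
      m.map (MonoidAlgebra.mapRingHom _ (Int.castRingHom ℚ_[p])) * e' = 1 := by
    rw [hmq, hmq', ← Matrix.map_mul, ← Matrix.map_mul, ← Matrix.map_add _ (map_add q),
      ← rowMatrix_comp, ← rowMatrix_comp, ← rowMatrix_add, contraction_odd hδ.2, rowMatrix_id,
      Matrix.map_one _ (map_zero q) (map_one q)]
  have h2 : e' * m.map (MonoidAlgebra.mapRingHom _ (Int.castRingHom ℚ_[p])) +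
      m'.map (MonoidAlgebra.mapRingHom _ (Int.castRingHom ℚ_[p])) * e = 1 := by
    rw [hmq, hmq', ← Matrix.map_mul, ← Matrix.map_mul, ← Matrix.map_add _ (map_add q),
      ← rowMatrix_comp, ← rowMatrix_comp, ← rowMatrix_add, contraction_even hδ.1 hδ.2, rowMatrix_id,
      Matrix.map_one _ (map_zero q) (map_one q)]
  have hnil : IsNilpotent (e' * e) := by
    obtain ⟨k, hk⟩ := isNilpotent_oddδ_evenδ (δ := δ) F.subsingleton_C
    refine ⟨k, ?_⟩
    rw [← Matrix.map_mul, ← rowMatrix_comp, ← RingHom.mapMatrix_apply, ← map_pow, ← hpow, hk,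
      rowMatrix_zero, map_zero]
  -- The first index, of the image of the odd differential, collects the homology in even degrees
  -- and the second that in odd degrees; their quotient is the Euler characteristic.
  obtain ⟨h0, h1, hdet⟩ := det_rightMul_contraction m m' e e' hmm hmm' h1 h2 hnil
  rw [relIndex_rightMul N.toSubgroup b₁ b₀ b₁, relIndex_even] at h0 hdet
  rw [relIndex_rightMul N.toSubgroup b₀ b₁ b₀, relIndex_odd] at h1 hdet
  simp only [← F.card_H] at h0 h1 hdet
  refine ⟨F.isEulerDefined N.toSubgroup h0 h1, ?_⟩
  have h1' : ((∏ k ∈ Finset.range (F.d + 1), Nat.card (H M N.toSubgroup (2 * k + 1)) : ℕ) :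
    ℚ_[p]) ≠ 0 := Nat.cast_ne_zero.2 h1
  have hχ : (eulerChar M N.toSubgroup : ℚ_[p]) =
      ((∏ k ∈ Finset.range (F.d + 1), Nat.card (H M N.toSubgroup (2 * k)) : ℕ) : ℚ_[p]) /
        ((∏ k ∈ Finset.range (F.d + 1), Nat.card (H M N.toSubgroup (2 * k + 1)) : ℕ) : ℚ_[p]) := by
    rw [F.eulerChar_eq N.toSubgroup]
    push_cast
    rfl
  rw [haq, hχ, ← neg_div, eq_div_iff h1', eq_div_iff h1']
  exact hdet

end Quotient

end FLResolution

/-! ### Torsion as a limit of Euler characteristics -/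

/-- The limit formula for L is applied to a matrix representing t. Its determinants over ℚ_p[Γ/Γ_n]
are Euler characteristics up to a sign that the logarithm does not see. -/
theorem FLResolution.IsTorsion.tendsto_eulerChar {p : ℕ} [Fact p.Prime] {Γ : Type} [Group Γ]
    {L : KT p Γ →* Multiplicative ℚ_[p]} (hL : IsReasonableLogDet L) {M : Type} [AddCommGroup M]
    [Module ℤ[Γ] M] {F : FLResolution Γ M} {n : ℕ → ℕ}
    {b : ∀ ν, Module.Basis (Fin (n ν)) ℤ[Γ] (F.F ν)} {t : KT p Γ} (ht : IsTorsion p b t)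
    {N : ℕ → FiniteIndexNormalSubgroup Γ} (hN : TendsToUnit N) :
    (∀ n, IsEulerDefined M (N n).toSubgroup) ∧
      Tendsto (fun n => ((N n).toSubgroup.index : ℚ_[p])⁻¹ *
        padicLog p (eulerChar M (N n).toSubgroup : ℚ_[p])) atTop (𝓝 (L t).toAdd) := by
  obtain ⟨δ, r, eOdd, eEven, a, hδ, ha, rfl⟩ := ht
  have key := fun k => quotientDet_eq_eulerChar b eOdd eEven (N k) hδ ha
  refine ⟨fun k => (key k).1, (hL.limit r a N hN).congr fun k => ?_⟩
  rcases (key k).2 with h | h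
  · rw [h]
  · rw [h, padicLog_neg]

end PadicTorsion

end

theorem theorem4p3 (p : ℕ) [Fact p.Prime] (Γ : Type) [Group Γ] [Countable Γ]
    [Group.ResiduallyFinite Γ]
    (L : PadicTorsion.KT p Γ →* Multiplicative ℚ_[p]) (hL : PadicTorsion.IsReasonableLogDet L)
    (M : Type) [AddCommGroup M] [Module ℤ[Γ] M]
    (hFL : PadicTorsion.IsTypeFL Γ M)
    (hexp : PadicTorsion.IsPadicallyExpansive Γ M p)
    (hlim : PadicTorsion.limTorsion p M = ⊥) :
    ∃ τ : ℚ_[p], PadicTorsion.HasPadicTorsion L M τ ∧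
      ∀ N : ℕ → FiniteIndexNormalSubgroup Γ, PadicTorsion.TendsToUnit N →
        (∀ n, PadicTorsion.IsEulerDefined M (N n).toSubgroup) ∧
        Tendsto
          (fun n => ((N n).toSubgroup.index : ℚ_[p])⁻¹ *
            PadicTorsion.padicLog p (PadicTorsion.eulerChar M (N n).toSubgroup : ℚ_[p]))
          atTop (𝓝 τ) := by
  -- An auxiliary sequence, used only to compare torsions of different resolutions.
  obtain ⟨N, hN⟩ := PadicTorsion.exists_tendsToUnit Γ
  obtain ⟨F⟩ := hFL
  obtain ⟨n, ⟨b⟩⟩ := F.exists_basis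
  obtain ⟨t, ht⟩ := PadicTorsion.FLResolution.exists_isTorsion b (F.isAcyclic hexp hlim)
  refine ⟨(L t).toAdd, fun F' => ⟨F'.isAcyclic hexp hlim, fun n' b' =>
    ⟨PadicTorsion.FLResolution.exists_isTorsion b' (F'.isAcyclic hexp hlim), fun t' ht' => ?_⟩⟩,
    fun N' hN' => ht.tendsto_eulerChar hL hN'⟩
  -- Both values are limits of the same sequence, which depends on M and `N` alone.
  exact tendsto_nhds_unique (ht'.tendsto_eulerChar hL hN).2 (ht.tendsto_eulerChar hL hN).2
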